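/- Let $1\le r\le n$, let $A_1,\dots,A_m\in\mathbb C^{n\times n}$ be Hermitian, and put $\langle x,y\rangle=\operatorname{Re}\operatorname{tr}(x^*y)$, $\|x\|=\|x\|_2=\sqrt{\langle x,x\rangle}$ (the Frobenius norm), $\pi(x)=xx^*$, $\beta_j(x)=\langle A_j,xx^*\rangle$ for $x\in\mathbb C^{n\times r}$. Write $x\sim y$ if $x=yU$ for some $U\in U(r)$, and $d(x,y)=\min_{U\in U(r)}\|x-yU\|\,\|x+yU\|$. Let $$a_0=\inf_{x\not\sim y}\frac{\|\beta(x)-\beta(y)\|^2}{\|xx^*-yy^*\|^2},$$ and for $z\in\mathbb C^{n\times r}$ of rank $k>0$ let (all quotients being over inequivalent pairs) $$a_1(z)=\lim_{R\to0^+}\inf_{\|\pi(x)-\pi(z)\|<R}\frac{\|\beta(x)-\beta(z)\|^2}{\|\pi(x)-\pi(z)\|^2},\qquad a_2(z)=\lim_{R\to0^+}\inf_{\|\pi(x)-\pi(z)\|<R,\ \|\pi(y)-\pi(z)\|<R}\frac{\|\beta(x)-\beta(y)\|^2}{\|\pi(x)-\pi(y)\|^2},$$ $$\hat a_1(z)=\lim_{R\to0^+}\inf_{\substack{d(x,z)<R\\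 \operatorname{rank}x\le k}}\frac{\|\beta(x)-\beta(z)\|^2}{d(x,z)^2},\qquad \hat a_2(z)=\lim_{R\to0^+}\inf_{\substack{d(x,z)<R,\ d(y,z)<R\\ \operatorname{rank}x,\operatorname{rank}y\le k}}\frac{\|\beta(x)-\beta(y)\|^2}{d(x,y)^2}.$$ Choose $\hat z\in\mathbb C^{n\times k}$ of rank $k$ with $z=[\hat z\,|\,0]U$, $U\in U(r)$; let $P$ be the orthogonal projection onto $\operatorname{Ran}(\hat z)=\operatorname{Ran}(z)$ and put $$T_z=\{W=W^*:(1-P)W(1-P)=0\},\qquad H_{\hat z}=\{H\hat z+X: H=H^*=PH,\ PX=0\},$$ $$a(z)=\min_{W\in T_z,\ \|W\|=1}\sum_j\langle W,A_j\rangle^2,\qquad \hat a(z)=\min_{w\in H_{\hat z},\ \|w\|=1}\sum_j\langle \hat zw^*+w\hat z^*,A_j\rangle^2 .$$ For $U_1\in\mathbb C^{n\times k}$, $U_2\in\mathbb C^{n\times(n-k)}$ with $[U_1|U_2]\in U(n)$ let $$Q_{[U_1|U_2]}=\sum_{j=1}^m v_jv_j^T,\qquad v_j=\begin{bmatrix}\tau(U_1^*A_jU_1)\\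 \sqrt2\,\mu(U_2^*A_jU_1)\end{bmatrix}\in\mathbb R^{2nk-k^2},$$ where $\tau(X)\in\mathbb R^{k^2}$ lists the diagonal entries of the Hermitian matrix $X$ and $\sqrt2$ times the real and the imaginary parts of its entries above the diagonal, and $\mu(Y)=\operatorname{vec}\begin{bmatrix}\operatorname{Re}Y\\ \operatorname{Im}Y\end{bmatrix}$ (columns stacked). Let $$\hat Q_z=4\sum_{j=1}^m F_j\,\mu(\hat z)\mu(\hat z)^TF_j,\qquad F_j=I_k\otimes\begin{bmatrix}\operatorname{Re}A_j&-\operatorname{Im}A_j\\ \operatorname{Im}A_j&\operatorname{Re}A_j\end{bmatrix}.$$ $\lambda_i$ denotes the $i$-th largest eigenvalue and $\sigma_i$ the $i$-th largest singular value. Then a reduction $\hat z$ exists, the limits and minima above exist, $a(z)$ and $\hat a(z)$ do not depend on $\hat z$, and, for every $z\in\mathbb C^{n\times r}$ of rank $k>0$: (i) $a_0=\inf_{z\ne0}a(z)$. (ii) $a_0\le a_2(z)\le a_1(z)\le a(z)$; in particular $a_0=\inf_{z\neq0}a_1(z)=\inf_{z\ne0}a_2(z)$. (iii) $a(z)=\lambda_{2nk-k^2}(Q_{[U_1|U_2]})$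 whenever the columns of $U_1$ and $U_2$ are orthonormal bases of $\operatorname{Ran}(z)$ and $\operatorname{Ran}(z)^\perp$ (such $U_1,U_2$ exist). (iv) If $r=1$, then $\frac1{4\|z\|^2}\hat a(z)\le a(z)\le\frac1{2\|z\|^2}\hat a(z)$, and if moreover $\beta$ is injective modulo $\sim$ (the family is generalized phase retrievable), then $\inf_{\|z\|=1}\hat a(z)>0$. If $r>1$, then $\inf_{z\ne0}\hat a(z)=0$, also $\inf_{\|z\|=1}\hat a(z)=0$, and there is no non-trivial global lower bound for the metric $d$: $\inf_{x\not\sim y}\|\beta(x)-\beta(y)\|^2/d(x,y)^2=0$. (v) $\hat a_1(z)=\hat a_2(z)=\frac1{4\|z\|^2}\hat a(z)$. (vi) $\hat a(z)=\lambda_{2nk-k^2}(\hat Q_z)$. (vii) $\frac1{4\|z\|^2}\hat a(z)\le a(z)\le\frac1{2\sigma_k(z)^2}\hat a(z)$. (viii) $a_0=\min\{\lambda_{2nr-r^2}(Q_{[U_1|U_2]}): [U_1|U_2]\in U(n),\ U_1\in\mathbb C^{n\times r}\}$, the minimum being attained. (ix) $\frac14\inf_{z^*z=I_r}\hat a(z)\le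 a_0\le\frac12\inf_{z^*z=I_r}\hat a(z)$. -/

import Mathlib

open Filter Topology
open scoped Matrix Matrix.Norms.Frobenius

noncomputable section

namespace PhaseRetrieval

/-! Throughout, `‖·‖` on matrices is the Frobenius (Schatten-2) norm. -/

/-- The real inner product `Re tr(x* y)` on complex matrices. -/
def rinner {p q : ℕ} (x y : Matrix (Fin p) (Fin q) ℂ) : ℝ := (Matrix.trace (xᴴ * y)).re

/-- `x ∼ y`: the matrices agree up to right multiplication by a unitary matrix. -/
def UEquiv {n r : ℕ} (x y : Matrix (Fin n) (Fin r) ℂ) : Prop :=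
  ∃ U ∈ Matrix.unitaryGroup (Fin r) ℂ, x = y * U

/-- `π(x) = x x*`. -/
def proj {n r : ℕ} (x : Matrix (Fin n) (Fin r) ℂ) : Matrix (Fin n) (Fin n) ℂ := x * xᴴ

/-- The derivative of `π` at `x` in the direction `w`, namely `x w* + w x*`. -/
def dproj {n r : ℕ} (x w : Matrix (Fin n) (Fin r) ℂ) : Matrix (Fin n) (Fin n) ℂ :=
  x * wᴴ + w * xᴴ

/-- `dproj x w` is indeed the directional derivative of `proj`. -/
theorem hasDerivAt_proj {n r : ℕ} (x w : Matrix (Fin n) (Fin r) ℂ) :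
    HasDerivAt (fun t : ℝ => proj (x + t • w)) (dproj x w) 0 := by
  have h : (fun t : ℝ => proj (x + t • w)) =
      fun t : ℝ => proj x + t • dproj x w + (t ^ 2) • proj w := by
    funext t
    simp only [proj, dproj, Matrix.conjTranspose_add, Matrix.conjTranspose_smul, star_trivial,
      Matrix.add_mul, Matrix.mul_add, Matrix.smul_mul, Matrix.mul_smul, smul_add, smul_smul, pow_two]
    abel
  rw [h]
  have h1 : HasDerivAt (fun t : ℝ => t • dproj x w) ((1 : ℝ) • dproj x w) 0 :=
    (hasDerivAt_id (0 : ℝ)).smul_const _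
  have h2 : HasDerivAt (fun t : ℝ => (t ^ 2) • proj w)
      (((2 : ℕ) * (0 : ℝ) ^ (2 - 1)) • proj w) 0 := (hasDerivAt_pow 2 (0 : ℝ)).smul_const _
  have h3 := (h1.const_add (proj x)).add h2
  exact h3.congr_deriv (by simp)

/-- The components `β_j(x) = ⟨A_j, x x*⟩` of the analysis map. -/
def beta {n r m : ℕ} (A : Fin m → Matrix (Fin n) (Fin n) ℂ) (x : Matrix (Fin n) (Fin r) ℂ)
    (j : Fin m) : ℝ := rinner (A j) (proj x)

/-- The squared Euclidean distance `‖β(x) - β(y)‖²`. -/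
def betaDistSq {n r m : ℕ} (A : Fin m → Matrix (Fin n) (Fin n) ℂ)
    (x y : Matrix (Fin n) (Fin r) ℂ) : ℝ := ∑ j, (beta A x j - beta A y j) ^ 2

/-- The family `A` is generalized phase retrievable for `n × r` matrices: `β` is injective
modulo the right action of the unitary group. -/
def PhaseRetrievable {n m : ℕ} (r : ℕ) (A : Fin m → Matrix (Fin n) (Fin n) ℂ) : Prop :=
  ∀ x y : Matrix (Fin n) (Fin r) ℂ, beta A x = beta A y → UEquiv x y

/-- The metric `d(x,y) = min_U ‖x - yU‖ ‖x + yU‖`, with `U` ranging over the unitary group. -/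
def dMetric {n r : ℕ} (x y : Matrix (Fin n) (Fin r) ℂ) : ℝ :=
  ⨅ U : Matrix.unitaryGroup (Fin r) ℂ,
    ‖x - y * (U : Matrix (Fin r) (Fin r) ℂ)‖ * ‖x + y * (U : Matrix (Fin r) (Fin r) ℂ)‖

/-- The squared global lower Lipschitz constant `a₀` of `β` with respect to `‖xx* - yy*‖`. -/
def aGlobal {n m : ℕ} (r : ℕ) (A : Fin m → Matrix (Fin n) (Fin n) ℂ) : ℝ :=
  sInf {s | ∃ x y : Matrix (Fin n) (Fin r) ℂ, ¬ UEquiv x y ∧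
    s = betaDistSq A x y / ‖proj x - proj y‖ ^ 2}

/-! Local lower Lipschitz bounds at `z`: limits, as the radius `R` decreases to `0`, of the
infima below. The quotients are taken over pairs of inequivalent matrices. -/

/-- The infimum over the ball of radius `R` in the definition of `a₁(z)`. -/
def localInf1 {n r m : ℕ} (A : Fin m → Matrix (Fin n) (Fin n) ℂ) (z : Matrix (Fin n) (Fin r) ℂ)
    (R : ℝ) : ℝ :=
  sInf {s | ∃ x : Matrix (Fin n) (Fin r) ℂ, ‖proj x - proj z‖ < R ∧ ¬ UEquiv x z ∧
    s = betaDistSq A x z / ‖proj x - proj z‖ ^ 2}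

/-- The infimum over the ball of radius `R` in the definition of `a₂(z)`. -/
def localInf2 {n r m : ℕ} (A : Fin m → Matrix (Fin n) (Fin n) ℂ) (z : Matrix (Fin n) (Fin r) ℂ)
    (R : ℝ) : ℝ :=
  sInf {s | ∃ x y : Matrix (Fin n) (Fin r) ℂ, ‖proj x - proj z‖ < R ∧ ‖proj y - proj z‖ < R ∧
    ¬ UEquiv x y ∧ s = betaDistSq A x y / ‖proj x - proj y‖ ^ 2}

/-- The infimum over the ball of radius `R` in the definition of `â₁(z)`. -/
def localInfHat1 {n r m : ℕ} (A : Fin m → Matrix (Fin n) (Fin n) ℂ)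
    (z : Matrix (Fin n) (Fin r) ℂ) (R : ℝ) : ℝ :=
  sInf {s | ∃ x : Matrix (Fin n) (Fin r) ℂ, dMetric x z < R ∧ x.rank ≤ z.rank ∧
    ¬ UEquiv x z ∧ s = betaDistSq A x z / dMetric x z ^ 2}

/-- The infimum over the ball of radius `R` in the definition of `â₂(z)`. -/
def localInfHat2 {n r m : ℕ} (A : Fin m → Matrix (Fin n) (Fin n) ℂ)
    (z : Matrix (Fin n) (Fin r) ℂ) (R : ℝ) : ℝ :=
  sInf {s | ∃ x y : Matrix (Fin n) (Fin r) ℂ, dMetric x z < R ∧ dMetric y z < R ∧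
    x.rank ≤ z.rank ∧ y.rank ≤ z.rank ∧
    ¬ UEquiv x y ∧ s = betaDistSq A x y / dMetric x y ^ 2}

/-- `a₁(z)`. -/
def aOne {n r m : ℕ} (A : Fin m → Matrix (Fin n) (Fin n) ℂ) (z : Matrix (Fin n) (Fin r) ℂ) : ℝ :=
  limUnder (𝓝[>] (0 : ℝ)) (localInf1 A z)

/-- `a₂(z)`. -/
def aTwo {n r m : ℕ} (A : Fin m → Matrix (Fin n) (Fin n) ℂ) (z : Matrix (Fin n) (Fin r) ℂ) : ℝ :=
  limUnder (𝓝[>] (0 : ℝ)) (localInf2 A z)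

/-- `â₁(z)`. -/
def aHatOne {n r m : ℕ} (A : Fin m → Matrix (Fin n) (Fin n) ℂ)
    (z : Matrix (Fin n) (Fin r) ℂ) : ℝ :=
  limUnder (𝓝[>] (0 : ℝ)) (localInfHat1 A z)

/-- `â₂(z)`. -/
def aHatTwo {n r m : ℕ} (A : Fin m → Matrix (Fin n) (Fin n) ℂ)
    (z : Matrix (Fin n) (Fin r) ℂ) : ℝ :=
  limUnder (𝓝[>] (0 : ℝ)) (localInfHat2 A z)

/-- The matrix of the orthogonal projection of `ℂⁿ` onto the range of `x`. -/
def rangeProj {n k : ℕ} (x : Matrix (Fin n) (Fin k) ℂ) : Matrix (Fin n) (Fin n) ℂ :=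
  Matrix.toEuclideanLin.symm
    ((LinearMap.range (Matrix.toEuclideanLin x)).starProjection :
      EuclideanSpace ℂ (Fin n) →ₗ[ℂ] EuclideanSpace ℂ (Fin n))

/-- The tangent space at `x x*` of the manifold of positive semidefinite matrices of rank `k`,
for `x` an `n × k` matrix of rank `k`. -/
def tangentSpace {n k : ℕ} (x : Matrix (Fin n) (Fin k) ℂ) : Set (Matrix (Fin n) (Fin n) ℂ) :=
  {W | W.IsHermitian ∧ (1 - rangeProj x) * W * (1 - rangeProj x) = 0}

/-- The horizontal space at `x` of the map `π` on `n × k` matrices of rank `k`. -/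
def horizontalSpace {n k : ℕ} (x : Matrix (Fin n) (Fin k) ℂ) : Set (Matrix (Fin n) (Fin k) ℂ) :=
  {w | ∃ (H : Matrix (Fin n) (Fin n) ℂ) (X : Matrix (Fin n) (Fin k) ℂ),
    H.IsHermitian ∧ rangeProj x * H = H ∧ rangeProj x * X = 0 ∧ w = H * x + X}

/-- `[x | 0]`: the `n × k` matrix `x` completed by zero columns to an `n × r` matrix. -/
def padZero {n k : ℕ} (r : ℕ) (x : Matrix (Fin n) (Fin k) ℂ) : Matrix (Fin n) (Fin r) ℂ :=
  Matrix.of fun i j => if h : (j : ℕ) < k then x i ⟨j, h⟩ else 0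

/-- `ẑ` is a full-rank `n × k` matrix with `z = [ẑ | 0] U` for some unitary `U`. -/
def IsReduction {n r k : ℕ} (z : Matrix (Fin n) (Fin r) ℂ) (zhat : Matrix (Fin n) (Fin k) ℂ) :
    Prop :=
  k ≤ r ∧ zhat.rank = k ∧ ∃ U ∈ Matrix.unitaryGroup (Fin r) ℂ, z = padZero r zhat * U

/-- The values `∑ⱼ ⟨W, A_j⟩²` at unit tangent vectors `W` at `ẑ ẑ*`. -/
def tangentValues {n k m : ℕ} (A : Fin m → Matrix (Fin n) (Fin n) ℂ)
    (zhat : Matrix (Fin n) (Fin k) ℂ) : Set ℝ :=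
  {s | ∃ W ∈ tangentSpace zhat, ‖W‖ = 1 ∧ s = ∑ j, rinner W (A j) ^ 2}

/-- The values `∑ⱼ ⟨Dπ(ẑ)(w), A_j⟩²` at unit horizontal vectors `w` at `ẑ`. -/
def horizontalValues {n k m : ℕ} (A : Fin m → Matrix (Fin n) (Fin n) ℂ)
    (zhat : Matrix (Fin n) (Fin k) ℂ) : Set ℝ :=
  {s | ∃ w ∈ horizontalSpace zhat, ‖w‖ = 1 ∧ s = ∑ j, rinner (dproj zhat w) (A j) ^ 2}

/-- `a(z)`. It does not depend on the reduction `ẑ` of `z`. -/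
def aGeom {n r m : ℕ} (A : Fin m → Matrix (Fin n) (Fin n) ℂ) (z : Matrix (Fin n) (Fin r) ℂ) : ℝ :=
  sInf {s | ∃ zhat : Matrix (Fin n) (Fin z.rank) ℂ, IsReduction z zhat ∧ s ∈ tangentValues A zhat}

/-- `â(z)`. It does not depend on the reduction `ẑ` of `z`. -/
def aHatGeom {n r m : ℕ} (A : Fin m → Matrix (Fin n) (Fin n) ℂ)
    (z : Matrix (Fin n) (Fin r) ℂ) : ℝ :=
  sInf {s | ∃ zhat : Matrix (Fin n) (Fin z.rank) ℂ,
    IsReduction z zhat ∧ s ∈ horizontalValues A zhat}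

/-- The `i`-th largest eigenvalue (counted from `1`, with multiplicity) of a real symmetric
matrix. -/
def lam {ι : Type} [Fintype ι] [DecidableEq ι] (i : ℕ) (M : Matrix ι ι ℝ) : ℝ :=
  if h : M.IsHermitian ∧ 1 ≤ i ∧ i ≤ Fintype.card ι then
    h.1.eigenvalues₀ ⟨i - 1, by omega⟩
  else 0

/-- Positions strictly above the diagonal of a `k × k` matrix. -/
abbrev UpperIdx (k : ℕ) : Type := {p : Fin k × Fin k // p.1 < p.2}

/-- Index set of the coordinates of a Hermitian `k × k` matrix. -/
abbrev TauIdx (k : ℕ) : Type := Fin k ⊕ (UpperIdx k ⊕ UpperIdx k)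

/-- Index set of the real coordinates of a complex `p × q` matrix, column by column. -/
abbrev MuIdx (p q : ℕ) : Type := Fin q × (Fin p ⊕ Fin p)

/-- The isometry `τ` from Hermitian `k × k` matrices to `ℝ^(k²)`: the diagonal, then `√2` times
the real parts and `√2` times the imaginary parts of the entries above the diagonal. -/
def tau {k : ℕ} (X : Matrix (Fin k) (Fin k) ℂ) : TauIdx k → ℝ :=
  Sum.elim (fun i => (X i i).re)
    (Sum.elim (fun p => √2 * (X p.1.1 p.1.2).re) (fun p => √2 * (X p.1.1 p.1.2).im))

/-- The isometry `μ` from complex `p × q` matrices to `ℝ^(2pq)`: the columns of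
`[Re X; Im X]`. -/
def mu {p q : ℕ} (X : Matrix (Fin p) (Fin q) ℂ) : MuIdx p q → ℝ :=
  fun c => Sum.elim (fun i => (X i c.1).re) (fun i => (X i c.1).im) c.2

/-- The coordinates `[τ(U₁* B U₁); √2 μ(U₂* B U₁)]`, in an orthonormal basis, of the orthogonal
projection of the Hermitian matrix `B` to the tangent space determined by `[U₁ | U₂]`. -/
def qVec {n k : ℕ} (U1 : Matrix (Fin n) (Fin k) ℂ) (U2 : Matrix (Fin n) (Fin (n - k)) ℂ)
    (B : Matrix (Fin n) (Fin n) ℂ) : TauIdx k ⊕ MuIdx (n - k) k → ℝ :=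
  Sum.elim (tau (U1ᴴ * B * U1)) (fun c => √2 * mu (U2ᴴ * B * U1) c)

/-- The matrix `Q_[U₁|U₂]`. -/
def qMat {n k m : ℕ} (A : Fin m → Matrix (Fin n) (Fin n) ℂ) (U1 : Matrix (Fin n) (Fin k) ℂ)
    (U2 : Matrix (Fin n) (Fin (n - k)) ℂ) :
    Matrix (TauIdx k ⊕ MuIdx (n - k) k) (TauIdx k ⊕ MuIdx (n - k) k) ℝ :=
  ∑ j, Matrix.vecMulVec (qVec U1 U2 (A j)) (qVec U1 U2 (A j))

/-- The real form `[Re X, -Im X; Im X, Re X]` of a complex matrix. -/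
def realify {n : ℕ} (X : Matrix (Fin n) (Fin n) ℂ) : Matrix (Fin n ⊕ Fin n) (Fin n ⊕ Fin n) ℝ :=
  Matrix.fromBlocks (X.map Complex.re) (-(X.map Complex.im)) (X.map Complex.im) (X.map Complex.re)

/-- The matrix `F = I_k ⊗ j(B)`. -/
def fMat {n : ℕ} (k : ℕ) (B : Matrix (Fin n) (Fin n) ℂ) : Matrix (MuIdx n k) (MuIdx n k) ℝ :=
  Matrix.kronecker (1 : Matrix (Fin k) (Fin k) ℝ) (realify B)

/-- The matrix `Q̂ = 4 ∑ⱼ F_j μ(ẑ) μ(ẑ)ᵀ F_j`. -/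
def qHatMat {n k m : ℕ} (A : Fin m → Matrix (Fin n) (Fin n) ℂ)
    (zhat : Matrix (Fin n) (Fin k) ℂ) : Matrix (MuIdx n k) (MuIdx n k) ℝ :=
  (4 : ℝ) • ∑ j, fMat k (A j) * Matrix.vecMulVec (mu zhat) (mu zhat) * fMat k (A j)

/-- `U₁` and `U₂` have as columns orthonormal bases of the range of `z` and of its orthogonal
complement (left singular vectors of `z` for the non-zero and the zero singular values). -/
def IsAdapted {n r k : ℕ} (z : Matrix (Fin n) (Fin r) ℂ) (U1 : Matrix (Fin n) (Fin k) ℂ)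
    (U2 : Matrix (Fin n) (Fin (n - k)) ℂ) : Prop :=
  U1ᴴ * U1 = 1 ∧ U2ᴴ * U2 = 1 ∧ U1 * U1ᴴ = rangeProj z ∧ U2 * U2ᴴ = 1 - rangeProj z

/-- The first `r` columns of a square matrix. -/
def leftCols {n r : ℕ} (h : r ≤ n) (U : Matrix (Fin n) (Fin n) ℂ) : Matrix (Fin n) (Fin r) ℂ :=
  U.submatrix id (Fin.castLE h)

/-- The last `n - r` columns of a square matrix. -/
def rightCols {n r : ℕ} (h : r ≤ n) (U : Matrix (Fin n) (Fin n) ℂ) :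
    Matrix (Fin n) (Fin (n - r)) ℂ :=
  U.submatrix id fun i => ⟨r + (i : ℕ), by omega⟩

/-- `k`-th largest singular value, counted from `1`. -/
def sigma {n r : ℕ} (k : ℕ) (z : Matrix (Fin n) (Fin r) ℂ) : ℝ :=
  (Matrix.toEuclideanLin z).singularValues (k - 1)

end PhaseRetrieval

end

open PhaseRetrieval

/-!
The starting point is that `π(x) = xx*` is quadratic: `xx* - yy* = Dπ(s)(w)` holds exactly, with
`s = (x + y)/2` and `w = x - y` (`proj_sub_proj`). As `β` is linear in `xx*`, the numerator
`‖β(x) - β(y)‖²` is the value of the quadratic form `W ↦ ∑ⱼ ⟨W, A_j⟩²` at `W = Dπ(s)(w)`, and the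
tangent space `T_z` is the range of `Dπ(z)` (`mem_tangentSpace_iff`).

Hence every quotient for the Frobenius distance is the value of the form at a unit vector of some
`T_s`, and conversely every unit vector of `T_z` arises from a pair `z ± w/2`; this gives
`a₀ = inf a`. The curves `z + t w` give `a₁ ≤ a`, and the limits exist by monotonicity in the
radius. Enlarging the range of `z` enlarges `T_z`, so that the infimum may be restricted to matrices
with orthonormal columns, where compactness of the set of pairs of a unitary matrix and a unit
tangent vector provides a minimizer (`exists_unitary_aGeom_eq_aGlobal`).

For the metric `d` one aligns: by polar decomposition each pair has representatives with `x* y`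
positive semidefinite, for which `d(x, y) = ‖x - y‖ ‖x + y‖` (`dMetric_of_posSemidef`). Then `s* w`
is Hermitian, that is, `w` is horizontal at `s` (`mem_horizontalSpace_iff`), and
`‖x - y‖ ‖x + y‖ = 2 ‖w‖ ‖s‖`. So the quotient for `d` is the normalized horizontal value at the
midpoint `s`. Near a matrix `ẑ` of full column rank this normalized value is lower semicontinuous,
uniformly over unit directions (`eventually_le_horizontal`), while a small move in a horizontal
direction keeps the pair aligned (`eventually_horizontal_curve`); the two facts bound `â₂` from
below and `â₁` from above by `â(z)/(4‖z‖²)`.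

The comparisons of `a` and `â` all come from `‖Dπ(s)(w)‖² = 2‖s w*‖² + 2‖s* w‖²` for horizontal `w`
(`norm_dproj_sq`). With at least two columns, `√(1 - t²) e₁` and `t e₂` as columns make `â` of order
`t²`, so all bounds for `d` degenerate. Finally, in real coordinates `Q` and `Q̂` are Gram
matrices whose quadratic forms take the tangent and the horizontal values, and the eigenvalues in
question are minima of these forms by the variational principle `lam_eq_of_isLeast`. For `Q̂` the
`k²` directions to be discarded are the vertical ones, on which `Dπ` vanishes.
-/

namespace PhaseRetrieval

/-! ### The real Frobenius inner product -/

theorem rinner_eq_sum {p q : ℕ} (x y : Matrix (Fin p) (Fin q) ℂ) :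
    rinner x y = ∑ j, ∑ i, (star (x i j) * y i j).re := by
  simp [rinner, Matrix.trace, Matrix.mul_apply, Matrix.conjTranspose_apply]

theorem rinner_self {p q : ℕ} (x : Matrix (Fin p) (Fin q) ℂ) : rinner x x = ‖x‖ ^ 2 := by
  rw [rinner_eq_sum, Matrix.frobenius_norm_def, ← Real.sqrt_eq_rpow, Real.sq_sqrt (by positivity),
    Finset.sum_comm]
  refine Finset.sum_congr rfl fun i _ => Finset.sum_congr rfl fun j _ => ?_
  rw [Real.rpow_two, ← Complex.normSq_eq_norm_sq, Complex.normSq_apply]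
  simp

theorem rinner_comm {p q : ℕ} (x y : Matrix (Fin p) (Fin q) ℂ) : rinner x y = rinner y x := by
  rw [rinner_eq_sum, rinner_eq_sum]
  refine Finset.sum_congr rfl fun j _ => Finset.sum_congr rfl fun i _ => ?_
  simp; ring

theorem rinner_add_right {p q : ℕ} (x y z : Matrix (Fin p) (Fin q) ℂ) :
    rinner x (y + z) = rinner x y + rinner x z := by
  simp [rinner, Matrix.mul_add]

theorem rinner_sub_right {p q : ℕ} (x y z : Matrix (Fin p) (Fin q) ℂ) :
    rinner x (y - z) = rinner x y - rinner x z := by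
  simp [rinner, Matrix.mul_sub]

theorem rinner_add_left {p q : ℕ} (x y z : Matrix (Fin p) (Fin q) ℂ) :
    rinner (x + y) z = rinner x z + rinner y z := by
  rw [rinner_comm, rinner_add_right, rinner_comm z, rinner_comm z]

theorem rinner_sub_left {p q : ℕ} (x y z : Matrix (Fin p) (Fin q) ℂ) :
    rinner (x - y) z = rinner x z - rinner y z := by
  rw [rinner_comm, rinner_sub_right, rinner_comm z, rinner_comm z]

theorem rinner_smul_right {p q : ℕ} (t : ℝ) (x y : Matrix (Fin p) (Fin q) ℂ) :
    rinner x (t • y) = t * rinner x y := by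
  simp [rinner]

theorem rinner_smul_left {p q : ℕ} (t : ℝ) (x y : Matrix (Fin p) (Fin q) ℂ) :
    rinner (t • x) y = t * rinner x y := by
  rw [rinner_comm, rinner_smul_right, rinner_comm]

theorem rinner_zero_right {p q : ℕ} (x : Matrix (Fin p) (Fin q) ℂ) : rinner x 0 = 0 := by
  simp [rinner]

theorem rinner_mul_left {p q s : ℕ} (B : Matrix (Fin p) (Fin s) ℂ) (x : Matrix (Fin s) (Fin q) ℂ)
    (y : Matrix (Fin p) (Fin q) ℂ) : rinner (B * x) y = rinner x (Bᴴ * y) := by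
  simp only [rinner, Matrix.conjTranspose_mul, Matrix.mul_assoc]

theorem rinner_mul_right {p q s : ℕ} (x : Matrix (Fin p) (Fin s) ℂ) (B : Matrix (Fin s) (Fin q) ℂ)
    (y : Matrix (Fin p) (Fin q) ℂ) : rinner (x * B) y = rinner x (y * Bᴴ) := by
  simp only [rinner, Matrix.conjTranspose_mul, Matrix.mul_assoc]
  rw [Matrix.trace_mul_comm, Matrix.mul_assoc]

theorem rinner_conjTranspose {p q : ℕ} (x y : Matrix (Fin p) (Fin q) ℂ) :
    rinner xᴴ yᴴ = rinner x y := by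
  rw [rinner_comm x y]
  simp only [rinner, Matrix.conjTranspose_conjTranspose]
  rw [Matrix.trace_mul_comm]

theorem norm_add_sq_eq {p q : ℕ} (x y : Matrix (Fin p) (Fin q) ℂ) :
    ‖x + y‖ ^ 2 = ‖x‖ ^ 2 + 2 * rinner x y + ‖y‖ ^ 2 := by
  rw [← rinner_self, rinner_add_left, rinner_add_right, rinner_add_right, rinner_comm y x,
    rinner_self, rinner_self]
  ring

theorem norm_sub_sq_eq {p q : ℕ} (x y : Matrix (Fin p) (Fin q) ℂ) :
    ‖x - y‖ ^ 2 = ‖x‖ ^ 2 - 2 * rinner x y + ‖y‖ ^ 2 := by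
  rw [← rinner_self, rinner_sub_left, rinner_sub_right, rinner_sub_right, rinner_comm y x,
    rinner_self, rinner_self]
  ring

theorem abs_rinner_le {p q : ℕ} (x y : Matrix (Fin p) (Fin q) ℂ) :
    |rinner x y| ≤ ‖x‖ * ‖y‖ := by
  have key (t : ℝ) : 0 ≤ ‖y‖ ^ 2 * (t * t) + (2 * rinner x y) * t + ‖x‖ ^ 2 := by
    have h := norm_add_sq_eq x (t • y)
    rw [rinner_smul_right, norm_smul, mul_pow, Real.norm_eq_abs, sq_abs] at h
    nlinarith [sq_nonneg ‖x + t • y‖]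
  have h := discrim_le_zero key
  rw [discrim] at h
  exact abs_le_of_sq_le_sq (by nlinarith) (by positivity)

theorem norm_mul_coisometry {p q s : ℕ} (x : Matrix (Fin p) (Fin s) ℂ)
    {V : Matrix (Fin s) (Fin q) ℂ} (hV : V * Vᴴ = 1) : ‖x * V‖ = ‖x‖ := by
  rw [← sq_eq_sq₀ (norm_nonneg _) (norm_nonneg _), ← rinner_self, ← rinner_self, rinner_mul_right,
    Matrix.mul_assoc, hV, Matrix.mul_one]

theorem norm_isometry_mul {p q s : ℕ} (x : Matrix (Fin s) (Fin q) ℂ)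
    {V : Matrix (Fin p) (Fin s) ℂ} (hV : Vᴴ * V = 1) : ‖V * x‖ = ‖x‖ := by
  rw [← sq_eq_sq₀ (norm_nonneg _) (norm_nonneg _), ← rinner_self, ← rinner_self, rinner_mul_left,
    ← Matrix.mul_assoc, hV, Matrix.one_mul]

theorem continuous_rinner {p q : ℕ} (y : Matrix (Fin p) (Fin q) ℂ) :
    Continuous fun x : Matrix (Fin p) (Fin q) ℂ => rinner x y := by
  unfold rinner
  fun_prop

/-! ### The maps `π` and `Dπ` -/

theorem dproj_isHermitian {n r : ℕ} (x w : Matrix (Fin n) (Fin r) ℂ) : (dproj x w).IsHermitian := by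
  simp [Matrix.IsHermitian, dproj, add_comm]

theorem proj_mul_coisometry {n r s : ℕ} (x : Matrix (Fin n) (Fin s) ℂ)
    {V : Matrix (Fin s) (Fin r) ℂ} (hV : V * Vᴴ = 1) : proj (x * V) = proj x := by
  rw [proj, proj, Matrix.conjTranspose_mul, Matrix.mul_assoc, ← Matrix.mul_assoc V, hV,
    Matrix.one_mul]

theorem dproj_mul_coisometry {n r s : ℕ} (x w : Matrix (Fin n) (Fin s) ℂ)
    {V : Matrix (Fin s) (Fin r) ℂ} (hV : V * Vᴴ = 1) : dproj (x * V) (w * V) = dproj x w := by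
  simp only [dproj, Matrix.conjTranspose_mul, Matrix.mul_assoc]
  simp only [← Matrix.mul_assoc V, hV, Matrix.one_mul]

theorem dproj_add_right {n r : ℕ} (x v w : Matrix (Fin n) (Fin r) ℂ) :
    dproj x (v + w) = dproj x v + dproj x w := by
  simp only [dproj, Matrix.conjTranspose_add, Matrix.mul_add, Matrix.add_mul]
  abel

theorem dproj_smul_right {n r : ℕ} (t : ℝ) (x w : Matrix (Fin n) (Fin r) ℂ) :
    dproj x (t • w) = t • dproj x w := by
  simp [dproj, smul_add]

theorem dproj_zero_left {n r : ℕ} (w : Matrix (Fin n) (Fin r) ℂ) : dproj 0 w = 0 := by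
  simp [dproj]

/-- Differences of values of `π` are exact values of its derivative at the midpoint. -/
theorem proj_sub_proj {n r : ℕ} (x y : Matrix (Fin n) (Fin r) ℂ) :
    proj x - proj y = dproj ((2⁻¹ : ℝ) • (x + y)) (x - y) := by
  have h : (2 : ℝ) • (proj x - proj y) = dproj (x + y) (x - y) := by
    simp only [proj, dproj, Matrix.conjTranspose_add, Matrix.conjTranspose_sub, Matrix.mul_add,
      Matrix.add_mul, Matrix.mul_sub, Matrix.sub_mul, two_smul]
    abel
  have h2 : dproj ((2⁻¹ : ℝ) • (x + y)) (x - y) = (2⁻¹ : ℝ) • dproj (x + y) (x - y) := by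
    rw [dproj, dproj, Matrix.conjTranspose_smul, star_trivial, Matrix.smul_mul, Matrix.mul_smul,
      smul_add]
  rw [h2, ← h, smul_smul]
  norm_num

theorem proj_add_smul {n r : ℕ} (x w : Matrix (Fin n) (Fin r) ℂ) (t : ℝ) :
    proj (x + t • w) = proj x + t • dproj x w + t ^ 2 • proj w := by
  simp only [proj, dproj, Matrix.conjTranspose_add, Matrix.conjTranspose_smul, star_trivial,
    Matrix.add_mul, Matrix.mul_add, Matrix.smul_mul, Matrix.mul_smul, smul_add, smul_smul, pow_two]
  abel

theorem norm_dproj_le {n r : ℕ} (x w : Matrix (Fin n) (Fin r) ℂ) :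
    ‖dproj x w‖ ≤ 2 * ‖x‖ * ‖w‖ := by
  refine (norm_add_le _ _).trans ?_
  have h1 := Matrix.frobenius_norm_mul x wᴴ
  have h2 := Matrix.frobenius_norm_mul w xᴴ
  rw [Matrix.frobenius_norm_conjTranspose] at h1 h2
  nlinarith

/-- On directions `w` with `s* w` Hermitian the norm of `Dπ(s)(w)` splits into two nonnegative
terms; this drives every comparison between `‖xx* - yy*‖` and `‖x - y‖`. -/
theorem norm_dproj_sq {n r : ℕ} {s w : Matrix (Fin n) (Fin r) ℂ} (h : (sᴴ * w).IsHermitian) :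
    ‖dproj s w‖ ^ 2 = 2 * ‖s * wᴴ‖ ^ 2 + 2 * ‖sᴴ * w‖ ^ 2 := by
  have h1 : w * sᴴ = (s * wᴴ)ᴴ := by simp
  have h2 : rinner (s * wᴴ) (w * sᴴ) = ‖sᴴ * w‖ ^ 2 := by
    rw [rinner_mul_left, ← rinner_self, ← Matrix.mul_assoc, rinner_comm, rinner_mul_right,
      Matrix.conjTranspose_conjTranspose]
    have h3 : wᴴ * s = sᴴ * w := by
      have := h.eq
      rwa [Matrix.conjTranspose_mul, Matrix.conjTranspose_conjTranspose] at this
    rw [← rinner_conjTranspose]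
    simp only [rinner, Matrix.conjTranspose_mul, Matrix.conjTranspose_conjTranspose, h3]
  rw [dproj, norm_add_sq_eq, h2, h1, Matrix.frobenius_norm_conjTranspose]
  ring

theorem continuous_dproj {n r : ℕ} :
    Continuous fun p : Matrix (Fin n) (Fin r) ℂ × Matrix (Fin n) (Fin r) ℂ => dproj p.1 p.2 := by
  unfold dproj
  fun_prop

/-! ### The quadratic form of the family `A` -/

/-- The quadratic form `W ↦ ∑ⱼ ⟨W, A_j⟩²` on matrices. -/
noncomputable def qform {n m : ℕ} (A : Fin m → Matrix (Fin n) (Fin n) ℂ)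
    (W : Matrix (Fin n) (Fin n) ℂ) : ℝ := ∑ j, rinner W (A j) ^ 2

theorem qform_nonneg {n m : ℕ} (A : Fin m → Matrix (Fin n) (Fin n) ℂ)
    (W : Matrix (Fin n) (Fin n) ℂ) : 0 ≤ qform A W :=
  Finset.sum_nonneg fun _ _ => sq_nonneg _

theorem qform_smul {n m : ℕ} (A : Fin m → Matrix (Fin n) (Fin n) ℂ) (t : ℝ)
    (W : Matrix (Fin n) (Fin n) ℂ) : qform A (t • W) = t ^ 2 * qform A W := by
  simp only [qform, rinner_smul_left, mul_pow, Finset.mul_sum]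

theorem qform_le {n m : ℕ} (A : Fin m → Matrix (Fin n) (Fin n) ℂ)
    (W : Matrix (Fin n) (Fin n) ℂ) : qform A W ≤ (∑ j, ‖A j‖ ^ 2) * ‖W‖ ^ 2 := by
  rw [qform, Finset.sum_mul]
  refine Finset.sum_le_sum fun j _ => ?_
  rw [← sq_abs, ← mul_pow, mul_comm ‖A j‖]
  exact pow_le_pow_left₀ (abs_nonneg _) (abs_rinner_le _ _) 2

theorem continuous_qform {n m : ℕ} (A : Fin m → Matrix (Fin n) (Fin n) ℂ) :
    Continuous (qform A) := by
  unfold qform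
  exact continuous_finsetSum _ fun j _ => (continuous_rinner (A j)).pow 2

theorem betaDistSq_eq {n r m : ℕ} (A : Fin m → Matrix (Fin n) (Fin n) ℂ)
    (x y : Matrix (Fin n) (Fin r) ℂ) : betaDistSq A x y = qform A (proj x - proj y) := by
  simp only [betaDistSq, beta, qform, ← rinner_sub_right]
  exact Finset.sum_congr rfl fun j _ => by rw [rinner_comm]

/-! ### Range projections and tangent spaces -/

theorem toEuclideanLin_rangeProj {n k : ℕ} (x : Matrix (Fin n) (Fin k) ℂ) :
    Matrix.toEuclideanLin (rangeProj x) =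
      ((LinearMap.range (Matrix.toEuclideanLin x)).starProjection :
      EuclideanSpace ℂ (Fin n) →ₗ[ℂ] EuclideanSpace ℂ (Fin n)) := by
  simp [rangeProj]

theorem rangeProj_isHermitian {n k : ℕ} (x : Matrix (Fin n) (Fin k) ℂ) :
    (rangeProj x).IsHermitian := by
  rw [← Matrix.isSymmetric_toEuclideanLin_iff, toEuclideanLin_rangeProj]
  exact (LinearMap.range (Matrix.toEuclideanLin x)).starProjection_isSymmetric

theorem rangeProj_mul_cancel {n k : ℕ} (x : Matrix (Fin n) (Fin k) ℂ) : rangeProj x * x = x := by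
  apply Matrix.toEuclideanLin.injective
  rw [Matrix.toLpLin_mul_same, toEuclideanLin_rangeProj]
  ext1 v
  exact Submodule.starProjection_eq_self_iff.2 (LinearMap.mem_range_self _ v)

theorem exists_rangeProj_eq_mul {n k : ℕ} (x : Matrix (Fin n) (Fin k) ℂ) :
    ∃ Y : Matrix (Fin k) (Fin n) ℂ, rangeProj x = x * Y := by
  have h : ∀ j : Fin n, ∃ u : Fin k → ℂ, (rangeProj x).col j = x *ᵥ u := fun j => by
    have h1 : Matrix.toEuclideanLin (rangeProj x) (WithLp.toLp 2 (Pi.single j 1)) ∈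
        LinearMap.range (Matrix.toEuclideanLin x) := by
      rw [toEuclideanLin_rangeProj]
      exact Submodule.starProjection_apply_mem _ _
    obtain ⟨u, hu⟩ := h1
    refine ⟨u.ofLp, ?_⟩
    have := congrArg WithLp.ofLp hu
    simp only [Matrix.ofLp_toLpLin, Matrix.toLin'_apply, Matrix.mulVec_single_one] at this
    exact this.symm
  choose u hu using h
  refine ⟨Matrix.of fun i j => u j i, ?_⟩
  ext i j
  exact congrFun (hu j) i

/-- A self-adjoint matrix that fixes `x` and factors through `x` is the range projection. -/
theorem eq_rangeProj {n k : ℕ} {x : Matrix (Fin n) (Fin k) ℂ} {P : Matrix (Fin n) (Fin n) ℂ}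
    {Y : Matrix (Fin k) (Fin n) ℂ} (hP : P.IsHermitian) (hPx : P * x = x) (hY : P = x * Y) :
    P = rangeProj x := by
  obtain ⟨Z, hZ⟩ := exists_rangeProj_eq_mul x
  have h1 : rangeProj x * P = P := by
    conv_lhs => rw [hY, ← Matrix.mul_assoc, rangeProj_mul_cancel]
    exact hY.symm
  have h2 : P * rangeProj x = rangeProj x := by
    conv_lhs => rw [hZ, ← Matrix.mul_assoc, hPx]
    exact hZ.symm
  have h3 := congrArg Matrix.conjTranspose h1
  rw [Matrix.conjTranspose_mul, hP.eq, (rangeProj_isHermitian x).eq, h2] at h3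
  exact h3.symm

theorem rangeProj_mul_self {n k : ℕ} (x : Matrix (Fin n) (Fin k) ℂ) :
    rangeProj x * rangeProj x = rangeProj x := by
  obtain ⟨Z, hZ⟩ := exists_rangeProj_eq_mul x
  conv_lhs => rw [hZ, ← Matrix.mul_assoc, ← hZ, rangeProj_mul_cancel]
  exact hZ.symm

theorem rangeProj_mul_coisometry {n k r : ℕ} (x : Matrix (Fin n) (Fin k) ℂ)
    {V : Matrix (Fin k) (Fin r) ℂ} (hV : V * Vᴴ = 1) : rangeProj (x * V) = rangeProj x := by
  obtain ⟨Z, hZ⟩ := exists_rangeProj_eq_mul x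
  refine (eq_rangeProj (Y := Vᴴ * Z) (rangeProj_isHermitian x) ?_ ?_).symm
  · rw [← Matrix.mul_assoc, rangeProj_mul_cancel]
  · rw [Matrix.mul_assoc, ← Matrix.mul_assoc V, hV, Matrix.one_mul, hZ]

theorem rangeProj_of_orthonormal {n k : ℕ} {U : Matrix (Fin n) (Fin k) ℂ} (hU : Uᴴ * U = 1) :
    rangeProj U = U * Uᴴ := by
  refine (eq_rangeProj (Y := Uᴴ) (Matrix.isHermitian_mul_conjTranspose_self U) ?_ rfl).symm
  rw [Matrix.mul_assoc, hU, Matrix.mul_one]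

theorem rangeProj_eq_of_rank_eq {n k l : ℕ} {x : Matrix (Fin n) (Fin k) ℂ}
    {y : Matrix (Fin n) (Fin l) ℂ} (h : rangeProj y * x = x) (hr : x.rank = y.rank) :
    rangeProj x = rangeProj y := by
  have hle : LinearMap.range (Matrix.toEuclideanLin x) ≤
      LinearMap.range (Matrix.toEuclideanLin y) := by
    rintro _ ⟨v, rfl⟩
    rw [← h, Matrix.toLpLin_mul_same, toEuclideanLin_rangeProj]
    exact Submodule.starProjection_apply_mem _ _
  have he := Submodule.eq_of_le_of_finrank_eq hle (by
    have h1 := Matrix.rank_eq_finrank_range_toLin x (EuclideanSpace.basisFun (Fin n) ℂ).toBasis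
      (EuclideanSpace.basisFun (Fin k) ℂ).toBasis
    have h2 := Matrix.rank_eq_finrank_range_toLin y (EuclideanSpace.basisFun (Fin n) ℂ).toBasis
      (EuclideanSpace.basisFun (Fin l) ℂ).toBasis
    rw [← Matrix.toEuclideanLin_eq_toLin_orthonormal] at h1 h2
    rw [← h1, ← h2, hr])
  simp only [rangeProj, he]

/-- The tangent space at `x x*` is the range of the derivative of `π` at `x`. -/
theorem mem_tangentSpace_iff {n k : ℕ} (x : Matrix (Fin n) (Fin k) ℂ)
    (W : Matrix (Fin n) (Fin n) ℂ) : W ∈ tangentSpace x ↔ ∃ w, W = dproj x w := by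
  set P := rangeProj x with hP
  have hPH : Pᴴ = P := (rangeProj_isHermitian x).eq
  have hPx : P * x = x := rangeProj_mul_cancel x
  constructor
  · rintro ⟨hW, h0⟩
    obtain ⟨Y, hY⟩ := exists_rangeProj_eq_mul x
    rw [← hP] at hY h0
    -- `W = P B* + B P` with `B = W - PW/2`, and `P = x Y = Y* x*`
    refine ⟨(W - (2⁻¹ : ℂ) • (P * W)) * Yᴴ, ?_⟩
    have hY' : Yᴴ * xᴴ = P := by rw [← Matrix.conjTranspose_mul, ← hY, hPH]
    have h1 : x * ((W - (2⁻¹ : ℂ) • (P * W)) * Yᴴ)ᴴ = P * (W - (2⁻¹ : ℂ) • (W * P)) := by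
      rw [hY, Matrix.conjTranspose_mul, ← hY, Matrix.conjTranspose_conjTranspose,
        ← Matrix.mul_assoc, ← hY]
      simp [Matrix.conjTranspose_sub, hW.eq, hPH]
    rw [dproj, h1, Matrix.mul_assoc _ Yᴴ, hY']
    have h2 : P * W * P = P * W + W * P - W := by
      simp only [Matrix.sub_mul, Matrix.mul_sub, Matrix.one_mul, Matrix.mul_one] at h0
      rw [← sub_eq_zero, ← h0]
      abel
    rw [Matrix.mul_sub, Matrix.sub_mul, Matrix.mul_smul, Matrix.smul_mul, ← Matrix.mul_assoc, h2]
    module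
  · rintro ⟨w, rfl⟩
    refine ⟨dproj_isHermitian x w, ?_⟩
    have h1 : (1 - P) * x = 0 := by rw [Matrix.sub_mul, Matrix.one_mul, hPx, sub_self]
    have h2 : xᴴ * (1 - P) = 0 := by
      have := congrArg Matrix.conjTranspose h1
      rwa [Matrix.conjTranspose_mul, Matrix.conjTranspose_sub, hPH, Matrix.conjTranspose_one,
        Matrix.conjTranspose_zero] at this
    rw [dproj, Matrix.mul_add, Matrix.add_mul, ← Matrix.mul_assoc, h1, ← Matrix.mul_assoc,
      Matrix.mul_assoc _ xᴴ, h2]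
    simp

/-- Enlarging the range enlarges the tangent space. -/
theorem tangentSpace_mono {n k l : ℕ} {x : Matrix (Fin n) (Fin k) ℂ}
    {y : Matrix (Fin n) (Fin l) ℂ} (h : rangeProj y * x = x) : tangentSpace x ⊆ tangentSpace y := by
  intro W hW
  obtain ⟨w, rfl⟩ := (mem_tangentSpace_iff x W).1 hW
  obtain ⟨Y, hY⟩ := exists_rangeProj_eq_mul y
  have hx : x = y * (Y * x) := by rw [← Matrix.mul_assoc, ← hY, h]
  refine (mem_tangentSpace_iff y _).2 ⟨w * (Y * x)ᴴ, ?_⟩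
  rw [hx, dproj, dproj, ← hx, Matrix.conjTranspose_mul, Matrix.conjTranspose_conjTranspose,
    ← Matrix.mul_assoc, ← hx, Matrix.mul_assoc w, ← Matrix.conjTranspose_mul, ← hx]

theorem tangentSpace_congr {n k l : ℕ} {x : Matrix (Fin n) (Fin k) ℂ}
    {y : Matrix (Fin n) (Fin l) ℂ} (h : rangeProj x = rangeProj y) :
    tangentSpace x = tangentSpace y := by
  rw [tangentSpace, tangentSpace, h]

theorem ne_zero_of_rank_pos {n k : ℕ} {x : Matrix (Fin n) (Fin k) ℂ} (hx : 0 < x.rank) :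
    x ≠ 0 := by
  rintro rfl
  simp at hx

/-! ### Unitary completions -/

theorem matrix_isometry_of_orthonormal {n k : ℕ} {b : Fin k → EuclideanSpace ℂ (Fin n)}
    (hb : Orthonormal ℂ b) :
    (Matrix.of fun i j => b j i : Matrix (Fin n) (Fin k) ℂ)ᴴ * (Matrix.of fun i j => b j i) =
      1 := by
  ext i j
  have h := (orthonormal_iff_ite.1 hb) i j
  rw [Matrix.one_apply, ← h, Matrix.mul_apply, PiLp.inner_apply]
  exact Finset.sum_congr rfl fun l _ => by simp [mul_comm]

theorem leftCols_isometry {n r : ℕ} (h : r ≤ n) {U : Matrix (Fin n) (Fin n) ℂ} (hU : Uᴴ * U = 1) :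
    (leftCols h U)ᴴ * leftCols h U = 1 := by
  ext i j
  have := congrFun (congrFun hU (Fin.castLE h i)) (Fin.castLE h j)
  simpa [leftCols, Matrix.mul_apply, Matrix.one_apply, Fin.ext_iff] using this

theorem rightCols_isometry {n r : ℕ} (h : r ≤ n) {U : Matrix (Fin n) (Fin n) ℂ} (hU : Uᴴ * U = 1) :
    (rightCols h U)ᴴ * rightCols h U = 1 := by
  ext i j
  have := congrFun (congrFun hU ⟨r + (i : ℕ), by omega⟩) ⟨r + (j : ℕ), by omega⟩
  simpa [rightCols, Matrix.mul_apply, Matrix.one_apply, Fin.ext_iff] using this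

theorem leftCols_add_rightCols {n r : ℕ} (h : r ≤ n) (U V : Matrix (Fin n) (Fin n) ℂ) :
    leftCols h U * (leftCols h V)ᴴ + rightCols h U * (rightCols h V)ᴴ = U * Vᴴ := by
  ext i j
  obtain ⟨s, rfl⟩ := Nat.exists_eq_add_of_le h
  simp only [leftCols, rightCols, Matrix.add_apply, Matrix.mul_apply, Matrix.submatrix_apply,
    Matrix.conjTranspose_apply, id]
  rw [Fin.sum_univ_add]
  congr 1
  refine Fintype.sum_equiv (finCongr (by omega)) _ _ fun x => rfl

theorem isAdapted_cols {n r : ℕ} (h : r ≤ n) {U : Matrix (Fin n) (Fin n) ℂ} (hU : Uᴴ * U = 1) :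
    IsAdapted (leftCols h U) (leftCols h U) (rightCols h U) := by
  refine ⟨leftCols_isometry h hU, rightCols_isometry h hU,
    (rangeProj_of_orthonormal (leftCols_isometry h hU)).symm, ?_⟩
  rw [rangeProj_of_orthonormal (leftCols_isometry h hU), eq_sub_iff_add_eq, add_comm,
    leftCols_add_rightCols, mul_eq_one_comm.1 hU]

/-- The range of a matrix of rank at most `k` lies in the span of the first `k` columns of some
unitary matrix. -/
theorem exists_unitary_leftCols {n r k : ℕ} (hk : k ≤ n) (x : Matrix (Fin n) (Fin r) ℂ)
    (hx : x.rank ≤ k) : ∃ U : Matrix (Fin n) (Fin n) ℂ, Uᴴ * U = 1 ∧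
      leftCols hk U * (leftCols hk U)ᴴ * x = x := by
  set S := LinearMap.range (Matrix.toEuclideanLin x) with hS
  have h1 : Module.finrank ℂ S ≤ k := by
    have h1 := Matrix.rank_eq_finrank_range_toLin x (EuclideanSpace.basisFun (Fin n) ℂ).toBasis
      (EuclideanSpace.basisFun (Fin r) ℂ).toBasis
    rw [← Matrix.toEuclideanLin_eq_toLin_orthonormal] at h1
    rw [hS, ← h1]; exact hx
  have h2 := Submodule.finrank_add_finrank_orthogonal S
  rw [finrank_euclideanSpace_fin] at h2
  let c := stdOrthonormalBasis ℂ Sᗮ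
  let e (i : Fin n) (hi : k ≤ i) : Fin (Module.finrank ℂ Sᗮ) := ⟨i - k, by omega⟩
  let v : Fin n → EuclideanSpace ℂ (Fin n) := fun i => if hi : k ≤ i then c (e i hi) else 0
  have hv : Orthonormal ℂ (({i : Fin n | k ≤ (i : ℕ)} : Set (Fin n)).domRestrict v) := by
    have h3 : Orthonormal ℂ fun i : {i : Fin n | k ≤ (i : ℕ)} =>
        ((c (e i.1 i.2) : Sᗮ) : EuclideanSpace ℂ (Fin n)) := by
      refine (c.orthonormal.comp_linearIsometry Sᗮ.subtypeₗᵢ).comp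
        (fun i : {i : Fin n | k ≤ (i : ℕ)} => e i.1 i.2) fun i j hij => ?_
      have h4 := i.2
      have h5 := j.2
      simp only [Set.mem_ofPred_eq] at h4 h5
      simp only [e, Fin.mk.injEq] at hij
      exact Subtype.ext (Fin.ext (by omega))
    convert! h3 using 2 with i
    have h4 : k ≤ (i.1 : ℕ) := i.2
    simp [v, h4]
  obtain ⟨b, hb⟩ := hv.exists_orthonormalBasis_extension_of_card_eq (by simp)
  have hU := matrix_isometry_of_orthonormal b.orthonormal
  set U : Matrix (Fin n) (Fin n) ℂ := Matrix.of fun i j => b j i with hUdef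
  refine ⟨U, hU, ?_⟩
  have h5 : (rightCols hk U)ᴴ * x = 0 := by
    ext i j
    have h6 : b ⟨k + i, by omega⟩ ∈ Sᗮ := by
      rw [hb _ (by simp)]
      simp [v]
    have h7 := (Submodule.mem_orthogonal' S _).1 h6 _
      (LinearMap.mem_range_self (Matrix.toEuclideanLin x) (WithLp.toLp 2 (Pi.single j 1)))
    rw [PiLp.inner_apply] at h7
    rw [Matrix.mul_apply, Matrix.zero_apply, ← h7]
    refine Finset.sum_congr rfl fun l _ => ?_
    simp [rightCols, hUdef, Matrix.toLpLin_apply, mul_comm]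
  have h8 := leftCols_add_rightCols hk U U
  rw [mul_eq_one_comm.1 hU] at h8
  calc leftCols hk U * (leftCols hk U)ᴴ * x
      = (leftCols hk U * (leftCols hk U)ᴴ + rightCols hk U * (rightCols hk U)ᴴ) * x := by
        rw [Matrix.add_mul, Matrix.mul_assoc (rightCols hk U), h5, Matrix.mul_zero, add_zero]
    _ = x := by rw [h8, Matrix.one_mul]

theorem rank_pos_of_ne_zero {n k : ℕ} {x : Matrix (Fin n) (Fin k) ℂ} (hx : x ≠ 0) :
    0 < x.rank := by
  refine Nat.pos_of_ne_zero fun h => hx ?_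
  obtain ⟨U, -, hU⟩ := exists_unitary_leftCols (Nat.zero_le n) x h.le
  rw [← hU]
  ext i j
  simp [Matrix.mul_apply]

open scoped ComplexOrder in
theorem rank_of_isometry {n k : ℕ} {U : Matrix (Fin n) (Fin k) ℂ} (hU : Uᴴ * U = 1) :
    U.rank = k := by
  rw [← Matrix.rank_conjTranspose_mul_self, hU, Matrix.rank_one, Fintype.card_fin]

theorem exists_isAdapted {n r k : ℕ} (z : Matrix (Fin n) (Fin r) ℂ) (hz : z.rank = k) :
    ∃ (U1 : Matrix (Fin n) (Fin k) ℂ) (U2 : Matrix (Fin n) (Fin (n - k)) ℂ),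
        IsAdapted z U1 U2 := by
  have hk : k ≤ n := by rw [← hz]; simpa using z.rank_le_height
  obtain ⟨U, hU, h⟩ := exists_unitary_leftCols hk z hz.le
  have h2 := isAdapted_cols hk hU
  have h3 : rangeProj z = rangeProj (leftCols hk U) := by
    refine rangeProj_eq_of_rank_eq ?_ ?_
    · rw [← h2.2.2.1, h]
    · rw [hz, rank_of_isometry h2.1]
  exact ⟨_, _, h2.1, h2.2.1, h3 ▸ h2.2.2.1, h3 ▸ h2.2.2.2⟩

section

open scoped ComplexOrder

/-! ### Alignment of two matrices and the metric `d` -/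

theorem conjTranspose_mul_self_of_mem {k : ℕ} {U : Matrix (Fin k) (Fin k) ℂ}
    (hU : U ∈ Matrix.unitaryGroup (Fin k) ℂ) : Uᴴ * U = 1 :=
  Matrix.mem_unitaryGroup_iff'.1 hU

theorem mul_conjTranspose_self_of_mem {k : ℕ} {U : Matrix (Fin k) (Fin k) ℂ}
    (hU : U ∈ Matrix.unitaryGroup (Fin k) ℂ) : U * Uᴴ = 1 :=
  Matrix.mem_unitaryGroup_iff.1 hU

theorem exists_conjTranspose_mul_self {k : ℕ} {M : Matrix (Fin k) (Fin k) ℂ}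
    (hM : M.PosSemidef) : ∃ G : Matrix (Fin k) (Fin k) ℂ, M = Gᴴ * G := by
  open scoped MatrixOrder Matrix.Norms.L2Operator in
  exact CStarAlgebra.nonneg_iff_eq_star_mul_self.1 hM.nonneg

/-- The polar decomposition: every square matrix becomes positive semidefinite after
multiplication by a suitable unitary matrix. -/
theorem exists_unitary_mul_posSemidef {k : ℕ} (M : Matrix (Fin k) (Fin k) ℂ) :
    ∃ U ∈ Matrix.unitaryGroup (Fin k) ℂ, (M * U).PosSemidef := by
  have hN := Matrix.posSemidef_conjTranspose_mul_self M
  set d := hN.isHermitian.eigenvalues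
  have hd0 : ∀ i, 0 ≤ d i := hN.eigenvalues_nonneg
  set W : Matrix (Fin k) (Fin k) ℂ :=
    (hN.isHermitian.eigenvectorUnitary : Matrix (Fin k) (Fin k) ℂ)
  have hWW : W ∈ Matrix.unitaryGroup (Fin k) ℂ := hN.isHermitian.eigenvectorUnitary.2
  have hC : (M * W)ᴴ * (M * W) = Matrix.diagonal fun i => (d i : ℂ) := by
    have h := hN.isHermitian.spectral_theorem
    rw [Unitary.conjStarAlgAut_apply] at h
    have h1 : Wᴴ * (Mᴴ * M) * W = Matrix.diagonal fun i => (d i : ℂ) := by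
      rw [h]
      change Wᴴ * (W * _ * Wᴴ) * W = _
      rw [Matrix.mul_assoc, Matrix.mul_assoc, Matrix.mul_assoc,
        conjTranspose_mul_self_of_mem hWW, Matrix.mul_one, ← Matrix.mul_assoc,
        conjTranspose_mul_self_of_mem hWW, Matrix.one_mul]
      rfl
    rw [← h1, Matrix.conjTranspose_mul]
    simp only [Matrix.mul_assoc]
  set C := M * W with hCdef
  have hCij (i j : Fin k) : ∑ l, star (C l i) * C l j = if i = j then (d i : ℂ) else 0 := by
    have := congrFun (congrFun hC i) j
    simpa [Matrix.mul_apply, Matrix.diagonal_apply] using this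
  -- the columns of `M W` are orthogonal with squared norms `d i`; normalize the nonzero ones and
  -- complete them to an orthonormal basis, the columns of `B`, so that `M W = B √d` and `M W B*` is
  -- positive semidefinite
  let v : Fin k → EuclideanSpace ℂ (Fin k) := fun i =>
    WithLp.toLp 2 fun l => ((√(d i))⁻¹ : ℝ) * C l i
  have hv : Orthonormal ℂ (({i | d i ≠ 0} : Set (Fin k)).domRestrict v) := by
    rw [orthonormal_iff_ite]
    rintro ⟨i, hi⟩ ⟨j, hj⟩
    have h1 : inner ℂ (v i) (v j) =
        (((√(d i))⁻¹ * (√(d j))⁻¹ : ℝ) : ℂ) * ∑ l, star (C l i) * C l j := by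
      rw [PiLp.inner_apply, Finset.mul_sum]
      refine Finset.sum_congr rfl fun l _ => ?_
      simp [v]; ring
    simp only [Set.domRestrict_apply, h1, hCij, Subtype.mk.injEq]
    split_ifs with h
    · subst h
      rw [← Complex.ofReal_mul, ← mul_inv, Real.mul_self_sqrt (hd0 i),
        inv_mul_cancel₀ hi, Complex.ofReal_one]
    · simp
  obtain ⟨b, hb⟩ := hv.exists_orthonormalBasis_extension_of_card_eq (by simp)
  have hB := matrix_isometry_of_orthonormal b.orthonormal
  set B : Matrix (Fin k) (Fin k) ℂ := Matrix.of fun i j => b j i with hBdef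
  have hCB : C = B * Matrix.diagonal fun i => ((√(d i) : ℝ) : ℂ) := by
    ext l i
    rw [Matrix.mul_diagonal]
    by_cases hi : d i = 0
    · have h1 : ∑ l, ‖C l i‖ ^ 2 = 0 := by
        have := hCij i i
        rw [if_pos rfl, hi] at this
        have h2 := congrArg Complex.re this
        rw [Complex.re_sum] at h2
        rw [← Complex.zero_re, ← Complex.ofReal_zero, ← h2]
        refine Finset.sum_congr rfl fun l _ => ?_
        rw [← Complex.normSq_eq_norm_sq, Complex.normSq_apply]
        simp
      have h3 := (Finset.sum_eq_zero_iff_of_nonneg fun _ _ => by positivity).1 h1 l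
        (Finset.mem_univ l)
      rw [hi, Real.sqrt_zero, Complex.ofReal_zero, mul_zero]
      exact norm_eq_zero.1 (pow_eq_zero_iff (two_ne_zero)|>.1 h3)
    · have h1 : √(d i) ≠ 0 := (Real.sqrt_pos.2 (lt_of_le_of_ne (hd0 i) (Ne.symm hi))).ne'
      have h2 : (√(d i) : ℂ) ≠ 0 := by exact_mod_cast h1
      rw [hBdef, Matrix.of_apply, hb i hi]
      simp only [v]
      rw [Complex.ofReal_inv]
      field_simp
  refine ⟨W * Bᴴ, mul_mem hWW ?_, ?_⟩
  · rw [Matrix.mem_unitaryGroup_iff]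
    change Bᴴ * Bᴴᴴ = 1
    rw [Matrix.conjTranspose_conjTranspose, hB]
  · rw [← Matrix.mul_assoc, ← hCdef, hCB]
    refine Matrix.PosSemidef.mul_mul_conjTranspose_same
      (Matrix.posSemidef_diagonal_iff.2 fun i => ?_) B
    exact_mod_cast Real.sqrt_nonneg _

/-- Any two matrices can be aligned: `x* (y U)` is positive semidefinite for some unitary `U`. -/
theorem exists_aligned {n k : ℕ} (x y : Matrix (Fin n) (Fin k) ℂ) :
    ∃ U ∈ Matrix.unitaryGroup (Fin k) ℂ, (xᴴ * (y * U)).PosSemidef := by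
  obtain ⟨U, hU, h⟩ := exists_unitary_mul_posSemidef (xᴴ * y)
  exact ⟨U, hU, by rwa [← Matrix.mul_assoc]⟩

/-- For an aligned pair the identity maximizes `U ↦ |⟨x, yU⟩|` over the unitary group. -/
theorem abs_rinner_mul_unitary_le {n k : ℕ} {x y : Matrix (Fin n) (Fin k) ℂ}
    (h : (xᴴ * y).PosSemidef) {U : Matrix (Fin k) (Fin k) ℂ}
    (hU : U ∈ Matrix.unitaryGroup (Fin k) ℂ) : |rinner x (y * U)| ≤ rinner x y := by
  obtain ⟨G, hG⟩ := exists_conjTranspose_mul_self h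
  have h1 : rinner x (y * U) = rinner G (G * U) := by
    simp only [rinner, ← Matrix.mul_assoc, hG]
  have h2 : rinner x y = ‖G‖ ^ 2 := by rw [← rinner_self, rinner, rinner, hG]
  rw [h1, h2]
  refine (abs_rinner_le _ _).trans_eq ?_
  rw [norm_mul_coisometry G (mul_conjTranspose_self_of_mem hU), sq]

theorem rinner_nonneg_of_posSemidef {n k : ℕ} {x y : Matrix (Fin n) (Fin k) ℂ}
    (h : (xᴴ * y).PosSemidef) : 0 ≤ rinner x y :=
  (abs_nonneg _).trans (abs_rinner_mul_unitary_le h (one_mem _))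

theorem dMetric_of_posSemidef {n k : ℕ} {x y : Matrix (Fin n) (Fin k) ℂ}
    (h : (xᴴ * y).PosSemidef) : dMetric x y = ‖x - y‖ * ‖x + y‖ := by
  have hb : BddBelow (Set.range fun U : Matrix.unitaryGroup (Fin k) ℂ =>
      ‖x - y * (U : Matrix (Fin k) (Fin k) ℂ)‖ * ‖x + y * (U : Matrix (Fin k) (Fin k) ℂ)‖) :=
    ⟨0, by rintro _ ⟨U, rfl⟩; positivity⟩
  refine le_antisymm ?_ (le_ciInf fun U => ?_)
  · have := ciInf_le hb 1
    simp only [OneMemClass.coe_one, Matrix.mul_one] at this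
    exact this
  · have hn := norm_mul_coisometry y (mul_conjTranspose_self_of_mem U.2)
    have h1 := norm_add_sq_eq x y
    have h2 := norm_sub_sq_eq x y
    have h3 := norm_add_sq_eq x (y * (U : Matrix (Fin k) (Fin k) ℂ))
    have h4 := norm_sub_sq_eq x (y * (U : Matrix (Fin k) (Fin k) ℂ))
    rw [hn] at h3 h4
    have h5 := abs_rinner_mul_unitary_le h U.2
    have h6 := sq_le_sq' (abs_le.1 h5).1 (abs_le.1 h5).2
    refine abs_le_of_sq_le_sq' ?_ (by positivity) |>.2
    rw [mul_pow, mul_pow, h1, h2, h3, h4]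
    nlinarith

theorem isHermitian_midpoint_sub {n k : ℕ} {x y : Matrix (Fin n) (Fin k) ℂ}
    (h : (xᴴ * y).IsHermitian) : (((2⁻¹ : ℝ) • (x + y))ᴴ * (x - y)).IsHermitian := by
  have h1 : yᴴ * x = xᴴ * y := by
    have := h.eq
    rwa [Matrix.conjTranspose_mul, Matrix.conjTranspose_conjTranspose] at this
  have h2 : ((2⁻¹ : ℝ) • (x + y))ᴴ * (x - y) = (2⁻¹ : ℝ) • (xᴴ * x - yᴴ * y) := by
    rw [Matrix.conjTranspose_smul, star_trivial, Matrix.smul_mul, Matrix.conjTranspose_add,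
      Matrix.add_mul, Matrix.mul_sub, Matrix.mul_sub, h1]
    congr 1
    abel
  rw [h2, Matrix.IsHermitian, Matrix.conjTranspose_smul, star_trivial]
  simp

/-- `π` separates aligned pairs. -/
theorem eq_of_proj_eq_of_posSemidef {n k : ℕ} {x y : Matrix (Fin n) (Fin k) ℂ}
    (h : (xᴴ * y).PosSemidef) (hxy : proj x = proj y) : x = y := by
  set s := (2⁻¹ : ℝ) • (x + y) with hs
  set w := x - y with hw
  have h1 := norm_dproj_sq (isHermitian_midpoint_sub h.isHermitian)
  rw [← proj_sub_proj, hxy, sub_self, norm_zero, ← hs, ← hw] at h1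
  have h2 : s * wᴴ = 0 := by
    rw [← norm_eq_zero, ← sq_eq_zero_iff]
    nlinarith [sq_nonneg ‖s * wᴴ‖, sq_nonneg ‖sᴴ * w‖]
  have hx : x = s + (2⁻¹ : ℝ) • w := by rw [hs, hw]; module
  have hy : y = s - (2⁻¹ : ℝ) • w := by rw [hs, hw]; module
  obtain ⟨G, hG⟩ := exists_conjTranspose_mul_self h
  -- as `s w* = 0`, one has `x w* = w w* / 2 = -y w*`, while `x* y = G* G` makes `⟨x w*, y w*⟩`
  -- nonnegative
  have h3 : rinner (x * wᴴ) (y * wᴴ) = ‖G * wᴴ‖ ^ 2 := by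
    rw [rinner_mul_left, ← Matrix.mul_assoc, hG, Matrix.mul_assoc, ← rinner_mul_left, rinner_self]
  have h4 : rinner (x * wᴴ) (y * wᴴ) = -(4⁻¹ * ‖w * wᴴ‖ ^ 2) := by
    have h5 : x * wᴴ = (2⁻¹ : ℝ) • (w * wᴴ) := by
      conv_lhs => rw [hx, Matrix.add_mul, h2, zero_add, Matrix.smul_mul]
    have h6 : y * wᴴ = (-2⁻¹ : ℝ) • (w * wᴴ) := by
      conv_lhs => rw [hy, Matrix.sub_mul, h2, zero_sub, Matrix.smul_mul]
      rw [neg_smul]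
    rw [h5, h6, rinner_smul_left, rinner_smul_right, rinner_self]
    ring
  have h5 : w * wᴴ = 0 := by
    rw [← norm_eq_zero, ← sq_eq_zero_iff]
    nlinarith [sq_nonneg ‖w * wᴴ‖, sq_nonneg ‖G * wᴴ‖]
  exact sub_eq_zero.1 (Matrix.self_mul_conjTranspose_eq_zero.1 h5)

theorem uEquiv_iff_proj_eq {n r : ℕ} (x y : Matrix (Fin n) (Fin r) ℂ) :
    UEquiv x y ↔ proj x = proj y := by
  constructor
  · rintro ⟨U, hU, rfl⟩
    exact proj_mul_coisometry y (mul_conjTranspose_self_of_mem hU)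
  · intro h
    obtain ⟨U, hU, hP⟩ := exists_aligned x y
    refine ⟨U, hU, eq_of_proj_eq_of_posSemidef hP ?_⟩
    rw [h, proj_mul_coisometry y (mul_conjTranspose_self_of_mem hU)]

theorem dMetric_congr {n r : ℕ} {x x' y y' : Matrix (Fin n) (Fin r) ℂ} (hx : proj x = proj x')
    (hy : proj y = proj y') : dMetric x y = dMetric x' y' := by
  obtain ⟨U, hU, rfl⟩ := (uEquiv_iff_proj_eq x x').2 hx
  obtain ⟨V, hV, rfl⟩ := (uEquiv_iff_proj_eq y y').2 hy
  let U' : Matrix.unitaryGroup (Fin r) ℂ := ⟨U, hU⟩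
  let V' : Matrix.unitaryGroup (Fin r) ℂ := ⟨V, hV⟩
  unfold dMetric
  refine Equiv.iInf_congr ((Equiv.mulLeft V').trans (Equiv.mulRight U'⁻¹)) fun T => ?_
  have h1 : ((((Equiv.mulLeft V').trans (Equiv.mulRight U'⁻¹)) T :
      Matrix.unitaryGroup (Fin r) ℂ) : Matrix (Fin r) (Fin r) ℂ) =
        V * (T : Matrix (Fin r) (Fin r) ℂ) * Uᴴ := rfl
  have h2 (a : Matrix (Fin n) (Fin r) ℂ) : ‖a‖ = ‖a * U‖ :=
    (norm_mul_coisometry a (mul_conjTranspose_self_of_mem hU)).symm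
  have h3 : y' * (V * (T : Matrix (Fin r) (Fin r) ℂ) * Uᴴ) * U =
      y' * V * (T : Matrix (Fin r) (Fin r) ℂ) := by
    rw [Matrix.mul_assoc, Matrix.mul_assoc _ Uᴴ, conjTranspose_mul_self_of_mem hU, Matrix.mul_one,
      Matrix.mul_assoc]
  rw [h1, h2, h2 (x' + _), Matrix.sub_mul, Matrix.add_mul, h3]

/-! ### Reductions -/

/-- The `k × r` matrix `[1 | 0]`. -/
noncomputable def padMat (k r : ℕ) : Matrix (Fin k) (Fin r) ℂ :=
  Matrix.of fun i j => if (j : ℕ) = i then 1 else 0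

theorem padMat_mul_conjTranspose {k r : ℕ} (h : k ≤ r) : padMat k r * (padMat k r)ᴴ = 1 := by
  ext i j
  simp only [Matrix.mul_apply, padMat, Matrix.of_apply, Matrix.conjTranspose_apply,
    Matrix.one_apply]
  rw [Finset.sum_eq_single (Fin.castLE h i)]
  · simp [Fin.ext_iff]
  · intro l _ hl
    have : ¬ (l : ℕ) = i := fun h' => hl (Fin.ext h')
    rw [if_neg this, zero_mul]
  · simp

theorem padZero_eq {n k : ℕ} (r : ℕ) (x : Matrix (Fin n) (Fin k) ℂ) :
    padZero r x = x * padMat k r := by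
  ext i j
  simp only [padZero, padMat, Matrix.mul_apply, Matrix.of_apply]
  split_ifs with h
  · rw [Finset.sum_eq_single ⟨j, h⟩]
    · simp
    · intro l _ hl
      rw [if_neg (fun h' => hl (Fin.ext h'.symm)), mul_zero]
    · simp
  · refine (Finset.sum_eq_zero fun l _ => ?_).symm
    rw [if_neg (by omega), mul_zero]

theorem proj_padZero {n k r : ℕ} (h : k ≤ r) (x : Matrix (Fin n) (Fin k) ℂ) :
    proj (padZero r x) = proj x := by
  rw [padZero_eq, proj_mul_coisometry x (padMat_mul_conjTranspose h)]

theorem isReduction_iff {n r k : ℕ} (z : Matrix (Fin n) (Fin r) ℂ)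
    (zhat : Matrix (Fin n) (Fin k) ℂ) :
    IsReduction z zhat ↔ k ≤ r ∧ zhat.rank = k ∧ proj z = proj zhat := by
  refine and_congr_right fun hk => and_congr_right fun _ => ?_
  rw [← proj_padZero hk, ← uEquiv_iff_proj_eq]
  rfl

theorem IsReduction.exists_coisometry {n r k : ℕ} {z : Matrix (Fin n) (Fin r) ℂ}
    {zhat : Matrix (Fin n) (Fin k) ℂ} (h : IsReduction z zhat) :
    ∃ V : Matrix (Fin k) (Fin r) ℂ, V * Vᴴ = 1 ∧ z = zhat * V := by
  obtain ⟨hk, -, U, hU, hz⟩ := h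
  refine ⟨padMat k r * U, ?_, ?_⟩
  · rw [Matrix.conjTranspose_mul, Matrix.mul_assoc, ← Matrix.mul_assoc U,
      mul_conjTranspose_self_of_mem hU, Matrix.one_mul, padMat_mul_conjTranspose hk]
  · rw [hz, padZero_eq, Matrix.mul_assoc]

/-- A matrix of rank at most `k` has the same image under `π` as some matrix with `k` columns. -/
theorem exists_proj_eq {n r k : ℕ} (hk : k ≤ n) (x : Matrix (Fin n) (Fin r) ℂ)
    (hx : x.rank ≤ k) : ∃ xhat : Matrix (Fin n) (Fin k) ℂ, proj xhat = proj x := by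
  obtain ⟨U, -, hU⟩ := exists_unitary_leftCols hk x hx
  set V := leftCols hk U
  obtain ⟨G, hG⟩ := exists_conjTranspose_mul_self
    (Matrix.posSemidef_self_mul_conjTranspose (Vᴴ * x))
  refine ⟨V * Gᴴ, ?_⟩
  conv_rhs => rw [← hU, proj]
  have h1 : V * Vᴴ * x * (V * Vᴴ * x)ᴴ = V * ((Vᴴ * x) * (Vᴴ * x)ᴴ) * Vᴴ := by
    simp only [Matrix.conjTranspose_mul, Matrix.conjTranspose_conjTranspose, Matrix.mul_assoc]
  rw [h1, hG, proj]
  simp only [Matrix.conjTranspose_mul, Matrix.conjTranspose_conjTranspose, Matrix.mul_assoc]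

theorem rank_proj {n r : ℕ} (x : Matrix (Fin n) (Fin r) ℂ) : (proj x).rank = x.rank :=
  Matrix.rank_self_mul_conjTranspose x

theorem exists_isReduction {n r k : ℕ} (z : Matrix (Fin n) (Fin r) ℂ) (hz : z.rank = k) :
    ∃ zhat : Matrix (Fin n) (Fin k) ℂ, IsReduction z zhat := by
  have hk : k ≤ n := by rw [← hz]; simpa using z.rank_le_height
  have hr : k ≤ r := by rw [← hz]; simpa using z.rank_le_width
  obtain ⟨zhat, h⟩ := exists_proj_eq hk z hz.le
  refine ⟨zhat, (isReduction_iff z zhat).2 ⟨hr, ?_, h.symm⟩⟩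
  rw [← rank_proj, h, rank_proj, hz]

/-- The metric `d` computed through aligned representatives with fewer columns. -/
theorem dMetric_eq_of_aligned {n r k : ℕ} (hk : k ≤ r) {x y : Matrix (Fin n) (Fin r) ℂ}
    {xhat yhat : Matrix (Fin n) (Fin k) ℂ} (hx : proj xhat = proj x) (hy : proj yhat = proj y)
    (h : (xhatᴴ * yhat).PosSemidef) : dMetric x y = ‖xhat - yhat‖ * ‖xhat + yhat‖ := by
  rw [dMetric_congr (hx.symm.trans (proj_padZero hk xhat).symm)
    (hy.symm.trans (proj_padZero hk yhat).symm), dMetric_of_posSemidef, padZero_eq, padZero_eq,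
    ← Matrix.sub_mul, ← Matrix.add_mul, norm_mul_coisometry _ (padMat_mul_conjTranspose hk),
    norm_mul_coisometry _ (padMat_mul_conjTranspose hk)]
  rw [padZero_eq, padZero_eq, Matrix.conjTranspose_mul, Matrix.mul_assoc,
    ← Matrix.mul_assoc xhatᴴ, ← Matrix.mul_assoc]
  have := Matrix.PosSemidef.conjTranspose_mul_mul_same h (padMat k r)
  exact this

/-- A left inverse of a matrix of full column rank. -/
theorem exists_left_inverse {n k : ℕ} {z : Matrix (Fin n) (Fin k) ℂ} (hz : z.rank = k) :
    ∃ Z : Matrix (Fin k) (Fin n) ℂ, Z * z = 1 := by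
  have h : (zᴴ * z).rank = Fintype.card (Fin k) := by
    rw [Matrix.rank_conjTranspose_mul_self, hz, Fintype.card_fin]
  have hu : IsUnit (zᴴ * z) := by
    rw [← Matrix.linearIndependent_rows_iff_isUnit, linearIndependent_iff_card_eq_finrank_span,
      ← h]
    exact Matrix.rank_eq_finrank_span_row _
  refine ⟨(zᴴ * z)⁻¹ * zᴴ, ?_⟩
  rw [Matrix.mul_assoc, Matrix.nonsing_inv_mul _ ((Matrix.isUnit_iff_isUnit_det _).1 hu)]

/-- At a matrix of full column rank the horizontal directions are those with `z* w` Hermitian. -/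
theorem mem_horizontalSpace_iff {n k : ℕ} {z : Matrix (Fin n) (Fin k) ℂ} (hz : z.rank = k)
    (w : Matrix (Fin n) (Fin k) ℂ) : w ∈ horizontalSpace z ↔ (zᴴ * w).IsHermitian := by
  have hPz : rangeProj z * z = z := rangeProj_mul_cancel z
  have hPH : (rangeProj z)ᴴ = rangeProj z := (rangeProj_isHermitian z).eq
  have hzP : zᴴ * rangeProj z = zᴴ := by
    have := congrArg Matrix.conjTranspose hPz
    rwa [Matrix.conjTranspose_mul, hPH] at this
  constructor
  · rintro ⟨H, X, hH, -, hX, rfl⟩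
    have h1 : zᴴ * X = 0 := by rw [← hzP, Matrix.mul_assoc, hX, Matrix.mul_zero]
    rw [Matrix.mul_add, h1, add_zero, Matrix.IsHermitian, Matrix.conjTranspose_mul,
      Matrix.conjTranspose_mul, Matrix.conjTranspose_conjTranspose, hH.eq, Matrix.mul_assoc]
  · intro h
    obtain ⟨Z, hZ⟩ := exists_left_inverse hz
    obtain ⟨Y, hY⟩ := exists_rangeProj_eq_mul z
    have hYz : Y * z = 1 := by
      have := congrArg (fun M => Z * M) hPz
      simpa only [hY, ← Matrix.mul_assoc, hZ, Matrix.one_mul] using this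
    have hYH : Yᴴ * zᴴ = rangeProj z := by rw [← Matrix.conjTranspose_mul, ← hY, hPH]
    refine ⟨Yᴴ * (zᴴ * w) * Y, w - rangeProj z * w, ?_, ?_, ?_, ?_⟩
    · rw [Matrix.IsHermitian, Matrix.conjTranspose_mul, Matrix.conjTranspose_mul,
        Matrix.conjTranspose_conjTranspose, h.eq, Matrix.mul_assoc (Yᴴ)]
    · have : rangeProj z * Yᴴ * zᴴ = Yᴴ * zᴴ := by
        rw [Matrix.mul_assoc, hYH, rangeProj_mul_self]
      simp only [← Matrix.mul_assoc] at this ⊢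
      rw [this]
    · rw [Matrix.mul_sub, ← Matrix.mul_assoc, rangeProj_mul_self, sub_self]
    · rw [Matrix.mul_assoc _ Y, hYz, Matrix.mul_one, ← Matrix.mul_assoc, hYH]
      abel

end

/-! ### Variational characterization of the smallest eigenvalue off a kernel -/

theorem exists_mem_forall_inner_eq_zero {E : Type*} [NormedAddCommGroup E] [InnerProductSpace ℝ E]
    [FiniteDimensional ℝ E] {κ : Type*} [Fintype κ] (F : Submodule ℝ E) (f : κ → E)
    (h : Fintype.card κ < Module.finrank ℝ F) : ∃ v ∈ F, v ≠ 0 ∧ ∀ i, inner ℝ (f i) v = 0 := by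
  let φ : F →ₗ[ℝ] (κ → ℝ) := LinearMap.pi fun i => (innerₛₗ ℝ (f i)).comp F.subtype
  have h1 : LinearMap.ker φ ≠ ⊥ := LinearMap.ker_ne_bot_of_finrank_lt (by simpa using h)
  obtain ⟨v, hv, hv0⟩ := Submodule.exists_mem_ne_zero_of_ne_bot h1
  refine ⟨v, v.2, by simpa using hv0, fun i => ?_⟩
  exact congrFun (LinearMap.mem_ker.1 hv) i

theorem dotProduct_mulVec_eq_sum_eigenvalues {ι : Type} [Fintype ι] [DecidableEq ι]
    {M : Matrix ι ι ℝ} (hM : M.IsHermitian) (v : EuclideanSpace ℝ ι) :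
    v.ofLp ⬝ᵥ M *ᵥ v.ofLp =
      ∑ i, hM.eigenvalues i * inner ℝ (hM.eigenvectorBasis i) v ^ 2 := by
  have h1 : v.ofLp ⬝ᵥ M *ᵥ v.ofLp = inner ℝ v (Matrix.toEuclideanLin M v) := by
    simp [PiLp.inner_apply, dotProduct, Matrix.toLpLin_apply, mul_comm]
  rw [h1, ← hM.eigenvectorBasis.sum_inner_mul_inner]
  refine Finset.sum_congr rfl fun i _ => ?_
  have h2 : inner ℝ (hM.eigenvectorBasis i) (Matrix.toEuclideanLin M v) =
      hM.eigenvalues i * inner ℝ (hM.eigenvectorBasis i) v := by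
    rw [← (Matrix.isSymmetric_toEuclideanLin_iff.2 hM) (hM.eigenvectorBasis i) v]
    have h3 : Matrix.toEuclideanLin M (hM.eigenvectorBasis i) =
        hM.eigenvalues i • hM.eigenvectorBasis i := by
      ext1
      exact congrFun (hM.mulVec_eigenvectorBasis i) _
    rw [h3, inner_smul_left]
    rfl
  rw [h2, real_inner_comm]
  ring

/-- If a symmetric matrix `M` kills `K`, and its quadratic form has the nonnegative minimum `c` on
the unit sphere of the `d`-dimensional space `Kᗮ`, then `c` is the `d`-th largest eigenvalue. -/
theorem lam_eq_of_isLeast {ι : Type} [Fintype ι] [DecidableEq ι] {M : Matrix ι ι ℝ}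
    (hM : M.IsHermitian) {K : Submodule ℝ (EuclideanSpace ℝ ι)} {d : ℕ} (hd : 1 ≤ d)
    (hdK : d + Module.finrank ℝ K = Fintype.card ι) (hK : ∀ u ∈ K, M *ᵥ u.ofLp = 0) {c : ℝ}
    (hc0 : 0 ≤ c)
    (hc : IsLeast {s | ∃ v ∈ Kᗮ, ‖v‖ = 1 ∧ s = v.ofLp ⬝ᵥ M *ᵥ v.ofLp} c) : lam d M = c := by
  have hlam : M.IsHermitian ∧ 1 ≤ d ∧ d ≤ Fintype.card ι := ⟨hM, hd, by omega⟩
  rw [lam, dif_pos hlam]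
  set b := hM.eigenvectorBasis
  let e : Fin (Fintype.card ι) ≃ ι := Fintype.equivOfCardEq (Fintype.card_fin _)
  have hev (i : ι) : hM.eigenvalues i = hM.eigenvalues₀ (e.symm i) := rfl
  have hanti := hM.eigenvalues₀_antitone
  have hnorm (v : EuclideanSpace ℝ ι) : ‖v‖ ^ 2 = ∑ i, inner ℝ (b i) v ^ 2 := by
    rw [← real_inner_self_eq_norm_sq, ← b.sum_inner_mul_inner]
    exact Finset.sum_congr rfl fun i _ => by rw [real_inner_comm, sq]
  obtain ⟨⟨w, hwK, hw1, hcw⟩, hmin⟩ := hc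
  apply le_antisymm
  · have hw0 : w ≠ 0 := by rintro rfl; simp at hw1
    have hwK' : w ∉ K := fun h => hw0 <| by
      have := Submodule.inner_right_of_mem_orthogonal h hwK
      exact inner_self_eq_zero.1 this
    have hfr : Module.finrank ℝ (K ⊔ Submodule.span ℝ {w} : Submodule ℝ _) =
        Module.finrank ℝ K + 1 := by
      have h1 := Submodule.finrank_sup_add_finrank_inf_eq K (Submodule.span ℝ {w})
      rw [finrank_span_singleton hw0,
        (Submodule.disjoint_span_singleton.2 fun h => absurd h hwK').eq_bot, finrank_bot] at h1
      simpa using h1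
    -- with `w` a minimizer, `K ⊕ ℝ w` has dimension one more than the number of eigenvectors after
    -- the `d`-th, so it meets the span of the first `d` eigenvectors; there the form is at least
    -- `λ_d ‖v‖²`, and on `K ⊕ ℝ w` it is at most `c ‖v‖²`
    obtain ⟨v, hv, hv0, hvi⟩ := exists_mem_forall_inner_eq_zero (K ⊔ Submodule.span ℝ {w})
      (fun i : Fin (Module.finrank ℝ K) => b (e ⟨d + i, by omega⟩)) (by simp [hfr])
    have h1 : hM.eigenvalues₀ ⟨d - 1, by omega⟩ * ‖v‖ ^ 2 ≤ v.ofLp ⬝ᵥ M *ᵥ v.ofLp := by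
      rw [dotProduct_mulVec_eq_sum_eigenvalues hM, hnorm, Finset.mul_sum]
      refine Finset.sum_le_sum fun i _ => ?_
      by_cases hi : (e.symm i : ℕ) < d
      · refine mul_le_mul_of_nonneg_right ?_ (sq_nonneg _)
        rw [hev]
        exact hanti (Fin.le_def.2 (by simp; omega))
      · have := hvi ⟨(e.symm i : ℕ) - d, by omega⟩
        have h2 : e ⟨d + ((e.symm i : ℕ) - d), by omega⟩ = i := by
          rw [← Equiv.eq_symm_apply]
          exact Fin.ext (by simp; omega)
        simp only [h2] at this
        change _ ≤ _ * inner ℝ (b i) v ^ 2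
        rw [this]; simp
    obtain ⟨u, hu, t, ht, rfl⟩ := Submodule.mem_sup.1 hv
    obtain ⟨a, rfl⟩ := Submodule.mem_span_singleton.1 ht
    have h3 : inner ℝ u (a • w) = 0 :=
      Submodule.inner_right_of_mem_orthogonal hu (Kᗮ.smul_mem a hwK)
    have h4 : ‖u + a • w‖ ^ 2 = ‖u‖ ^ 2 + a ^ 2 := by
      rw [norm_add_sq_real, h3, norm_smul, hw1, mul_one, Real.norm_eq_abs, sq_abs]
      ring
    have h5 : (u + a • w).ofLp ⬝ᵥ M *ᵥ (u + a • w).ofLp = a ^ 2 * c := by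
      have h6 : M *ᵥ (u + a • w).ofLp = a • M *ᵥ w.ofLp := by
        rw [WithLp.ofLp_add, Matrix.mulVec_add, hK u hu, zero_add, WithLp.ofLp_smul,
          Matrix.mulVec_smul]
      have h7 : u.ofLp ⬝ᵥ M *ᵥ w.ofLp = 0 := by
        rw [Matrix.dotProduct_mulVec, ← Matrix.mulVec_transpose]
        have h8 : Mᵀ = M := by
          rw [← Matrix.conjTranspose_eq_transpose_of_trivial, hM.eq]
        rw [h8, hK u hu, zero_dotProduct]
      rw [h6, WithLp.ofLp_add, add_dotProduct, dotProduct_smul, h7, WithLp.ofLp_smul,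
        smul_dotProduct, dotProduct_smul, ← hcw]
      simp only [smul_eq_mul]; ring
    have h6 : 0 < ‖u + a • w‖ ^ 2 := by positivity
    rw [h5] at h1
    have h7 : a ^ 2 * c ≤ ‖u + a • w‖ ^ 2 * c := by
      rw [h4]; nlinarith [sq_nonneg ‖u‖]
    nlinarith
  · have hfr : Module.finrank ℝ Kᗮ = d := by
      have := Submodule.finrank_add_finrank_orthogonal K
      rw [finrank_euclideanSpace] at this
      omega
    -- the `d`-dimensional space `Kᗮ` contains a nonzero vector orthogonal to the first `d - 1`
    -- eigenvectors, where the form is at most `λ_d ‖v‖²`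
    obtain ⟨v, hv, hv0, hvi⟩ := exists_mem_forall_inner_eq_zero Kᗮ
      (fun i : Fin (d - 1) => b (e ⟨i, by omega⟩)) (by simp [hfr]; omega)
    have h1 : v.ofLp ⬝ᵥ M *ᵥ v.ofLp ≤ hM.eigenvalues₀ ⟨d - 1, by omega⟩ * ‖v‖ ^ 2 := by
      rw [dotProduct_mulVec_eq_sum_eigenvalues hM, hnorm, Finset.mul_sum]
      refine Finset.sum_le_sum fun i _ => ?_
      by_cases hi : (e.symm i : ℕ) < d - 1
      · have := hvi ⟨e.symm i, hi⟩
        simp only [Fin.eta, Equiv.apply_symm_apply] at this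
        change _ * inner ℝ (b i) v ^ 2 ≤ _
        rw [this]; simp
      · refine mul_le_mul_of_nonneg_right ?_ (sq_nonneg _)
        rw [hev]
        exact hanti (Fin.le_def.2 (by simp; omega))
    have hvn : 0 < ‖v‖ := norm_pos_iff.2 hv0
    have h2 : c ≤ (‖v‖⁻¹ • v).ofLp ⬝ᵥ M *ᵥ (‖v‖⁻¹ • v).ofLp :=
      hmin ⟨_, Kᗮ.smul_mem _ hv, by rw [norm_smul, norm_inv, norm_norm, inv_mul_cancel₀ hvn.ne'],
        rfl⟩
    rw [WithLp.ofLp_smul, Matrix.mulVec_smul, smul_dotProduct, dotProduct_smul, smul_eq_mul,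
      smul_eq_mul] at h2
    have h3 : ‖v‖ ^ 2 * c ≤ ‖v‖ ^ 2 * (‖v‖⁻¹ * (‖v‖⁻¹ * (v.ofLp ⬝ᵥ M *ᵥ v.ofLp))) :=
      mul_le_mul_of_nonneg_left h2 (sq_nonneg _)
    have h4 : ‖v‖ ^ 2 * (‖v‖⁻¹ * (‖v‖⁻¹ * (v.ofLp ⬝ᵥ M *ᵥ v.ofLp))) = v.ofLp ⬝ᵥ M *ᵥ v.ofLp := by
      field_simp
    rw [h4] at h3
    have h5 : 0 < ‖v‖ ^ 2 := by positivity
    nlinarith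

/-! ### Real coordinates -/

theorem sum_mu_mul_mu {p q : ℕ} (x y : Matrix (Fin p) (Fin q) ℂ) :
    ∑ c, mu x c * mu y c = rinner x y := by
  rw [rinner_eq_sum, Fintype.sum_prod_type]
  refine Finset.sum_congr rfl fun j _ => ?_
  rw [Fintype.sum_sum_type, ← Finset.sum_add_distrib]
  exact Finset.sum_congr rfl fun i _ => by simp [mu]

/-- The inverse of `mu`. -/
noncomputable def unmu {p q : ℕ} (v : MuIdx p q → ℝ) : Matrix (Fin p) (Fin q) ℂ :=
  Matrix.of fun i j => ⟨v (j, Sum.inl i), v (j, Sum.inr i)⟩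

theorem mu_unmu {p q : ℕ} (v : MuIdx p q → ℝ) : mu (unmu v) = v := by
  funext ⟨j, i⟩
  cases i <;> simp [mu, unmu]

/-- `mu` as a linear map. -/
noncomputable def muLin (p q : ℕ) :
    Matrix (Fin p) (Fin q) ℂ →ₗ[ℝ] EuclideanSpace ℝ (MuIdx p q) where
  toFun x := WithLp.toLp 2 (mu x)
  map_add' x y := by
    ext ⟨j, i⟩
    cases i <;> simp [mu]
  map_smul' t x := by
    ext ⟨j, i⟩
    cases i <;> simp [mu]

theorem inner_muLin {p q : ℕ} (x y : Matrix (Fin p) (Fin q) ℂ) :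
    inner ℝ (muLin p q x) (muLin p q y) = rinner x y := by
  rw [← sum_mu_mul_mu, PiLp.inner_apply]
  exact Finset.sum_congr rfl fun c _ => by simp [muLin, mul_comm]

theorem norm_muLin {p q : ℕ} (x : Matrix (Fin p) (Fin q) ℂ) : ‖muLin p q x‖ = ‖x‖ := by
  rw [← sq_eq_sq₀ (norm_nonneg _) (norm_nonneg _), ← real_inner_self_eq_norm_sq, inner_muLin,
    rinner_self]

theorem muLin_surjective (p q : ℕ) : Function.Surjective (muLin p q) := fun v =>
  ⟨unmu v.ofLp, by ext1; exact congrFun (mu_unmu v.ofLp) _⟩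

theorem sum_eq_diag_add_upper {k : ℕ} (f : Fin k → Fin k → ℝ) (hf : ∀ i j, f i j = f j i) :
    ∑ j, ∑ i, f i j = ∑ i, f i i + 2 * ∑ p : UpperIdx k, f p.1.1 p.1.2 := by
  have h1 : ∑ p : UpperIdx k, f p.1.1 p.1.2 = ∑ j, ∑ i, if i < j then f i j else 0 := by
    rw [Finset.sum_comm, ← Finset.sum_product', Finset.univ_product_univ, ← Finset.sum_filter]
    exact (Finset.sum_subtype _ (by simp) fun p : Fin k × Fin k => f p.1 p.2).symm
  have h2 : ∑ p : UpperIdx k, f p.1.1 p.1.2 = ∑ j, ∑ i, if j < i then f i j else 0 := by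
    rw [h1, Finset.sum_comm]
    refine Finset.sum_congr rfl fun i _ => Finset.sum_congr rfl fun j _ => ?_
    rw [hf]
  have h3 : ∑ i, f i i = ∑ j, ∑ i, if i = j then f i j else 0 := by simp
  rw [two_mul]
  nth_rewrite 1 [h1]
  rw [h2, h3, ← Finset.sum_add_distrib, ← Finset.sum_add_distrib]
  refine Finset.sum_congr rfl fun j _ => ?_
  rw [← Finset.sum_add_distrib, ← Finset.sum_add_distrib]
  refine Finset.sum_congr rfl fun i _ => ?_
  rcases lt_trichotomy i j with h | h | h
  · simp [h, h.ne, h.not_gt]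
  · simp [h]
  · simp [h, h.ne', h.not_gt]

theorem sum_tau_mul_tau {k : ℕ} {x y : Matrix (Fin k) (Fin k) ℂ} (hx : x.IsHermitian)
    (hy : y.IsHermitian) : ∑ c, tau x c * tau y c = rinner x y := by
  have hx' (i j) : x i j = star (x j i) := (hx.apply i j).symm
  have hy' (i j) : y i j = star (y j i) := (hy.apply i j).symm
  rw [rinner_eq_sum, sum_eq_diag_add_upper (fun i j => (star (x i j) * y i j).re)]
  · rw [Fintype.sum_sum_type, Fintype.sum_sum_type, ← Finset.sum_add_distrib, Finset.mul_sum]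
    congr 1
    · refine Finset.sum_congr rfl fun i _ => ?_
      have h1 := congrArg Complex.im (hx' i i)
      have h2 := congrArg Complex.im (hy' i i)
      simp only [Complex.star_def, Complex.conj_im] at h1 h2
      have h1' : (x i i).im = 0 := by linarith
      simp [tau, h1']
    · refine Finset.sum_congr rfl fun p _ => ?_
      have h : √2 * √2 = (2 : ℝ) := Real.mul_self_sqrt (by norm_num)
      simp only [tau, Sum.elim_inr, Sum.elim_inl, Complex.star_def, Complex.mul_re,
        Complex.conj_re, Complex.conj_im]
      linear_combination ((x p.1.1 p.1.2).re * (y p.1.1 p.1.2).re +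
        (x p.1.1 p.1.2).im * (y p.1.1 p.1.2).im) * h
  · intro i j
    rw [hx' i j, hy' i j]
    simp

/-- The inverse of `tau` on Hermitian matrices. -/
noncomputable def untau {k : ℕ} (v : TauIdx k → ℝ) : Matrix (Fin k) (Fin k) ℂ :=
  Matrix.of fun i j =>
    if h : i < j then ⟨(√2)⁻¹ * v (.inr (.inl ⟨(i, j), h⟩)), (√2)⁻¹ * v (.inr (.inr ⟨(i, j), h⟩))⟩
    else if h : j < i then
      ⟨(√2)⁻¹ * v (.inr (.inl ⟨(j, i), h⟩)), -((√2)⁻¹ * v (.inr (.inr ⟨(j, i), h⟩)))⟩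
    else v (.inl i)

theorem untau_isHermitian {k : ℕ} (v : TauIdx k → ℝ) : (untau v).IsHermitian := by
  ext i j
  rw [Matrix.conjTranspose_apply]
  simp only [untau, Matrix.of_apply]
  rcases lt_trichotomy i j with h | h | h
  · rw [dif_neg h.not_gt, dif_pos h, dif_pos h]
    apply Complex.ext <;> simp
  · subst h
    simp
  · rw [dif_pos h, dif_neg h.not_gt, dif_pos h]
    apply Complex.ext <;> simp

theorem tau_untau {k : ℕ} (v : TauIdx k → ℝ) : tau (untau v) = v := by
  have h2 : √2 ≠ (0 : ℝ) := by positivity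
  funext c
  rcases c with i | p | p
  · simp [tau, untau]
  · simp [tau, untau, p.2, h2]
  · simp [tau, untau, p.2, h2]

theorem card_tauIdx (k : ℕ) : Fintype.card (TauIdx k) = k ^ 2 := by
  have h := sum_eq_diag_add_upper (k := k) (fun _ _ => 1) fun _ _ => rfl
  simp only [Finset.sum_const, Finset.card_univ, Fintype.card_fin, nsmul_eq_mul, mul_one] at h
  rw [Fintype.card_sum, Fintype.card_sum, Fintype.card_fin]
  have h2 : k * k = k + 2 * Fintype.card (UpperIdx k) := by exact_mod_cast h
  nlinarith

theorem card_muIdx (p q : ℕ) : Fintype.card (MuIdx p q) = 2 * p * q := by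
  simp only [MuIdx, Fintype.card_prod, Fintype.card_sum, Fintype.card_fin]
  ring

/-- The coordinates `tau` identify the Hermitian `k × k` matrices with a space of dimension `k²`. -/
theorem finrank_selfAdjoint (k : ℕ) :
    Module.finrank ℝ (selfAdjoint.submodule ℝ (Matrix (Fin k) (Fin k) ℂ)) = k ^ 2 := by
  let φ : selfAdjoint.submodule ℝ (Matrix (Fin k) (Fin k) ℂ) →ₗ[ℝ] (TauIdx k → ℝ) :=
    { toFun := fun x => tau x.1
      map_add' := fun x y => by
        funext c
        rcases c with i | p | p <;> simp [tau, mul_add]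
      map_smul' := fun t x => by
        funext c
        rcases c with i | p | p <;> simp [tau] <;> ring }
  have hφ : Function.Bijective φ := by
    constructor
    · refine (injective_iff_map_eq_zero φ).2 fun x hx => ?_
      have hxH : (x : Matrix (Fin k) (Fin k) ℂ).IsHermitian := x.2
      have h1 := sum_tau_mul_tau hxH hxH
      have h2 (c) : tau (x : Matrix (Fin k) (Fin k) ℂ) c = 0 := congrFun hx c
      simp only [h2, mul_zero, Finset.sum_const_zero, rinner_self] at h1
      exact Subtype.ext (norm_eq_zero.1 (sq_eq_zero_iff.1 h1.symm))
    · exact fun v => ⟨⟨untau v, untau_isHermitian v⟩, tau_untau v⟩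
  rw [(LinearEquiv.ofBijective φ hφ).finrank_eq, Module.finrank_fintype_fun_eq_card, card_tauIdx]

/-! ### The matrices `Q` and `Q̂` as Gram matrices -/

theorem dotProduct_sum_vecMulVec {ι : Type} [Fintype ι] {m : ℕ} (f : Fin m → ι → ℝ) (v : ι → ℝ) :
    v ⬝ᵥ (∑ j, Matrix.vecMulVec (f j) (f j)) *ᵥ v = ∑ j, (v ⬝ᵥ f j) ^ 2 := by
  rw [Matrix.sum_mulVec, dotProduct_sum]
  refine Finset.sum_congr rfl fun j _ => ?_
  rw [Matrix.vecMulVec_mulVec, dotProduct_smul, dotProduct_comm (f j) v, sq]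
  simp

theorem isHermitian_sum_vecMulVec {ι : Type} [Fintype ι] {m : ℕ} (f : Fin m → ι → ℝ) :
    (∑ j, Matrix.vecMulVec (f j) (f j)).IsHermitian := by
  ext a b
  simp [Matrix.sum_apply, Matrix.vecMulVec_apply, mul_comm]

/-- `qVec` is an isometry on the tangent space: pairing coordinates recovers `⟨W, B⟩`. -/
theorem qVec_dotProduct {n k r : ℕ} {z : Matrix (Fin n) (Fin r) ℂ} {U1 : Matrix (Fin n) (Fin k) ℂ}
    {U2 : Matrix (Fin n) (Fin (n - k)) ℂ} (hU : IsAdapted z U1 U2) {W B : Matrix (Fin n) (Fin n) ℂ}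
    (hW : W ∈ tangentSpace z) (hB : B.IsHermitian) :
    qVec U1 U2 W ⬝ᵥ qVec U1 U2 B = rinner W B := by
  obtain ⟨hWH, hW0⟩ := hW
  obtain ⟨-, -, hP, hQ⟩ := hU
  have h1 : W = U1 * U1ᴴ * W * (U1 * U1ᴴ) + U2 * U2ᴴ * W * (U1 * U1ᴴ) +
      (U2 * U2ᴴ * W * (U1 * U1ᴴ))ᴴ := by
    have h2 : (U2 * U2ᴴ * W * (U1 * U1ᴴ))ᴴ = U1 * U1ᴴ * W * (U2 * U2ᴴ) := by
      simp only [Matrix.conjTranspose_mul, Matrix.conjTranspose_conjTranspose, hWH.eq,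
        Matrix.mul_assoc]
    rw [h2, hP, hQ]
    rw [← sub_eq_zero, ← hW0]
    simp only [Matrix.sub_mul, Matrix.mul_sub, Matrix.one_mul, Matrix.mul_one]
    abel
  have e1 : rinner (U1 * U1ᴴ * W * (U1 * U1ᴴ)) B = rinner (U1ᴴ * W * U1) (U1ᴴ * B * U1) := by
    have : U1 * U1ᴴ * W * (U1 * U1ᴴ) = U1 * ((U1ᴴ * W * U1) * U1ᴴ) := by
      simp only [Matrix.mul_assoc]
    rw [this, rinner_mul_left, rinner_mul_right, Matrix.conjTranspose_conjTranspose]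
  have e2 : rinner (U2 * U2ᴴ * W * (U1 * U1ᴴ)) B = rinner (U2ᴴ * W * U1) (U2ᴴ * B * U1) := by
    have : U2 * U2ᴴ * W * (U1 * U1ᴴ) = U2 * ((U2ᴴ * W * U1) * U1ᴴ) := by
      simp only [Matrix.mul_assoc]
    rw [this, rinner_mul_left, rinner_mul_right, Matrix.conjTranspose_conjTranspose]
  have e3 : rinner (U2 * U2ᴴ * W * (U1 * U1ᴴ))ᴴ B = rinner (U2ᴴ * W * U1) (U2ᴴ * B * U1) := by
    rw [← e2, ← rinner_conjTranspose, Matrix.conjTranspose_conjTranspose, hB.eq]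
  conv_rhs => rw [h1, rinner_add_left, rinner_add_left, e1, e2, e3]
  have h (C : Matrix (Fin n) (Fin n) ℂ) (hC : C.IsHermitian) : (U1ᴴ * C * U1).IsHermitian :=
    Matrix.isHermitian_conjTranspose_mul_mul U1 hC
  rw [← sum_tau_mul_tau (h W hWH) (h B hB), ← sum_mu_mul_mu]
  rw [dotProduct, Fintype.sum_sum_type]
  simp only [qVec, Sum.elim_inl, Sum.elim_inr]
  have h2 : √2 * √2 = (2 : ℝ) := Real.mul_self_sqrt (by norm_num)
  rw [add_assoc, ← two_mul, Finset.mul_sum]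
  congr 1
  refine Finset.sum_congr rfl fun c _ => ?_
  linear_combination mu (U2ᴴ * W * U1) c * mu (U2ᴴ * B * U1) c * h2

theorem exists_qVec_eq {n k r : ℕ} {z : Matrix (Fin n) (Fin r) ℂ} {U1 : Matrix (Fin n) (Fin k) ℂ}
    {U2 : Matrix (Fin n) (Fin (n - k)) ℂ} (hU : IsAdapted z U1 U2)
    (v : TauIdx k ⊕ MuIdx (n - k) k → ℝ) : ∃ W ∈ tangentSpace z, qVec U1 U2 W = v := by
  obtain ⟨h1, h2, hP, hQ⟩ := hU
  have h12 : U2ᴴ * U1 = 0 := by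
    have h3 : (U2 * U2ᴴ) * (U1 * U1ᴴ) = 0 := by
      rw [hP, hQ, Matrix.sub_mul, Matrix.one_mul, rangeProj_mul_self, sub_self]
    calc U2ᴴ * U1 = U2ᴴ * U2 * U2ᴴ * (U1 * (U1ᴴ * U1)) := by simp [h1, h2]
      _ = U2ᴴ * ((U2 * U2ᴴ) * (U1 * U1ᴴ)) * U1 := by simp only [Matrix.mul_assoc]
      _ = 0 := by rw [h3, Matrix.mul_zero, Matrix.zero_mul]
  have h21 : U1ᴴ * U2 = 0 := by
    have := congrArg Matrix.conjTranspose h12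
    simpa using this
  set X := untau fun c => v (.inl c)
  set Y : Matrix (Fin (n - k)) (Fin k) ℂ := unmu fun c => (√2)⁻¹ * v (.inr c)
  have hX : Xᴴ = X := untau_isHermitian _
  refine ⟨U1 * X * U1ᴴ + U2 * Y * U1ᴴ + U1 * Yᴴ * U2ᴴ, ⟨?_, ?_⟩, ?_⟩
  · simp only [Matrix.IsHermitian, Matrix.conjTranspose_add, Matrix.conjTranspose_mul,
      Matrix.conjTranspose_conjTranspose, hX, Matrix.mul_assoc]
    abel
  · rw [← hQ]
    simp only [Matrix.mul_add, Matrix.add_mul, Matrix.mul_assoc]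
    simp only [← Matrix.mul_assoc U1ᴴ U2, ← Matrix.mul_assoc U2ᴴ U1, h12, h21, Matrix.zero_mul,
      Matrix.mul_zero, add_zero]
  · have e1 : U1ᴴ * (U1 * X * U1ᴴ + U2 * Y * U1ᴴ + U1 * Yᴴ * U2ᴴ) * U1 = X := by
      simp only [Matrix.mul_add, Matrix.add_mul, Matrix.mul_assoc]
      simp only [← Matrix.mul_assoc U1ᴴ U2, ← Matrix.mul_assoc U1ᴴ U1, h1, h12, h21,
        Matrix.zero_mul, Matrix.mul_zero, add_zero, Matrix.one_mul, Matrix.mul_one]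
    have e2 : U2ᴴ * (U1 * X * U1ᴴ + U2 * Y * U1ᴴ + U1 * Yᴴ * U2ᴴ) * U1 = Y := by
      simp only [Matrix.mul_add, Matrix.add_mul, Matrix.mul_assoc]
      simp only [← Matrix.mul_assoc U2ᴴ U2, ← Matrix.mul_assoc U2ᴴ U1, h1, h2, h12,
        Matrix.zero_mul, Matrix.mul_zero, add_zero, zero_add, Matrix.one_mul, Matrix.mul_one]
    have h2 : √2 ≠ (0 : ℝ) := by positivity
    funext c
    rcases c with c | c
    · simp only [qVec, e1, Sum.elim_inl, X, tau_untau]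
    · simp only [qVec, e2, Sum.elim_inr, Y, mu_unmu]
      rw [mul_inv_cancel_left₀ h2]

/-- The quadratic form of `Q` in unit coordinates takes exactly the tangent values. -/
theorem lam_qMat_eq {n r k m : ℕ} {A : Fin m → Matrix (Fin n) (Fin n) ℂ}
    (hA : ∀ j, (A j).IsHermitian) {z : Matrix (Fin n) (Fin r) ℂ} (hk : 0 < k) (hkn : k ≤ n)
    {U1 : Matrix (Fin n) (Fin k) ℂ} {U2 : Matrix (Fin n) (Fin (n - k)) ℂ}
    (hU : IsAdapted z U1 U2) {c : ℝ} (hc : IsLeast (tangentValues A z) c) :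
    lam (2 * n * k - k ^ 2) (qMat A U1 U2) = c := by
  have hc0 : 0 ≤ c := by
    obtain ⟨⟨W, -, -, rfl⟩, -⟩ := hc
    exact qform_nonneg A W
  obtain ⟨l, rfl⟩ := Nat.exists_eq_add_of_le hkn
  have hd : 2 * (k + l) * k - k ^ 2 = k ^ 2 + 2 * l * k := by
    have : 2 * (k + l) * k = k ^ 2 + (k ^ 2 + 2 * l * k) := by ring
    omega
  have hk2 : 0 < k ^ 2 := by positivity
  refine lam_eq_of_isLeast (K := ⊥) (isHermitian_sum_vecMulVec _) (by omega) ?_ ?_ hc0 ?_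
  · rw [finrank_bot, Fintype.card_sum, card_tauIdx, card_muIdx, hd, Nat.add_sub_cancel_left,
      add_zero]
  · intro u hu
    rw [(Submodule.mem_bot ℝ).1 hu]
    exact Matrix.mulVec_zero _
  · convert! hc using 1
    ext s
    have hform (W : Matrix (Fin (k + l)) (Fin (k + l)) ℂ) (hW : W ∈ tangentSpace z) :
        qVec U1 U2 W ⬝ᵥ qMat A U1 U2 *ᵥ qVec U1 U2 W = qform A W := by
      rw [qMat, dotProduct_sum_vecMulVec]
      exact Finset.sum_congr rfl fun j _ => by rw [qVec_dotProduct hU hW (hA j)]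
    have hnorm (W : Matrix (Fin (k + l)) (Fin (k + l)) ℂ) (hW : W ∈ tangentSpace z) :
        ‖(WithLp.toLp 2 (qVec U1 U2 W) : EuclideanSpace ℝ _)‖ = ‖W‖ := by
      rw [← sq_eq_sq₀ (norm_nonneg _) (norm_nonneg _), ← rinner_self,
        ← qVec_dotProduct hU hW hW.1, EuclideanSpace.norm_sq_eq]
      exact Finset.sum_congr rfl fun c _ => by simp [sq]
    constructor
    · rintro ⟨v, -, hv, rfl⟩
      obtain ⟨W, hW, hWv⟩ := exists_qVec_eq hU v.ofLp
      refine ⟨W, hW, ?_, ?_⟩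
      · rw [← hnorm W hW, hWv]; exact hv
      · rw [← hWv]; exact hform W hW
    · rintro ⟨W, hW, hW1, rfl⟩
      exact ⟨WithLp.toLp 2 (qVec U1 U2 W), by simp, by rw [hnorm W hW, hW1], (hform W hW).symm⟩

theorem fMat_mulVec_mu {n k : ℕ} (B : Matrix (Fin n) (Fin n) ℂ) (x : Matrix (Fin n) (Fin k) ℂ) :
    fMat k B *ᵥ mu x = mu (B * x) := by
  funext ⟨j, i⟩
  have h1 : (fMat k B *ᵥ mu x) (j, i) = ∑ l, realify B i l * mu x (j, l) := by
    rw [Matrix.mulVec, dotProduct, Fintype.sum_prod_type, Finset.sum_eq_single j]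
    · exact Finset.sum_congr rfl fun l _ => by simp [fMat, Matrix.kroneckerMap_apply]
    · intro b _ hb
      exact Finset.sum_eq_zero fun l _ => by simp [fMat, Matrix.kroneckerMap_apply, hb.symm]
    · simp
  rw [h1, Fintype.sum_sum_type, ← Finset.sum_add_distrib]
  rcases i with i | i
  · simp only [mu, Sum.elim_inl, Matrix.mul_apply, Complex.re_sum]
    exact Finset.sum_congr rfl fun l _ => by simp [realify]; ring
  · simp only [mu, Sum.elim_inr, Matrix.mul_apply, Complex.im_sum]
    exact Finset.sum_congr rfl fun l _ => by simp [realify]; ring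

theorem fMat_isSymm {n k : ℕ} {B : Matrix (Fin n) (Fin n) ℂ} (hB : B.IsHermitian) :
    (fMat k B)ᵀ = fMat k B := by
  have hre (i j) : (B i j).re = (B j i).re := by rw [← hB.apply i j]; simp
  have him (i j) : (B i j).im = -(B j i).im := by rw [← hB.apply i j]; simp
  have h : (realify B)ᵀ = realify B := by
    ext i j
    rcases i with i | i <;> rcases j with j | j <;> simp [realify, hre i j, him i j]
  rw [fMat]
  change (Matrix.kroneckerMap _ _ _)ᵀ = _
  rw [← Matrix.kroneckerMap_transpose, Matrix.transpose_one, h]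
  rfl

theorem qHatMat_eq {n k m : ℕ} {A : Fin m → Matrix (Fin n) (Fin n) ℂ}
    (hA : ∀ j, (A j).IsHermitian) (z : Matrix (Fin n) (Fin k) ℂ) :
    qHatMat A z = ∑ j, Matrix.vecMulVec ((2 : ℝ) • mu (A j * z)) ((2 : ℝ) • mu (A j * z)) := by
  rw [qHatMat, Finset.smul_sum]
  refine Finset.sum_congr rfl fun j _ => ?_
  rw [Matrix.mul_vecMulVec, Matrix.vecMulVec_mul, fMat_mulVec_mu, ← Matrix.mulVec_transpose,
    fMat_isSymm (hA j), fMat_mulVec_mu]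
  ext a b
  simp [Matrix.vecMulVec_apply]
  ring

theorem rinner_dproj {n r : ℕ} {B : Matrix (Fin n) (Fin n) ℂ} (hB : B.IsHermitian)
    (z w : Matrix (Fin n) (Fin r) ℂ) : rinner (dproj z w) B = 2 * rinner w (B * z) := by
  have h1 : rinner (w * zᴴ) B = rinner w (B * z) := by
    rw [rinner_mul_right, Matrix.conjTranspose_conjTranspose]
  have h2 : rinner (z * wᴴ) B = rinner (w * zᴴ) B := by
    rw [← rinner_conjTranspose, hB.eq]
    simp
  rw [dproj, rinner_add_left, h2, h1]
  ring

/-- The vertical directions `z S` at `z`, with `S` skew-Hermitian, in real coordinates; `S` is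
parametrized as `i` times a Hermitian matrix. -/
noncomputable def verticalLin {n k : ℕ} (z : Matrix (Fin n) (Fin k) ℂ) :
    selfAdjoint.submodule ℝ (Matrix (Fin k) (Fin k) ℂ) →ₗ[ℝ] EuclideanSpace ℝ (MuIdx n k) :=
  (muLin n k).comp
    ({ toFun := fun S => z * (Complex.I • (S : Matrix (Fin k) (Fin k) ℂ))
       map_add' := fun S T => by simp [Matrix.mul_add]
       map_smul' := fun t S => by
        simp only [Submodule.coe_smul, RingHom.id_apply, smul_comm Complex.I t, Matrix.mul_smul] } :
      selfAdjoint.submodule ℝ (Matrix (Fin k) (Fin k) ℂ) →ₗ[ℝ] Matrix (Fin n) (Fin k) ℂ)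

theorem verticalLin_apply {n k : ℕ} (z : Matrix (Fin n) (Fin k) ℂ)
    (S : selfAdjoint.submodule ℝ (Matrix (Fin k) (Fin k) ℂ)) :
    verticalLin z S = muLin n k (z * (Complex.I • (S : Matrix (Fin k) (Fin k) ℂ))) := rfl

theorem dproj_vertical {n k : ℕ} (z : Matrix (Fin n) (Fin k) ℂ)
    (S : selfAdjoint.submodule ℝ (Matrix (Fin k) (Fin k) ℂ)) :
    dproj z (z * (Complex.I • (S : Matrix (Fin k) (Fin k) ℂ))) = 0 := by
  have hS : (S : Matrix (Fin k) (Fin k) ℂ)ᴴ = S := S.2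
  simp only [dproj, Matrix.conjTranspose_mul, Matrix.conjTranspose_smul, hS, Matrix.mul_smul,
    Matrix.smul_mul, Matrix.mul_assoc]
  simp

theorem finrank_range_verticalLin {n k : ℕ} {z : Matrix (Fin n) (Fin k) ℂ} (hz : z.rank = k) :
    Module.finrank ℝ (LinearMap.range (verticalLin z)) = k ^ 2 := by
  obtain ⟨Z, hZ⟩ := exists_left_inverse hz
  have hinj : Function.Injective (verticalLin z) := by
    refine (injective_iff_map_eq_zero (verticalLin z)).2 fun S hS => ?_
    have h1 : z * (Complex.I • (S : Matrix (Fin k) (Fin k) ℂ)) = 0 := by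
      rw [← norm_eq_zero, ← norm_muLin]
      exact norm_eq_zero.2 hS
    have h2 := congrArg (fun M => Z * M) h1
    simp only [← Matrix.mul_assoc, hZ, Matrix.one_mul, Matrix.mul_zero] at h2
    exact Subtype.ext ((smul_eq_zero.1 h2).resolve_left Complex.I_ne_zero)
  rw [LinearMap.finrank_range_of_inj hinj, finrank_selfAdjoint]

/-- The orthogonal complement of the vertical directions consists of the `w` with `z* w`
Hermitian. -/
theorem muLin_mem_orthogonal_iff {n k : ℕ} (z w : Matrix (Fin n) (Fin k) ℂ) :
    muLin n k w ∈ (LinearMap.range (verticalLin z))ᗮ ↔ (zᴴ * w).IsHermitian := by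
  rw [Submodule.mem_orthogonal]
  have hS (S : selfAdjoint.submodule ℝ (Matrix (Fin k) (Fin k) ℂ)) :
      inner ℝ (verticalLin z S) (muLin n k w) =
        rinner (Complex.I • (S : Matrix (Fin k) (Fin k) ℂ)) (zᴴ * w) := by
    rw [verticalLin_apply, inner_muLin, rinner_mul_left]
  constructor
  · intro h
    -- test against the skew-Hermitian part of `z* w`
    set D := zᴴ * w - (zᴴ * w)ᴴ with hD
    have hDH : (Complex.I • D)ᴴ = Complex.I • D := by
      rw [Matrix.conjTranspose_smul, hD, Matrix.conjTranspose_sub,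
        Matrix.conjTranspose_conjTranspose]
      simp only [Complex.star_def, Complex.conj_I]
      module
    have h1 := h _ ⟨⟨Complex.I • D, hDH⟩, rfl⟩
    rw [hS] at h1
    simp only [smul_smul, Complex.I_mul_I, neg_smul, one_smul] at h1
    have h2 : rinner D (zᴴ * w) = 0 := by
      have : -D = (-1 : ℝ) • D := by simp
      rw [this, rinner_smul_left] at h1
      linarith
    have h3 : rinner D (zᴴ * w)ᴴ = 0 := by
      rw [← rinner_conjTranspose, Matrix.conjTranspose_conjTranspose]
      have : Dᴴ = (-1 : ℝ) • D := by
        rw [hD, Matrix.conjTranspose_sub, Matrix.conjTranspose_conjTranspose]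
        module
      rw [this, rinner_smul_left, h2, mul_zero]
    have h4 : rinner D D = 0 := by
      conv_lhs => rw [hD, rinner_sub_right, ← hD, h2, h3, sub_zero]
    rw [rinner_self] at h4
    have h5 : D = 0 := norm_eq_zero.1 (sq_eq_zero_iff.1 h4)
    exact (sub_eq_zero.1 h5).symm
  · rintro h _ ⟨S, rfl⟩
    rw [hS]
    have hSS : (S : Matrix (Fin k) (Fin k) ℂ)ᴴ = S := S.2
    have h1 := rinner_conjTranspose (Complex.I • (S : Matrix (Fin k) (Fin k) ℂ)) (zᴴ * w)
    rw [h.eq, Matrix.conjTranspose_smul, hSS] at h1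
    have h2 : (star Complex.I) • (S : Matrix (Fin k) (Fin k) ℂ) =
        (-1 : ℝ) • Complex.I • (S : Matrix (Fin k) (Fin k) ℂ) := by
      simp
    rw [h2, rinner_smul_left] at h1
    linarith

/-- Every value of `Dπ(z)` is taken in a horizontal direction: drop the vertical component. -/
theorem exists_horizontal_dproj_eq {n k : ℕ} (z w : Matrix (Fin n) (Fin k) ℂ) :
    ∃ v, (zᴴ * v).IsHermitian ∧ dproj z v = dproj z w := by
  obtain ⟨_, ⟨S, rfl⟩, u, hu, h⟩ :=
    (LinearMap.range (verticalLin z)).exists_add_mem_mem_orthogonal (muLin n k w)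
  obtain ⟨v, rfl⟩ := muLin_surjective n k u
  refine ⟨v, (muLin_mem_orthogonal_iff z v).1 hu, ?_⟩
  have h1 : w = z * (Complex.I • (S : Matrix (Fin k) (Fin k) ℂ)) + v := by
    rw [verticalLin_apply, ← map_add] at h
    rw [← sub_eq_zero, ← norm_eq_zero, ← norm_muLin, map_sub, h, sub_self, norm_zero]
  rw [h1, dproj_add_right, dproj_vertical, zero_add]

/-- The horizontal space is the orthogonal complement of the vertical directions, on which `Q̂`
vanishes, so the least horizontal value is the eigenvalue of `Q̂` of index `2nk - k²`. -/
theorem lam_qHatMat_eq {n k m : ℕ} {A : Fin m → Matrix (Fin n) (Fin n) ℂ}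
    (hA : ∀ j, (A j).IsHermitian) (hk : 0 < k) (hkn : k ≤ n) {z : Matrix (Fin n) (Fin k) ℂ}
    (hz : z.rank = k) {c : ℝ} (hc : IsLeast (horizontalValues A z) c) :
    lam (2 * n * k - k ^ 2) (qHatMat A z) = c := by
  have hc0 : 0 ≤ c := by
    obtain ⟨⟨w, -, -, rfl⟩, -⟩ := hc
    exact qform_nonneg A _
  have hkk : k ^ 2 ≤ n * k := by rw [sq]; exact Nat.mul_le_mul_right k hkn
  have hpos : 0 < k ^ 2 := by positivity
  have hcard : 2 * n * k = 2 * (n * k) := by ring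
  have hH : (qHatMat A z).IsHermitian := by
    rw [qHatMat_eq hA]
    exact isHermitian_sum_vecMulVec _
  refine lam_eq_of_isLeast (K := LinearMap.range (verticalLin z)) hH (by omega) ?_ ?_ hc0 ?_
  · rw [finrank_range_verticalLin hz, card_muIdx]; omega
  · rintro _ ⟨S, rfl⟩
    rw [qHatMat_eq hA, Matrix.sum_mulVec]
    refine Finset.sum_eq_zero fun j _ => ?_
    rw [Matrix.vecMulVec_mulVec]
    have h1 : ((2 : ℝ) • mu (A j * z)) ⬝ᵥ (verticalLin z S).ofLp = 0 := by
      have h2 := rinner_dproj (hA j) z (z * (Complex.I • (S : Matrix (Fin k) (Fin k) ℂ)))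
      rw [dproj_vertical, rinner_comm, rinner_zero_right, rinner_comm, ← sum_mu_mul_mu] at h2
      rw [smul_dotProduct, smul_eq_mul]
      exact h2.symm
    rw [h1]
    simp
  · convert! hc using 1
    ext s
    have hmem (w : Matrix (Fin n) (Fin k) ℂ) :
        muLin n k w ∈ (LinearMap.range (verticalLin z))ᗮ ↔ w ∈ horizontalSpace z := by
      rw [mem_horizontalSpace_iff hz, muLin_mem_orthogonal_iff]
    have hform (w : Matrix (Fin n) (Fin k) ℂ) :
        (muLin n k w).ofLp ⬝ᵥ qHatMat A z *ᵥ (muLin n k w).ofLp = qform A (dproj z w) := by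
      rw [qHatMat_eq hA, dotProduct_sum_vecMulVec]
      refine Finset.sum_congr rfl fun j _ => ?_
      rw [rinner_dproj (hA j), ← sum_mu_mul_mu, dotProduct_smul, smul_eq_mul]
      rfl
    constructor
    · rintro ⟨v, hv, hv1, rfl⟩
      obtain ⟨w, rfl⟩ := muLin_surjective n k v
      exact ⟨w, (hmem w).1 hv, by rw [← norm_muLin, hv1], hform w⟩
    · rintro ⟨w, hw, hw1, rfl⟩
      exact ⟨muLin n k w, (hmem w).2 hw, by rw [norm_muLin, hw1], (hform w).symm⟩

/-! ### The geometric bound `a(z)` -/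

theorem IsReduction.rangeProj_eq {n r k : ℕ} {z : Matrix (Fin n) (Fin r) ℂ}
    {zhat : Matrix (Fin n) (Fin k) ℂ} (h : IsReduction z zhat) : rangeProj z = rangeProj zhat := by
  obtain ⟨V, hV, rfl⟩ := h.exists_coisometry
  exact rangeProj_mul_coisometry zhat hV

theorem tangentValues_congr {n k l m : ℕ} (A : Fin m → Matrix (Fin n) (Fin n) ℂ)
    {x : Matrix (Fin n) (Fin k) ℂ} {y : Matrix (Fin n) (Fin l) ℂ}
    (h : rangeProj x = rangeProj y) : tangentValues A x = tangentValues A y := by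
  rw [tangentValues, tangentValues, tangentSpace_congr h]

theorem isCompact_unit_tangent {n k : ℕ} (z : Matrix (Fin n) (Fin k) ℂ) :
    IsCompact (Metric.sphere (0 : Matrix (Fin n) (Fin n) ℂ) 1 ∩ tangentSpace z) := by
  refine (isCompact_sphere _ _).inter_right (IsClosed.inter ?_ ?_)
  · exact isClosed_eq (by fun_prop) continuous_id
  · exact isClosed_eq (by fun_prop) continuous_const

theorem proj_mem_tangentSpace {n k : ℕ} (z : Matrix (Fin n) (Fin k) ℂ) :
    proj z ∈ tangentSpace z := by
  refine (mem_tangentSpace_iff z _).2 ⟨(2⁻¹ : ℝ) • z, ?_⟩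
  rw [dproj_smul_right, dproj, proj, ← two_smul ℝ, smul_smul]
  norm_num

open scoped ComplexOrder in
theorem proj_ne_zero {n k : ℕ} {z : Matrix (Fin n) (Fin k) ℂ} (hz : z ≠ 0) : proj z ≠ 0 :=
  fun h => hz (Matrix.self_mul_conjTranspose_eq_zero.1 h)

theorem smul_mem_tangentSpace {n k : ℕ} {z : Matrix (Fin n) (Fin k) ℂ}
    {W : Matrix (Fin n) (Fin n) ℂ} (hW : W ∈ tangentSpace z) (t : ℝ) :
    t • W ∈ tangentSpace z := by
  obtain ⟨w, rfl⟩ := (mem_tangentSpace_iff z W).1 hW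
  exact (mem_tangentSpace_iff z _).2 ⟨t • w, by rw [dproj_smul_right]⟩

theorem norm_inv_norm_smul {p q : ℕ} {W : Matrix (Fin p) (Fin q) ℂ} (hW : W ≠ 0) :
    ‖‖W‖⁻¹ • W‖ = 1 := by
  rw [norm_smul, norm_inv, norm_norm, inv_mul_cancel₀ (norm_ne_zero_iff.2 hW)]

theorem isLeast_sInf_tangentValues {n k m : ℕ} (A : Fin m → Matrix (Fin n) (Fin n) ℂ)
    {z : Matrix (Fin n) (Fin k) ℂ} (hz : z ≠ 0) :
    IsLeast (tangentValues A z) (sInf (tangentValues A z)) := by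
  have h1 : tangentValues A z =
      qform A '' (Metric.sphere (0 : Matrix (Fin n) (Fin n) ℂ) 1 ∩ tangentSpace z) := by
    ext s
    constructor
    · rintro ⟨W, hW, hW1, rfl⟩
      exact ⟨W, ⟨by simpa using hW1, hW⟩, rfl⟩
    · rintro ⟨W, ⟨hW1, hW⟩, rfl⟩
      exact ⟨W, hW, by simpa using hW1, rfl⟩
  rw [h1]
  refine ((isCompact_unit_tangent z).image (continuous_qform A)).isLeast_sInf
    (Set.Nonempty.image _ ⟨‖proj z‖⁻¹ • proj z, ?_, ?_⟩)
  · simpa using norm_inv_norm_smul (proj_ne_zero hz)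
  · exact smul_mem_tangentSpace (proj_mem_tangentSpace z) _

theorem isLeast_aGeom {n r m : ℕ} (A : Fin m → Matrix (Fin n) (Fin n) ℂ)
    {z : Matrix (Fin n) (Fin r) ℂ} (hz : z ≠ 0) : IsLeast (tangentValues A z) (aGeom A z) := by
  have h : aGeom A z = sInf (tangentValues A z) := by
    rw [aGeom]
    congr 1
    ext s
    constructor
    · rintro ⟨zhat, hr, hs⟩
      rwa [tangentValues_congr A hr.rangeProj_eq]
    · intro hs
      obtain ⟨zhat, hr⟩ := exists_isReduction z rfl
      exact ⟨zhat, hr, by rwa [← tangentValues_congr A hr.rangeProj_eq]⟩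
  rw [h]
  exact isLeast_sInf_tangentValues A hz

theorem isLeast_aGeom_reduction {n r k m : ℕ} (A : Fin m → Matrix (Fin n) (Fin n) ℂ)
    {z : Matrix (Fin n) (Fin r) ℂ} (hz : z ≠ 0) {zhat : Matrix (Fin n) (Fin k) ℂ}
    (h : IsReduction z zhat) : IsLeast (tangentValues A zhat) (aGeom A z) := by
  rw [← tangentValues_congr A h.rangeProj_eq]
  exact isLeast_aGeom A hz

theorem aGeom_mul_norm_sq_le {n r m : ℕ} (A : Fin m → Matrix (Fin n) (Fin n) ℂ)
    {z : Matrix (Fin n) (Fin r) ℂ} (hz : z ≠ 0) {W : Matrix (Fin n) (Fin n) ℂ}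
    (hW : W ∈ tangentSpace z) : aGeom A z * ‖W‖ ^ 2 ≤ qform A W := by
  by_cases hW0 : W = 0
  · subst hW0; simpa using qform_nonneg A 0
  · have h1 : aGeom A z ≤ qform A (‖W‖⁻¹ • W) :=
      (isLeast_aGeom A hz).2 ⟨_, smul_mem_tangentSpace hW _, norm_inv_norm_smul hW0, rfl⟩
    rw [qform_smul, inv_pow, inv_mul_eq_div] at h1
    exact (le_div_iff₀ (by positivity)).1 h1

theorem aGeom_nonneg {n r m : ℕ} (A : Fin m → Matrix (Fin n) (Fin n) ℂ)
    {z : Matrix (Fin n) (Fin r) ℂ} (hz : z ≠ 0) : 0 ≤ aGeom A z := by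
  obtain ⟨⟨W, -, -, hW⟩, -⟩ := isLeast_aGeom A hz
  rw [hW]; exact qform_nonneg A W

theorem aGeom_le_of_rangeProj {n r s m : ℕ} (A : Fin m → Matrix (Fin n) (Fin n) ℂ)
    {z : Matrix (Fin n) (Fin r) ℂ} {y : Matrix (Fin n) (Fin s) ℂ} (hz : z ≠ 0) (hy : y ≠ 0)
    (h : rangeProj y * z = z) : aGeom A y ≤ aGeom A z := by
  obtain ⟨⟨W, hW, hW1, he⟩, -⟩ := isLeast_aGeom A hz
  exact (isLeast_aGeom A hy).2 ⟨W, tangentSpace_mono h hW, hW1, he⟩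

/-! ### The global bound `a₀` -/

theorem proj_sub_ne_zero {n r : ℕ} {x y : Matrix (Fin n) (Fin r) ℂ} (h : ¬ UEquiv x y) :
    proj x - proj y ≠ 0 := fun h' => h ((uEquiv_iff_proj_eq x y).2 (sub_eq_zero.1 h'))

theorem not_uEquiv_of_proj_sub {n r : ℕ} {x y : Matrix (Fin n) (Fin r) ℂ}
    (h : proj x - proj y ≠ 0) : ¬ UEquiv x y :=
  fun h' => h (sub_eq_zero.2 ((uEquiv_iff_proj_eq x y).1 h'))

theorem quotient_nonneg {n r m : ℕ} (A : Fin m → Matrix (Fin n) (Fin n) ℂ)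
    (x y : Matrix (Fin n) (Fin r) ℂ) (c : ℝ) : 0 ≤ betaDistSq A x y / c ^ 2 := by
  rw [betaDistSq_eq]
  exact div_nonneg (qform_nonneg A _) (sq_nonneg _)

theorem aGlobal_le {n r m : ℕ} (A : Fin m → Matrix (Fin n) (Fin n) ℂ)
    {x y : Matrix (Fin n) (Fin r) ℂ} (h : ¬ UEquiv x y) :
    aGlobal r A ≤ betaDistSq A x y / ‖proj x - proj y‖ ^ 2 :=
  csInf_le ⟨0, by rintro _ ⟨x, y, -, rfl⟩; exact quotient_nonneg A x y _⟩ ⟨x, y, h, rfl⟩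

/-- A unit tangent vector `Dπ(z)(w)` is the difference `xx* - yy*` for `x, y = z ± w/2`. -/
theorem aGlobal_le_aGeom {n r m : ℕ} (A : Fin m → Matrix (Fin n) (Fin n) ℂ)
    {z : Matrix (Fin n) (Fin r) ℂ} (hz : z ≠ 0) : aGlobal r A ≤ aGeom A z := by
  obtain ⟨⟨W, hW, hW1, he⟩, -⟩ := isLeast_aGeom A hz
  obtain ⟨w, rfl⟩ := (mem_tangentSpace_iff z W).1 hW
  have h1 : proj (z + (2⁻¹ : ℝ) • w) - proj (z - (2⁻¹ : ℝ) • w) = dproj z w := by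
    rw [proj_sub_proj]
    congr 1 <;> module
  have h2 := aGlobal_le A (x := z + (2⁻¹ : ℝ) • w) (y := z - (2⁻¹ : ℝ) • w)
    (not_uEquiv_of_proj_sub (by rw [h1, ← norm_ne_zero_iff, hW1]; exact one_ne_zero))
  rw [betaDistSq_eq, h1, hW1, one_pow, div_one] at h2
  rw [he]; exact h2

theorem le_quotient_of_le_aGeom {n r m : ℕ} (A : Fin m → Matrix (Fin n) (Fin n) ℂ) {b : ℝ}
    (hb : ∀ z : Matrix (Fin n) (Fin r) ℂ, z ≠ 0 → b ≤ aGeom A z)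
    {x y : Matrix (Fin n) (Fin r) ℂ} (h : ¬ UEquiv x y) :
    b ≤ betaDistSq A x y / ‖proj x - proj y‖ ^ 2 := by
  have h1 := proj_sub_ne_zero h
  have h2 := proj_sub_proj x y
  have hs : (2⁻¹ : ℝ) • (x + y) ≠ 0 := by
    intro h0
    rw [h0, dproj_zero_left] at h2
    exact h1 h2
  have h3 := aGeom_mul_norm_sq_le A hs ((mem_tangentSpace_iff _ _).2 ⟨x - y, h2⟩)
  rw [betaDistSq_eq, le_div_iff₀ (by have := norm_pos_iff.2 h1; positivity)]
  exact (mul_le_mul_of_nonneg_right (hb _ hs) (sq_nonneg _)).trans h3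

theorem exists_ne_zero_matrix {n r : ℕ} (hr : 0 < r) (hn : 0 < n) :
    ∃ z : Matrix (Fin n) (Fin r) ℂ, z ≠ 0 :=
  ⟨Matrix.of fun _ _ => 1, fun h => one_ne_zero (congrFun (congrFun h ⟨0, hn⟩) ⟨0, hr⟩)⟩

theorem exists_not_uEquiv {n r : ℕ} (hr : 0 < r) (hn : 0 < n) :
    ∃ x y : Matrix (Fin n) (Fin r) ℂ, ¬ UEquiv x y := by
  obtain ⟨z, hz⟩ := exists_ne_zero_matrix hr hn
  refine ⟨z, 0, not_uEquiv_of_proj_sub ?_⟩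
  have : proj (0 : Matrix (Fin n) (Fin r) ℂ) = 0 := by simp [proj]
  rw [this, sub_zero]
  exact proj_ne_zero hz

theorem le_aGlobal {n r m : ℕ} (hr : 0 < r) (hn : 0 < n) (A : Fin m → Matrix (Fin n) (Fin n) ℂ)
    {b : ℝ} (hb : ∀ z : Matrix (Fin n) (Fin r) ℂ, z ≠ 0 → b ≤ aGeom A z) : b ≤ aGlobal r A := by
  obtain ⟨x, y, h⟩ := exists_not_uEquiv (n := n) hr hn
  refine le_csInf ⟨_, x, y, h, rfl⟩ ?_
  rintro _ ⟨x, y, h, rfl⟩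
  exact le_quotient_of_le_aGeom A hb h

theorem isGLB_aGeom {n r m : ℕ} (hr : 0 < r) (hn : 0 < n)
    (A : Fin m → Matrix (Fin n) (Fin n) ℂ) :
    IsGLB (aGeom A '' {z : Matrix (Fin n) (Fin r) ℂ | z ≠ 0}) (aGlobal r A) := by
  refine ⟨?_, fun b hb => le_aGlobal hr hn A fun z hz => hb ⟨z, hz, rfl⟩⟩
  rintro _ ⟨z, hz, rfl⟩
  exact aGlobal_le_aGeom A hz

/-- The pairs of a unitary matrix and a unit vector of the tangent space determined by its first
`r` columns. -/
def unitaryTangent {n r : ℕ} (hrn : r ≤ n) :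
    Set (Matrix (Fin n) (Fin n) ℂ × Matrix (Fin n) (Fin n) ℂ) :=
  {p | p.1ᴴ * p.1 = 1 ∧ ‖p.2‖ = 1 ∧ p.2ᴴ = p.2 ∧
    (1 - leftCols hrn p.1 * (leftCols hrn p.1)ᴴ) * p.2 *
      (1 - leftCols hrn p.1 * (leftCols hrn p.1)ᴴ) = 0}

theorem mem_unitaryTangent_iff {n r : ℕ} (hrn : r ≤ n) (U W : Matrix (Fin n) (Fin n) ℂ) :
    (U, W) ∈ unitaryTangent hrn ↔
      Uᴴ * U = 1 ∧ ‖W‖ = 1 ∧ W ∈ tangentSpace (leftCols hrn U) := by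
  refine and_congr_right fun hU => and_congr_right fun _ => ?_
  rw [← rangeProj_of_orthonormal (leftCols_isometry hrn hU)]
  rfl

theorem continuous_leftCols {n r : ℕ} (hrn : r ≤ n) :
    Continuous fun U : Matrix (Fin n) (Fin n) ℂ => leftCols hrn U := by
  unfold leftCols
  fun_prop

theorem isCompact_unitaryTangent {n r : ℕ} (hrn : r ≤ n) :
    IsCompact (unitaryTangent (n := n) hrn) := by
  have hP : Continuous fun p : Matrix (Fin n) (Fin n) ℂ × Matrix (Fin n) (Fin n) ℂ =>
      1 - leftCols hrn p.1 * (leftCols hrn p.1)ᴴ := by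
    have := (continuous_leftCols hrn).comp
      (continuous_fst (X := Matrix (Fin n) (Fin n) ℂ) (Y := Matrix (Fin n) (Fin n) ℂ))
    exact continuous_const.sub (this.matrix_mul this.matrix_conjTranspose)
  have hS : IsClosed (unitaryTangent (n := n) hrn) := by
    refine IsClosed.inter ?_ (IsClosed.inter ?_ (IsClosed.inter ?_ ?_))
    · exact isClosed_eq (continuous_fst.matrix_conjTranspose.matrix_mul continuous_fst)
        continuous_const
    · exact isClosed_eq continuous_snd.norm continuous_const
    · exact isClosed_eq continuous_snd.matrix_conjTranspose continuous_snd
    · exact isClosed_eq ((hP.matrix_mul continuous_snd).matrix_mul hP) continuous_const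
  refine IsCompact.of_isClosed_subset ((isCompact_sphere (0 : Matrix (Fin n) (Fin n) ℂ)
      ‖(1 : Matrix (Fin n) (Fin n) ℂ)‖).prod (isCompact_sphere 0 1)) hS ?_
  rintro ⟨U, W⟩ ⟨hU, hW, -⟩
  have h := norm_isometry_mul (1 : Matrix (Fin n) (Fin n) ℂ) hU
  rw [Matrix.mul_one] at h
  exact ⟨mem_sphere_zero_iff_norm.2 h, mem_sphere_zero_iff_norm.2 hW⟩

/-- The global bound is attained at some matrix with orthonormal columns: enlarging the range only
decreases `a`, and pairs of a unitary matrix and a unit tangent vector form a compact set. -/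
theorem exists_unitary_aGeom_eq_aGlobal {n r m : ℕ} (hr : 0 < r) (hrn : r ≤ n)
    (A : Fin m → Matrix (Fin n) (Fin n) ℂ) :
    ∃ U ∈ Matrix.unitaryGroup (Fin n) ℂ, aGeom A (leftCols hrn U) = aGlobal r A := by
  have hne (U : Matrix (Fin n) (Fin n) ℂ) (hU : Uᴴ * U = 1) : leftCols hrn U ≠ 0 :=
    ne_zero_of_rank_pos (by rw [rank_of_isometry (leftCols_isometry hrn hU)]; exact hr)
  have hvalue (U : Matrix (Fin n) (Fin n) ℂ) (hU : Uᴴ * U = 1) : ∃ W,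
      (U, W) ∈ unitaryTangent hrn ∧ aGeom A (leftCols hrn U) = qform A W := by
    obtain ⟨⟨W, hW, hW1, he⟩, -⟩ := isLeast_aGeom A (hne U hU)
    exact ⟨W, (mem_unitaryTangent_iff hrn U W).2 ⟨hU, hW1, hW⟩, he⟩
  obtain ⟨W1, hW1, -⟩ := hvalue 1 (by simp)
  obtain ⟨⟨U, W⟩, hUW, hmin⟩ := (isCompact_unitaryTangent hrn).exists_isMinOn ⟨_, hW1⟩
    ((continuous_qform A).comp continuous_snd).continuousOn
  have hmin' := isMinOn_iff.1 hmin
  simp only [Function.comp_apply] at hmin'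
  obtain ⟨hU, hWn, hW⟩ := (mem_unitaryTangent_iff hrn U W).1 hUW
  refine ⟨U, Matrix.mem_unitaryGroup_iff'.2 hU, le_antisymm ?_ (aGlobal_le_aGeom A (hne U hU))⟩
  refine le_aGlobal hr (hr.trans_le hrn) A fun z hz => ?_
  have hzr : z.rank ≤ r := by simpa using z.rank_le_width
  obtain ⟨V, hV, hVz⟩ := exists_unitary_leftCols hrn z hzr
  rw [← rangeProj_of_orthonormal (leftCols_isometry hrn hV)] at hVz
  obtain ⟨W', hW', he⟩ := hvalue V hV
  calc aGeom A (leftCols hrn U) ≤ qform A W := (isLeast_aGeom A (hne U hU)).2 ⟨W, hW, hWn, rfl⟩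
    _ ≤ qform A W' := hmin' (V, W') hW'
    _ = aGeom A (leftCols hrn V) := he.symm
    _ ≤ aGeom A z := aGeom_le_of_rangeProj A hz (hne V hV) hVz

/-! ### The local bounds `a₁` and `a₂` -/

/-- A bounded function that decreases with the radius has a limit at radius `0`. -/
theorem tendsto_limUnder_of_antitoneOn {f : ℝ → ℝ} (hf : AntitoneOn f (Set.Ioi 0))
    (hb : BddAbove (f '' Set.Ioi 0)) : Tendsto f (𝓝[>] 0) (𝓝 (limUnder (𝓝[>] 0) f)) := by
  refine tendsto_nhds_limUnder ⟨_, hf.tendsto_nhdsGT hb⟩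

/-- Along `x = z + t w` the difference quotients converge to the value at `Dπ(z)(w)`. -/
theorem eventually_curve {n r m : ℕ} (A : Fin m → Matrix (Fin n) (Fin n) ℂ)
    {z w : Matrix (Fin n) (Fin r) ℂ} (hw : dproj z w ≠ 0) {R : ℝ} (hR : 0 < R) :
    ∀ᶠ t : ℝ in 𝓝[>] 0, ‖proj (z + t • w) - proj z‖ < R ∧ ¬ UEquiv (z + t • w) z ∧
      betaDistSq A (z + t • w) z / ‖proj (z + t • w) - proj z‖ ^ 2 =
        qform A (dproj z w + t • proj w) / ‖dproj z w + t • proj w‖ ^ 2 := by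
  have h0 (t : ℝ) : proj (z + t • w) - proj z = t • (dproj z w + t • proj w) := by
    rw [proj_add_smul]
    module
  have hc1 : Continuous fun t : ℝ => t • (dproj z w + t • proj w) := by fun_prop
  have hc2 : Continuous fun t : ℝ => dproj z w + t • proj w := by fun_prop
  have e1 : ∀ᶠ t : ℝ in 𝓝[>] 0, ‖t • (dproj z w + t • proj w)‖ < R := by
    refine Filter.Eventually.filter_mono nhdsWithin_le_nhds ?_
    exact hc1.norm.continuousAt.eventually_lt continuousAt_const (by simpa using hR)
  have e2 : ∀ᶠ t : ℝ in 𝓝[>] 0, dproj z w + t • proj w ≠ 0 := by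
    refine Filter.Eventually.filter_mono nhdsWithin_le_nhds ?_
    exact hc2.continuousAt.eventually_ne (by simpa using hw)
  filter_upwards [e1, e2, self_mem_nhdsWithin] with t h1 h2 ht
  have ht0 : t ≠ 0 := (Set.mem_Ioi.1 ht).ne'
  refine ⟨by rwa [h0], not_uEquiv_of_proj_sub ?_, ?_⟩
  · rw [h0]; exact smul_ne_zero ht0 h2
  · rw [betaDistSq_eq, h0, qform_smul, norm_smul, mul_pow, Real.norm_eq_abs, sq_abs,
      mul_div_mul_left _ _ (pow_ne_zero 2 ht0)]

theorem exists_unit_dproj {n r m : ℕ} (A : Fin m → Matrix (Fin n) (Fin n) ℂ)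
    {z : Matrix (Fin n) (Fin r) ℂ} (hz : z ≠ 0) :
    ∃ w, ‖dproj z w‖ = 1 ∧ qform A (dproj z w) = aGeom A z := by
  obtain ⟨⟨W, hW, hW1, he⟩, -⟩ := isLeast_aGeom A hz
  obtain ⟨w, rfl⟩ := (mem_tangentSpace_iff z W).1 hW
  exact ⟨w, hW1, he.symm⟩

theorem localInf1_set_nonempty {n r m : ℕ} (A : Fin m → Matrix (Fin n) (Fin n) ℂ)
    {z : Matrix (Fin n) (Fin r) ℂ} (hz : z ≠ 0) {R : ℝ} (hR : 0 < R) :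
    {s | ∃ x : Matrix (Fin n) (Fin r) ℂ, ‖proj x - proj z‖ < R ∧ ¬ UEquiv x z ∧
      s = betaDistSq A x z / ‖proj x - proj z‖ ^ 2}.Nonempty := by
  obtain ⟨w, hw, -⟩ := exists_unit_dproj A hz
  have hw0 : dproj z w ≠ 0 := norm_ne_zero_iff.1 (by rw [hw]; exact one_ne_zero)
  obtain ⟨t, h1, h2, -⟩ := (eventually_curve A hw0 hR).exists
  exact ⟨_, _, h1, h2, rfl⟩

theorem localInf1_le_aGeom {n r m : ℕ} (A : Fin m → Matrix (Fin n) (Fin n) ℂ)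
    {z : Matrix (Fin n) (Fin r) ℂ} (hz : z ≠ 0) {R : ℝ} (hR : 0 < R) :
    localInf1 A z R ≤ aGeom A z := by
  obtain ⟨w, hw, he⟩ := exists_unit_dproj A hz
  have hw0 : dproj z w ≠ 0 := norm_ne_zero_iff.1 (by rw [hw]; exact one_ne_zero)
  have hlim : Tendsto (fun t : ℝ => qform A (dproj z w + t • proj w) /
      ‖dproj z w + t • proj w‖ ^ 2) (𝓝[>] 0) (𝓝 (aGeom A z)) := by
    have hc : Continuous fun t : ℝ => dproj z w + t • proj w := by fun_prop
    have h1 : ContinuousAt (fun t : ℝ => qform A (dproj z w + t • proj w) /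
        ‖dproj z w + t • proj w‖ ^ 2) 0 :=
      ((continuous_qform A).comp hc).continuousAt.div (hc.norm.pow 2).continuousAt
        (by simp [hw])
    have h2 := h1.tendsto.mono_left (nhdsWithin_le_nhds (s := Set.Ioi 0))
    simpa [hw, he] using h2
  refine ge_of_tendsto hlim ?_
  filter_upwards [eventually_curve A hw0 hR] with t ht
  rw [← ht.2.2]
  exact csInf_le ⟨0, by rintro _ ⟨x, -, -, rfl⟩; exact quotient_nonneg A x z _⟩
    ⟨_, ht.1, ht.2.1, rfl⟩

theorem localInf2_le_localInf1 {n r m : ℕ} (A : Fin m → Matrix (Fin n) (Fin n) ℂ)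
    {z : Matrix (Fin n) (Fin r) ℂ} (hz : z ≠ 0) {R : ℝ} (hR : 0 < R) :
    localInf2 A z R ≤ localInf1 A z R := by
  refine csInf_le_csInf ⟨0, ?_⟩ (localInf1_set_nonempty A hz hR) ?_
  · rintro _ ⟨x, y, -, -, -, rfl⟩; exact quotient_nonneg A x y _
  · rintro _ ⟨x, h1, h2, rfl⟩
    exact ⟨x, z, h1, by simpa using hR, h2, rfl⟩

theorem localInf2_set_nonempty {n r m : ℕ} (A : Fin m → Matrix (Fin n) (Fin n) ℂ)
    {z : Matrix (Fin n) (Fin r) ℂ} (hz : z ≠ 0) {R : ℝ} (hR : 0 < R) :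
    {s | ∃ x y : Matrix (Fin n) (Fin r) ℂ, ‖proj x - proj z‖ < R ∧ ‖proj y - proj z‖ < R ∧
      ¬ UEquiv x y ∧ s = betaDistSq A x y / ‖proj x - proj y‖ ^ 2}.Nonempty := by
  obtain ⟨_, x, h1, h2, -⟩ := localInf1_set_nonempty A hz hR
  exact ⟨_, x, z, h1, by simpa using hR, h2, rfl⟩

theorem aGlobal_le_localInf2 {n r m : ℕ} (A : Fin m → Matrix (Fin n) (Fin n) ℂ)
    {z : Matrix (Fin n) (Fin r) ℂ} (hz : z ≠ 0) {R : ℝ} (hR : 0 < R) :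
    aGlobal r A ≤ localInf2 A z R := by
  refine le_csInf (localInf2_set_nonempty A hz hR) ?_
  rintro _ ⟨x, y, -, -, h, rfl⟩
  exact aGlobal_le A h

theorem tendsto_localInf1 {n r m : ℕ} (A : Fin m → Matrix (Fin n) (Fin n) ℂ)
    {z : Matrix (Fin n) (Fin r) ℂ} (hz : z ≠ 0) :
    Tendsto (localInf1 A z) (𝓝[>] 0) (𝓝 (aOne A z)) := by
  refine tendsto_limUnder_of_antitoneOn ?_ ⟨aGeom A z, ?_⟩
  · intro R hR R' _ hle
    refine csInf_le_csInf ⟨0, ?_⟩ (localInf1_set_nonempty A hz hR) ?_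
    · rintro _ ⟨x, -, -, rfl⟩; exact quotient_nonneg A x z _
    · rintro _ ⟨x, h1, h2, rfl⟩
      exact ⟨x, h1.trans_le hle, h2, rfl⟩
  · rintro _ ⟨R, hR, rfl⟩
    exact localInf1_le_aGeom A hz hR

theorem tendsto_localInf2 {n r m : ℕ} (A : Fin m → Matrix (Fin n) (Fin n) ℂ)
    {z : Matrix (Fin n) (Fin r) ℂ} (hz : z ≠ 0) :
    Tendsto (localInf2 A z) (𝓝[>] 0) (𝓝 (aTwo A z)) := by
  refine tendsto_limUnder_of_antitoneOn ?_ ⟨aGeom A z, ?_⟩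
  · intro R hR R' _ hle
    refine csInf_le_csInf ⟨0, ?_⟩ (localInf2_set_nonempty A hz hR) ?_
    · rintro _ ⟨x, y, -, -, -, rfl⟩; exact quotient_nonneg A x y _
    · rintro _ ⟨x, y, h1, h2, h3, rfl⟩
      exact ⟨x, y, h1.trans_le hle, h2.trans_le hle, h3, rfl⟩
  · rintro _ ⟨R, hR, rfl⟩
    exact (localInf2_le_localInf1 A hz hR).trans (localInf1_le_aGeom A hz hR)

theorem aGlobal_le_aTwo {n r m : ℕ} (A : Fin m → Matrix (Fin n) (Fin n) ℂ)
    {z : Matrix (Fin n) (Fin r) ℂ} (hz : z ≠ 0) : aGlobal r A ≤ aTwo A z := by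
  refine ge_of_tendsto (tendsto_localInf2 A hz) ?_
  filter_upwards [self_mem_nhdsWithin] with R hR using aGlobal_le_localInf2 A hz hR

theorem aTwo_le_aOne {n r m : ℕ} (A : Fin m → Matrix (Fin n) (Fin n) ℂ)
    {z : Matrix (Fin n) (Fin r) ℂ} (hz : z ≠ 0) : aTwo A z ≤ aOne A z := by
  refine le_of_tendsto_of_tendsto (tendsto_localInf2 A hz) (tendsto_localInf1 A hz) ?_
  filter_upwards [self_mem_nhdsWithin] with R hR using localInf2_le_localInf1 A hz hR

theorem aOne_le_aGeom {n r m : ℕ} (A : Fin m → Matrix (Fin n) (Fin n) ℂ)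
    {z : Matrix (Fin n) (Fin r) ℂ} (hz : z ≠ 0) : aOne A z ≤ aGeom A z := by
  refine le_of_tendsto (tendsto_localInf1 A hz) ?_
  filter_upwards [self_mem_nhdsWithin] with R hR using localInf1_le_aGeom A hz hR

theorem isGLB_of_between {n r m : ℕ} (hr : 0 < r) (hn : 0 < n)
    (A : Fin m → Matrix (Fin n) (Fin n) ℂ) (f : Matrix (Fin n) (Fin r) ℂ → ℝ)
    (h1 : ∀ z, z ≠ 0 → aGlobal r A ≤ f z) (h2 : ∀ z, z ≠ 0 → f z ≤ aGeom A z) :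
    IsGLB (f '' {z : Matrix (Fin n) (Fin r) ℂ | z ≠ 0}) (aGlobal r A) := by
  refine ⟨?_, fun b hb => le_aGlobal hr hn A fun z hz => (hb ⟨z, hz, rfl⟩).trans (h2 z hz)⟩
  rintro _ ⟨z, hz, rfl⟩
  exact h1 z hz

section

open scoped ComplexOrder

/-! ### The geometric bound `â(z)` -/

theorem horizontalValues_subset {n k m : ℕ} (A : Fin m → Matrix (Fin n) (Fin n) ℂ)
    {x y : Matrix (Fin n) (Fin k) ℂ} (hx : x.rank = k) (hy : y.rank = k) (h : proj x = proj y) :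
    horizontalValues A x ⊆ horizontalValues A y := by
  obtain ⟨U, hU, rfl⟩ := (uEquiv_iff_proj_eq x y).2 h
  have h1 := mul_conjTranspose_self_of_mem hU
  have h2 := conjTranspose_mul_self_of_mem hU
  rintro _ ⟨w, hw, hw1, rfl⟩
  have hwU : w = w * Uᴴ * U := by rw [Matrix.mul_assoc, h2, Matrix.mul_one]
  refine ⟨w * Uᴴ, ?_, ?_, ?_⟩
  · rw [mem_horizontalSpace_iff hx] at hw
    rw [mem_horizontalSpace_iff hy]
    have h3 := Matrix.isHermitian_mul_mul_conjTranspose U hw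
    rw [Matrix.conjTranspose_mul] at h3
    simpa only [← Matrix.mul_assoc, h1, Matrix.one_mul] using h3
  · rw [norm_mul_coisometry, hw1]
    rw [Matrix.conjTranspose_conjTranspose, h2]
  · conv_lhs => rw [hwU]
    simp only [dproj_mul_coisometry _ _ h1]

theorem isLeast_sInf_horizontalValues {n k m : ℕ} (A : Fin m → Matrix (Fin n) (Fin n) ℂ)
    {z : Matrix (Fin n) (Fin k) ℂ} (hz : z.rank = k) (hk : 0 < k) :
    IsLeast (horizontalValues A z) (sInf (horizontalValues A z)) := by
  have h1 : horizontalValues A z = (fun w => qform A (dproj z w)) ''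
      (Metric.sphere (0 : Matrix (Fin n) (Fin k) ℂ) 1 ∩ {w | (zᴴ * w)ᴴ = zᴴ * w}) := by
    ext s
    constructor
    · rintro ⟨w, hw, hw1, rfl⟩
      exact ⟨w, ⟨by simpa using hw1, (mem_horizontalSpace_iff hz w).1 hw⟩, rfl⟩
    · rintro ⟨w, ⟨hw1, hw⟩, rfl⟩
      exact ⟨w, (mem_horizontalSpace_iff hz w).2 hw, by simpa using hw1, rfl⟩
  rw [h1]
  have hz0 : z ≠ 0 := ne_zero_of_rank_pos (hz.symm ▸ hk)
  have hc : Continuous fun w => qform A (dproj z w) :=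
    (continuous_qform A).comp (continuous_dproj.comp (Continuous.prodMk_right z))
  refine (((isCompact_sphere _ _).inter_right ?_).image hc).isLeast_sInf
    (Set.Nonempty.image _ ⟨‖z‖⁻¹ • z, ?_, ?_⟩)
  · exact isClosed_eq (by fun_prop) (by fun_prop)
  · simpa using norm_inv_norm_smul hz0
  · change (zᴴ * (‖z‖⁻¹ • z))ᴴ = zᴴ * (‖z‖⁻¹ • z)
    rw [Matrix.mul_smul, Matrix.conjTranspose_smul, star_trivial, Matrix.conjTranspose_mul,
      Matrix.conjTranspose_conjTranspose]

theorem isLeast_aHatGeom {n r k m : ℕ} (A : Fin m → Matrix (Fin n) (Fin n) ℂ)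
    {z : Matrix (Fin n) (Fin r) ℂ} (hz : z.rank = k) (hk : 0 < k)
    {zhat : Matrix (Fin n) (Fin k) ℂ} (h : IsReduction z zhat) :
    IsLeast (horizontalValues A zhat) (aHatGeom A z) := by
  subst hz
  have h1 : aHatGeom A z = sInf (horizontalValues A zhat) := by
    rw [aHatGeom]
    congr 1
    ext s
    constructor
    · rintro ⟨y, hy, hs⟩
      have h2 := (isReduction_iff z y).1 hy
      have h3 := (isReduction_iff z zhat).1 h
      exact horizontalValues_subset A h2.2.1 h3.2.1 (h2.2.2.symm.trans h3.2.2) hs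
    · exact fun hs => ⟨zhat, h, hs⟩
  rw [h1]
  exact isLeast_sInf_horizontalValues A h.2.1 hk

theorem aHatGeom_mul_norm_sq_le {n r k m : ℕ} (A : Fin m → Matrix (Fin n) (Fin n) ℂ)
    {z : Matrix (Fin n) (Fin r) ℂ} (hz : z.rank = k) (hk : 0 < k)
    {zhat : Matrix (Fin n) (Fin k) ℂ} (h : IsReduction z zhat) {w : Matrix (Fin n) (Fin k) ℂ}
    (hw : (zhatᴴ * w).IsHermitian) :
    aHatGeom A z * ‖w‖ ^ 2 ≤ qform A (dproj zhat w) := by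
  by_cases hw0 : w = 0
  · subst hw0; simpa using qform_nonneg A _
  · have h1 : aHatGeom A z ≤ qform A (dproj zhat (‖w‖⁻¹ • w)) := by
      refine (isLeast_aHatGeom A hz hk h).2
        ⟨_, (mem_horizontalSpace_iff h.2.1 _).2 ?_, norm_inv_norm_smul hw0, rfl⟩
      rw [Matrix.IsHermitian, Matrix.mul_smul, Matrix.conjTranspose_smul, star_trivial, hw.eq]
    rw [dproj_smul_right, qform_smul, inv_pow, inv_mul_eq_div] at h1
    exact (le_div_iff₀ (by have := norm_pos_iff.2 hw0; positivity)).1 h1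

theorem aHatGeom_nonneg {n r m : ℕ} (A : Fin m → Matrix (Fin n) (Fin n) ℂ)
    {z : Matrix (Fin n) (Fin r) ℂ} (hz : z ≠ 0) : 0 ≤ aHatGeom A z := by
  obtain ⟨zhat, h⟩ := exists_isReduction z rfl
  obtain ⟨⟨w, -, -, hw⟩, -⟩ := isLeast_aHatGeom A rfl (rank_pos_of_ne_zero hz) h
  rw [hw]; exact qform_nonneg A _

theorem norm_eq_of_proj_eq {n k r : ℕ} {x : Matrix (Fin n) (Fin k) ℂ}
    {y : Matrix (Fin n) (Fin r) ℂ} (h : proj x = proj y) : ‖x‖ = ‖y‖ := by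
  have key {s : ℕ} (x : Matrix (Fin n) (Fin s) ℂ) : ‖x‖ ^ 2 = (Matrix.trace (proj x)).re := by
    rw [← rinner_self, rinner, proj, Matrix.trace_mul_comm]
  rw [← sq_eq_sq₀ (norm_nonneg _) (norm_nonneg _), key, key, h]

theorem dproj_ne_zero {n k : ℕ} {z w : Matrix (Fin n) (Fin k) ℂ} (hz : z.rank = k)
    (hw : (zᴴ * w).IsHermitian) (hw0 : w ≠ 0) : dproj z w ≠ 0 := by
  intro h
  have h1 := norm_dproj_sq hw
  rw [h, norm_zero] at h1
  have h2 : z * wᴴ = 0 := by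
    rw [← norm_eq_zero, ← sq_eq_zero_iff]
    nlinarith [sq_nonneg ‖z * wᴴ‖, sq_nonneg ‖zᴴ * w‖]
  obtain ⟨Z, hZ⟩ := exists_left_inverse hz
  have h3 : wᴴ = 0 := by
    have := congrArg (fun M => Z * M) h2
    simpa only [← Matrix.mul_assoc, hZ, Matrix.one_mul, Matrix.mul_zero] using this
  exact hw0 (Matrix.conjTranspose_eq_zero.1 h3)

/-! ### The local bounds `â₁` and `â₂` -/

theorem posSemidef_one_add {k : ℕ} {H : Matrix (Fin k) (Fin k) ℂ} (hH : H.IsHermitian)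
    (h1 : ‖H‖ ≤ 1) : (1 + H).PosSemidef := by
  have hH1 : (1 + H).IsHermitian := Matrix.isHermitian_one.add hH
  refine Matrix.PosSemidef.of_dotProduct_mulVec_nonneg hH1 fun v => ?_
  have him := hH1.im_star_dotProduct_mulVec_self v
  refine Complex.nonneg_iff.2 ⟨?_, by simpa using him.symm⟩
  rw [Matrix.add_mulVec, Matrix.one_mulVec, dotProduct_add, Complex.add_re]
  set u : EuclideanSpace ℂ (Fin k) := WithLp.toLp 2 v
  set u' : EuclideanSpace ℂ (Fin k) := WithLp.toLp 2 (H *ᵥ v)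
  have e1 : (star v ⬝ᵥ v).re = ‖u‖ ^ 2 := by
    rw [EuclideanSpace.norm_sq_eq, dotProduct, Complex.re_sum]
    refine Finset.sum_congr rfl fun i _ => ?_
    rw [← Complex.normSq_eq_norm_sq, Complex.normSq_apply]
    simp [u]
  have e2 : star v ⬝ᵥ H *ᵥ v = inner ℂ u u' := by
    rw [PiLp.inner_apply, dotProduct]
    refine Finset.sum_congr rfl fun i _ => ?_
    simp [u, u', mul_comm]
  have e3 : ‖u'‖ ≤ ‖H‖ * ‖u‖ := by
    have h := Matrix.frobenius_norm_mul H (Matrix.replicateCol Unit v)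
    have h2 : ‖Matrix.replicateCol Unit v‖ = ‖u‖ := Matrix.frobenius_norm_replicateCol v
    have h3 : ‖Matrix.replicateCol Unit (H *ᵥ v)‖ = ‖u'‖ := Matrix.frobenius_norm_replicateCol _
    rwa [← Matrix.replicateCol_mulVec, h2, h3] at h
  have e4 : |(star v ⬝ᵥ H *ᵥ v).re| ≤ ‖u‖ * ‖u'‖ := by
    rw [e2]
    exact (Complex.abs_re_le_norm _).trans (norm_inner_le_norm u u')
  rw [e1]
  have e5 : ‖u‖ * ‖u'‖ ≤ ‖u‖ ^ 2 := by
    have : ‖u'‖ ≤ ‖u‖ := e3.trans (mul_le_of_le_one_left (norm_nonneg _) h1)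
    nlinarith [norm_nonneg u]
  linarith [(abs_le.1 e4).1]

/-- Moving a short distance in a horizontal direction keeps the pair aligned. -/
theorem eventually_posSemidef {n k : ℕ} {z w : Matrix (Fin n) (Fin k) ℂ} (hz : z.rank = k)
    (hw : (zᴴ * w).IsHermitian) : ∀ᶠ t : ℝ in 𝓝[>] 0, ((z + t • w)ᴴ * z).PosSemidef := by
  obtain ⟨Z, hZ⟩ := exists_left_inverse hz
  have hwz : wᴴ * z = zᴴ * w := by
    have := hw.eq
    rwa [Matrix.conjTranspose_mul, Matrix.conjTranspose_conjTranspose] at this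
  set H := (2⁻¹ : ℝ) • (w * Z + (w * Z)ᴴ) with hH
  have hHH : H.IsHermitian := by
    rw [hH, Matrix.IsHermitian, Matrix.conjTranspose_smul, star_trivial, Matrix.conjTranspose_add,
      Matrix.conjTranspose_conjTranspose, add_comm]
  have hzHz : zᴴ * H * z = wᴴ * z := by
    have e1 : zᴴ * (w * Z) * z = wᴴ * z := by
      rw [Matrix.mul_assoc, Matrix.mul_assoc, hZ, Matrix.mul_one, hwz]
    have e2 : zᴴ * (w * Z)ᴴ * z = wᴴ * z := by
      have := congrArg Matrix.conjTranspose e1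
      rw [Matrix.conjTranspose_mul (zᴴ * (w * Z)) z, Matrix.conjTranspose_mul zᴴ,
        Matrix.conjTranspose_mul wᴴ, Matrix.conjTranspose_conjTranspose,
        Matrix.conjTranspose_conjTranspose, ← hwz, ← Matrix.mul_assoc] at this
      exact this
    rw [hH, Matrix.mul_smul, Matrix.smul_mul, Matrix.mul_add, Matrix.add_mul, e1, e2]
    module
  clear_value H
  have e : ∀ᶠ t : ℝ in 𝓝[>] 0, ‖t • H‖ < 1 := by
    refine Filter.Eventually.filter_mono nhdsWithin_le_nhds ?_
    have : Continuous fun t : ℝ => ‖t • H‖ := by fun_prop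
    exact this.continuousAt.eventually_lt continuousAt_const (by simp)
  filter_upwards [e] with t ht
  have h1 : (z + t • w)ᴴ * z = zᴴ * (1 + t • H) * z := by
    rw [Matrix.conjTranspose_add, Matrix.conjTranspose_smul, star_trivial, Matrix.add_mul,
      Matrix.smul_mul, ← hzHz, Matrix.mul_add, Matrix.add_mul, Matrix.mul_one, Matrix.mul_smul,
      Matrix.smul_mul]
  rw [h1]
  refine Matrix.PosSemidef.conjTranspose_mul_mul_same (posSemidef_one_add ?_ ht.le) z
  rw [Matrix.IsHermitian, Matrix.conjTranspose_smul, star_trivial, hHH.eq]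

/-- Along the horizontal curve `ẑ + t w`, padded by zero columns, the difference quotients for the
metric `d` are explicit. -/
theorem eventually_horizontal_curve {n r k m : ℕ} (A : Fin m → Matrix (Fin n) (Fin n) ℂ)
    {z : Matrix (Fin n) (Fin r) ℂ} (hzk : z.rank = k)
    {zhat w : Matrix (Fin n) (Fin k) ℂ} (h : IsReduction z zhat)
    (hw : (zhatᴴ * w).IsHermitian) (hw1 : ‖w‖ = 1) {R : ℝ} (hR : 0 < R) :
    ∀ᶠ t : ℝ in 𝓝[>] 0, ∃ x : Matrix (Fin n) (Fin r) ℂ, dMetric x z < R ∧ x.rank ≤ z.rank ∧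
      ¬ UEquiv x z ∧ betaDistSq A x z / dMetric x z ^ 2 =
        qform A (dproj zhat w + t • proj w) / ‖(2 : ℝ) • zhat + t • w‖ ^ 2 := by
  obtain ⟨hkr, hzr, hpz⟩ := (isReduction_iff z zhat).1 h
  have hw0 : dproj zhat w ≠ 0 :=
    dproj_ne_zero hzr hw (norm_ne_zero_iff.1 (by rw [hw1]; exact one_ne_zero))
  have e1 : ∀ᶠ t : ℝ in 𝓝[>] 0, ‖t • w‖ * ‖(2 : ℝ) • zhat + t • w‖ < R := by
    refine Filter.Eventually.filter_mono nhdsWithin_le_nhds ?_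
    have : Continuous fun t : ℝ => ‖t • w‖ * ‖(2 : ℝ) • zhat + t • w‖ := by fun_prop
    exact this.continuousAt.eventually_lt continuousAt_const (by simpa using hR)
  filter_upwards [e1, eventually_posSemidef hzr hw, eventually_curve A hw0 hR,
    self_mem_nhdsWithin] with t h1 h2 h3 ht
  have ht0 : (t : ℝ) ≠ 0 := (Set.mem_Ioi.1 ht).ne'
  have hx : proj (padZero r (zhat + t • w)) = proj (zhat + t • w) := proj_padZero hkr _
  have hd : dMetric (padZero r (zhat + t • w)) z = ‖t • w‖ * ‖(2 : ℝ) • zhat + t • w‖ := by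
    rw [dMetric_eq_of_aligned hkr hx.symm hpz.symm h2]
    congr 2 <;> module
  refine ⟨padZero r (zhat + t • w), by rwa [hd], ?_, ?_, ?_⟩
  · rw [← rank_proj, hx, rank_proj, hzk]
    simpa using (zhat + t • w).rank_le_width
  · rw [uEquiv_iff_proj_eq, hx, hpz, ← uEquiv_iff_proj_eq]
    exact h3.2.1
  · have h0 : proj (padZero r (zhat + t • w)) - proj z = t • (dproj zhat w + t • proj w) := by
      rw [hx, hpz, proj_add_smul]
      module
    rw [betaDistSq_eq, h0, hd, qform_smul, norm_smul, hw1, mul_one, mul_pow, Real.norm_eq_abs,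
      sq_abs, mul_div_mul_left _ _ (pow_ne_zero 2 ht0)]

theorem localInfHat1_set_nonempty {n r m : ℕ} (A : Fin m → Matrix (Fin n) (Fin n) ℂ)
    {z : Matrix (Fin n) (Fin r) ℂ} (hz : z ≠ 0) {R : ℝ} (hR : 0 < R) :
    {s | ∃ x : Matrix (Fin n) (Fin r) ℂ, dMetric x z < R ∧ x.rank ≤ z.rank ∧
      ¬ UEquiv x z ∧ s = betaDistSq A x z / dMetric x z ^ 2}.Nonempty := by
  have hk := rank_pos_of_ne_zero hz
  obtain ⟨zhat, h⟩ := exists_isReduction z rfl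
  obtain ⟨⟨w, hw, hw1, -⟩, -⟩ := isLeast_aHatGeom A rfl hk h
  rw [mem_horizontalSpace_iff h.2.1] at hw
  obtain ⟨t, x, h1, h2, h3, -⟩ := (eventually_horizontal_curve A rfl h hw hw1 hR).exists
  exact ⟨_, x, h1, h2, h3, rfl⟩

theorem localInfHat1_le {n r m : ℕ} (A : Fin m → Matrix (Fin n) (Fin n) ℂ)
    {z : Matrix (Fin n) (Fin r) ℂ} (hz : z ≠ 0) {R : ℝ} (hR : 0 < R) :
    localInfHat1 A z R ≤ aHatGeom A z / (4 * ‖z‖ ^ 2) := by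
  have hk := rank_pos_of_ne_zero hz
  obtain ⟨zhat, h⟩ := exists_isReduction z rfl
  obtain ⟨⟨w, hw, hw1, he⟩, -⟩ := isLeast_aHatGeom A rfl hk h
  rw [mem_horizontalSpace_iff h.2.1] at hw
  have hn : ‖zhat‖ = ‖z‖ := norm_eq_of_proj_eq ((isReduction_iff z zhat).1 h).2.2.symm
  have hlim : Tendsto (fun t : ℝ => qform A (dproj zhat w + t • proj w) /
      ‖(2 : ℝ) • zhat + t • w‖ ^ 2) (𝓝[>] 0) (𝓝 (aHatGeom A z / (4 * ‖z‖ ^ 2))) := by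
    have hc1 : Continuous fun t : ℝ => dproj zhat w + t • proj w := by fun_prop
    have hc2 : Continuous fun t : ℝ => (2 : ℝ) • zhat + t • w := by fun_prop
    have h0 : ‖(2 : ℝ) • zhat + (0 : ℝ) • w‖ ^ 2 = 4 * ‖z‖ ^ 2 := by
      rw [zero_smul, add_zero, norm_smul, hn, mul_pow]
      norm_num
    have h1 : ContinuousAt (fun t : ℝ => qform A (dproj zhat w + t • proj w) /
        ‖(2 : ℝ) • zhat + t • w‖ ^ 2) 0 :=
      ((continuous_qform A).comp hc1).continuousAt.div (hc2.norm.pow 2).continuousAt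
        (by rw [h0]; positivity)
    have h2 := h1.tendsto.mono_left (nhdsWithin_le_nhds (s := Set.Ioi 0))
    rw [h0, zero_smul, add_zero] at h2
    rw [he]
    exact h2
  refine ge_of_tendsto hlim ?_
  filter_upwards [eventually_horizontal_curve A rfl h hw hw1 hR] with t ht
  obtain ⟨x, h1, h2, h3, h4⟩ := ht
  rw [← h4]
  exact csInf_le ⟨0, by rintro _ ⟨x, -, -, -, rfl⟩; exact quotient_nonneg A x z _⟩
    ⟨x, h1, h2, h3, rfl⟩

theorem localInfHat2_le_localInfHat1 {n r m : ℕ} (A : Fin m → Matrix (Fin n) (Fin n) ℂ)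
    {z : Matrix (Fin n) (Fin r) ℂ} (hz : z ≠ 0) {R : ℝ} (hR : 0 < R) :
    localInfHat2 A z R ≤ localInfHat1 A z R := by
  refine csInf_le_csInf ⟨0, ?_⟩ (localInfHat1_set_nonempty A hz hR) ?_
  · rintro _ ⟨x, y, -, -, -, -, -, rfl⟩; exact quotient_nonneg A x y _
  · rintro _ ⟨x, h1, h2, h3, rfl⟩
    refine ⟨x, z, h1, ?_, h2, le_rfl, h3, rfl⟩
    rw [dMetric_of_posSemidef (Matrix.posSemidef_conjTranspose_mul_self z)]
    simpa using hR

/-- The normalized horizontal quadratic form is lower semicontinuous in the base point, uniformly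
over unit directions: a tube-lemma argument on the compact unit sphere. -/
theorem eventually_le_horizontal {n k m : ℕ} (A : Fin m → Matrix (Fin n) (Fin n) ℂ)
    {z : Matrix (Fin n) (Fin k) ℂ} (hz : z ≠ 0) {L : ℝ}
    (hL : ∀ w : Matrix (Fin n) (Fin k) ℂ, ‖w‖ = 1 → (zᴴ * w).IsHermitian →
      L ≤ qform A (dproj z w) / (4 * ‖z‖ ^ 2)) {ε : ℝ} (hε : 0 < ε) :
    ∀ᶠ s in 𝓝 z, ∀ w ∈ Metric.sphere (0 : Matrix (Fin n) (Fin k) ℂ) 1, (sᴴ * w).IsHermitian →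
      L - ε ≤ qform A (dproj s w) / (4 * ‖s‖ ^ 2) := by
  refine (isCompact_sphere _ _).eventually_forall_of_forall_eventually fun w hw => ?_
  -- near a horizontal direction the form is continuous; near any other direction no pair is
  -- horizontal
  by_cases h : (zᴴ * w).IsHermitian
  · have hc : ContinuousAt (fun p : Matrix (Fin n) (Fin k) ℂ × Matrix (Fin n) (Fin k) ℂ =>
        qform A (dproj p.1 p.2) / (4 * ‖p.1‖ ^ 2)) (z, w) := by
      refine ContinuousAt.div ((continuous_qform A).comp continuous_dproj).continuousAt
        (by fun_prop) ?_
      have : ‖z‖ ≠ 0 := norm_ne_zero_iff.2 hz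
      positivity
    have h1 : L - ε < qform A (dproj z w) / (4 * ‖z‖ ^ 2) :=
      (sub_lt_self L hε).trans_le (hL w (by simpa using hw) h)
    filter_upwards [continuousAt_const.eventually_lt hc h1] with p hp _ using hp.le
  · have hc : Continuous fun p : Matrix (Fin n) (Fin k) ℂ × Matrix (Fin n) (Fin k) ℂ =>
        (p.1ᴴ * p.2)ᴴ - p.1ᴴ * p.2 := by fun_prop
    have h1 : (zᴴ * w)ᴴ - zᴴ * w ≠ 0 := fun h' => h (sub_eq_zero.1 h')
    filter_upwards [hc.continuousAt.eventually_ne h1] with p hp hp'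
    exact absurd (sub_eq_zero.2 hp'.eq) hp

/-- Aligning a representative of `x` with `ẑ` gives `‖x̂ + ẑ‖ ≥ ‖ẑ‖`, so the metric `d` bounds the
distance to `ẑ`. -/
theorem exists_aligned_representative {n r k : ℕ} (hkn : k ≤ n) (hkr : k ≤ r)
    {x z : Matrix (Fin n) (Fin r) ℂ} {zhat : Matrix (Fin n) (Fin k) ℂ} (hz : proj zhat = proj z)
    (hx : x.rank ≤ k) : ∃ xhat : Matrix (Fin n) (Fin k) ℂ, proj xhat = proj x ∧
      ‖xhat - zhat‖ * ‖zhat‖ ≤ dMetric x z := by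
  obtain ⟨x0, hx0⟩ := exists_proj_eq hkn x hx
  obtain ⟨U, hU, h⟩ := exists_aligned zhat x0
  have hxU : proj (x0 * U) = proj x := by
    rw [proj_mul_coisometry x0 (mul_conjTranspose_self_of_mem hU), hx0]
  have h' : ((x0 * U)ᴴ * zhat).PosSemidef := by
    have := h.conjTranspose
    rwa [Matrix.conjTranspose_mul, Matrix.conjTranspose_conjTranspose] at this
  refine ⟨x0 * U, hxU, ?_⟩
  rw [dMetric_eq_of_aligned hkr hxU hz h']
  refine mul_le_mul_of_nonneg_left ?_ (norm_nonneg _)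
  refine abs_le_of_sq_le_sq' ?_ (norm_nonneg _) |>.2
  rw [norm_add_sq_eq]
  nlinarith [rinner_nonneg_of_posSemidef h', sq_nonneg ‖x0 * U‖]

/-- Two matrices of rank at most `k` near `z` have mutually aligned representatives near `ẑ`. -/
theorem exists_aligned_pair {n r k : ℕ} (hkn : k ≤ n) (hkr : k ≤ r)
    {x y z : Matrix (Fin n) (Fin r) ℂ} {zhat : Matrix (Fin n) (Fin k) ℂ} (hz : proj zhat = proj z)
    (hx : x.rank ≤ k) (hy : y.rank ≤ k) : ∃ xhat yhat : Matrix (Fin n) (Fin k) ℂ,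
      proj xhat = proj x ∧ proj yhat = proj y ∧ (xhatᴴ * yhat).PosSemidef ∧
      ‖(2⁻¹ : ℝ) • (xhat + yhat) - zhat‖ * ‖zhat‖ ≤ 2 * max (dMetric x z) (dMetric y z) := by
  obtain ⟨xhat, hxp, hxd⟩ := exists_aligned_representative hkn hkr hz hx
  obtain ⟨y1, hyp, hyd⟩ := exists_aligned_representative hkn hkr hz hy
  obtain ⟨U, hU, h⟩ := exists_aligned xhat y1
  refine ⟨xhat, y1 * U, hxp, ?_, h, ?_⟩
  · rw [proj_mul_coisometry y1 (mul_conjTranspose_self_of_mem hU), hyp]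
  -- aligning `y1` with `xhat` only decreases their distance, so `y1 U` stays near `ẑ`
  · have hclose : ‖xhat - y1 * U‖ ≤ ‖xhat - y1‖ := by
      have h1 : y1 = y1 * U * Uᴴ := by
        rw [Matrix.mul_assoc, mul_conjTranspose_self_of_mem hU, Matrix.mul_one]
      have h2 := abs_rinner_mul_unitary_le h (Unitary.star_mem hU : star U ∈ _)
      rw [Matrix.star_eq_conjTranspose, ← h1] at h2
      refine abs_le_of_sq_le_sq' ?_ (norm_nonneg _) |>.2
      rw [norm_sub_sq_eq, norm_sub_sq_eq,
        norm_mul_coisometry y1 (mul_conjTranspose_self_of_mem hU)]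
      linarith [(abs_le.1 h2).2]
    have h3 : ‖(2⁻¹ : ℝ) • (xhat + y1 * U) - zhat‖ ≤
        ‖xhat - zhat‖ + 2⁻¹ * (‖xhat - zhat‖ + ‖y1 - zhat‖) := by
      have e : (2⁻¹ : ℝ) • (xhat + y1 * U) - zhat =
          (xhat - zhat) - (2⁻¹ : ℝ) • (xhat - y1 * U) := by module
      rw [e]
      refine (norm_sub_le _ _).trans ?_
      rw [norm_smul, Real.norm_eq_abs, abs_of_pos (by norm_num : (0 : ℝ) < 2⁻¹)]
      have h4 : ‖xhat - y1‖ ≤ ‖xhat - zhat‖ + ‖y1 - zhat‖ := by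
        have e2 : xhat - y1 = (xhat - zhat) - (y1 - zhat) := by abel
        rw [e2]
        exact norm_sub_le _ _
      linarith
    have h5 := mul_le_mul_of_nonneg_right h3 (norm_nonneg zhat)
    have h6 := le_max_left (dMetric x z) (dMetric y z)
    have h7 := le_max_right (dMetric x z) (dMetric y z)
    linarith

/-- The quotients for `d` near `z` are normalized horizontal values at midpoints near `ẑ`. -/
theorem eventually_le_localInfHat2 {n r m : ℕ} (A : Fin m → Matrix (Fin n) (Fin n) ℂ)
    {z : Matrix (Fin n) (Fin r) ℂ} (hz : z ≠ 0) {ε : ℝ} (hε : 0 < ε) :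
    ∀ᶠ R in 𝓝[>] (0 : ℝ), aHatGeom A z / (4 * ‖z‖ ^ 2) - ε ≤ localInfHat2 A z R := by
  have hk := rank_pos_of_ne_zero hz
  have hkn : z.rank ≤ n := by simpa using z.rank_le_height
  obtain ⟨zhat, h⟩ := exists_isReduction z rfl
  obtain ⟨hkr, hzr, hpz⟩ := (isReduction_iff z zhat).1 h
  have hn : ‖zhat‖ = ‖z‖ := norm_eq_of_proj_eq hpz.symm
  have hzpos : 0 < ‖z‖ := norm_pos_iff.2 hz
  have hz0 : zhat ≠ 0 := norm_ne_zero_iff.1 (by rw [hn]; exact hzpos.ne')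
  have hev := eventually_le_horizontal A hz0 (L := aHatGeom A z / (4 * ‖z‖ ^ 2))
    (fun w hw1 hw => by
      have := aHatGeom_mul_norm_sq_le A rfl hk h hw
      rw [hw1, one_pow, mul_one] at this
      rw [hn]
      exact div_le_div_of_nonneg_right this (by positivity)) hε
  obtain ⟨δ, hδ, hball⟩ := Metric.eventually_nhds_iff.1 hev
  have hRpos : 0 < δ * ‖z‖ / 2 := by positivity
  filter_upwards [Ioo_mem_nhdsGT hRpos] with R hR
  refine le_csInf ?_ ?_
  · obtain ⟨_, x, h1, h2, h3, -⟩ := localInfHat1_set_nonempty A hz hR.1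
    refine ⟨_, x, z, h1, ?_, h2, le_rfl, h3, rfl⟩
    rw [dMetric_of_posSemidef (Matrix.posSemidef_conjTranspose_mul_self z)]
    simpa using hR.1
  · rintro _ ⟨x, y, hx, hy, hxr, hyr, hxy, rfl⟩
    obtain ⟨xhat, yhat, hxp, hyp, hP, hs⟩ := exists_aligned_pair hkn hkr hpz.symm hxr hyr
    set s := (2⁻¹ : ℝ) • (xhat + yhat) with hsdef
    set w := xhat - yhat with hwdef
    have hw0 : w ≠ 0 := by
      intro h0
      refine hxy ((uEquiv_iff_proj_eq x y).2 ?_)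
      rw [← hxp, ← hyp, sub_eq_zero.1 h0]
    have hwpos : 0 < ‖w‖ := norm_pos_iff.2 hw0
    have hdist : dist s zhat < δ := by
      rw [dist_eq_norm]
      have h1 : max (dMetric x z) (dMetric y z) < δ * ‖z‖ / 2 :=
        (max_lt hx hy).trans hR.2
      rw [hn] at hs
      have h2 : ‖s - zhat‖ * ‖z‖ < δ * ‖z‖ := by linarith
      exact lt_of_mul_lt_mul_right h2 hzpos.le
    have hherm := isHermitian_midpoint_sub hP.isHermitian
    have hb := hball hdist (‖w‖⁻¹ • w) (mem_sphere_zero_iff_norm.2 (norm_inv_norm_smul hw0)) (by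
      rw [Matrix.IsHermitian, Matrix.mul_smul, Matrix.conjTranspose_smul, star_trivial, hherm.eq])
    refine hb.trans (le_of_eq ?_)
    have hd : dMetric x y = ‖w‖ * (2 * ‖s‖) := by
      rw [dMetric_eq_of_aligned hkr hxp hyp hP]
      have : xhat + yhat = (2 : ℝ) • s := by rw [hsdef]; module
      rw [← hwdef, this, norm_smul, Real.norm_ofNat]
    rw [betaDistSq_eq, ← hxp, ← hyp, proj_sub_proj, ← hsdef, ← hwdef, hd, dproj_smul_right,
      qform_smul]
    rw [inv_pow, mul_pow, mul_pow, inv_mul_eq_div, div_div]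
    norm_num

theorem tendsto_localInfHat {n r m : ℕ} (A : Fin m → Matrix (Fin n) (Fin n) ℂ)
    {z : Matrix (Fin n) (Fin r) ℂ} (hz : z ≠ 0) :
    Tendsto (localInfHat1 A z) (𝓝[>] 0) (𝓝 (aHatGeom A z / (4 * ‖z‖ ^ 2))) ∧
      Tendsto (localInfHat2 A z) (𝓝[>] 0) (𝓝 (aHatGeom A z / (4 * ‖z‖ ^ 2))) := by
  have key {f : ℝ → ℝ} (h1 : ∀ R, 0 < R → localInfHat2 A z R ≤ f R)
      (h2 : ∀ R, 0 < R → f R ≤ localInfHat1 A z R) :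
      Tendsto f (𝓝[>] 0) (𝓝 (aHatGeom A z / (4 * ‖z‖ ^ 2))) := by
    rw [Metric.tendsto_nhds]
    intro ε hε
    filter_upwards [eventually_le_localInfHat2 A hz (half_pos hε), self_mem_nhdsWithin]
      with R hR hR0
    have h3 := h1 R hR0
    have h4 := (h2 R hR0).trans (localInfHat1_le A hz hR0)
    rw [Real.dist_eq, abs_lt]
    constructor <;> linarith
  exact ⟨key (fun R hR => localInfHat2_le_localInfHat1 A hz hR) fun R _ => le_rfl,
    key (fun R _ => le_rfl) fun R hR => localInfHat2_le_localInfHat1 A hz hR⟩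

theorem aHatOne_eq {n r m : ℕ} (A : Fin m → Matrix (Fin n) (Fin n) ℂ)
    {z : Matrix (Fin n) (Fin r) ℂ} (hz : z ≠ 0) :
    aHatOne A z = aHatGeom A z / (4 * ‖z‖ ^ 2) :=
  (tendsto_localInfHat A hz).1.limUnder_eq

theorem aHatTwo_eq {n r m : ℕ} (A : Fin m → Matrix (Fin n) (Fin n) ℂ)
    {z : Matrix (Fin n) (Fin r) ℂ} (hz : z ≠ 0) :
    aHatTwo A z = aHatGeom A z / (4 * ‖z‖ ^ 2) :=
  (tendsto_localInfHat A hz).2.limUnder_eq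

end

/-! ### Singular values -/

/-- On the orthogonal complement of its kernel a matrix expands lengths at least by its smallest
nonzero singular value. -/
theorem sigma_sq_mul_norm_sq_le {n r k : ℕ} {z : Matrix (Fin n) (Fin r) ℂ} (hz : z.rank = k)
    (hk : 0 < k) (u : EuclideanSpace ℂ (Fin n)) :
    sigma k z ^ 2 * ‖Matrix.toEuclideanLin zᴴ u‖ ^ 2 ≤
      ‖Matrix.toEuclideanLin z (Matrix.toEuclideanLin zᴴ u)‖ ^ 2 := by
  set T := Matrix.toEuclideanLin z with hT
  have hrk : Module.finrank ℂ (LinearMap.range T) = k := by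
    have h1 := Matrix.rank_eq_finrank_range_toLin z (EuclideanSpace.basisFun (Fin n) ℂ).toBasis
      (EuclideanSpace.basisFun (Fin r) ℂ).toBasis
    rw [← Matrix.toEuclideanLin_eq_toLin_orthonormal] at h1
    rw [← hz, h1]
  have hn : Module.finrank ℂ (EuclideanSpace ℂ (Fin r)) = r := finrank_euclideanSpace_fin
  rw [Matrix.toEuclideanLin_conjTranspose_eq_adjoint, ← hT]
  set v := LinearMap.adjoint T u
  have hS := T.isSymmetric_adjoint_comp_self
  set b := hS.eigenvectorBasis hn
  have hb (i : Fin r) : LinearMap.adjoint T (T (b i)) = (T.singularValues i ^ 2 : ℝ) • b i := by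
    rw [T.sq_singularValues_fin hn i]
    exact hS.apply_eigenvectorBasis hn i
  have h1 : ‖T v‖ ^ 2 = ∑ i : Fin r, T.singularValues i ^ 2 * ‖inner ℂ (b i) v‖ ^ 2 := by
    have e1 : (‖T v‖ ^ 2 : ℂ) = inner ℂ v (LinearMap.adjoint T (T v)) := by
      rw [LinearMap.adjoint_inner_right, inner_self_eq_norm_sq_to_K]
      rfl
    have e2 : inner ℂ v (LinearMap.adjoint T (T v)) =
        ∑ i : Fin r, ((T.singularValues i ^ 2 * ‖inner ℂ (b i) v‖ ^ 2 : ℝ) : ℂ) := by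
      rw [← b.sum_inner_mul_inner]
      refine Finset.sum_congr rfl fun i _ => ?_
      have e3 : inner ℂ (b i) (LinearMap.adjoint T (T v)) =
          (T.singularValues i ^ 2 : ℝ) * inner ℂ (b i) v := by
        rw [LinearMap.adjoint_inner_right, ← LinearMap.adjoint_inner_left, hb,
          inner_smul_left_eq_smul]
        simp
      rw [e3, ← inner_conj_symm v (b i)]
      have e4 := Complex.conj_mul' (inner ℂ (b i) v)
      push_cast
      linear_combination ((T.singularValues i : ℂ) ^ 2) * e4
    rw [e2, ← Complex.ofReal_sum] at e1
    exact_mod_cast e1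
  have h2 : ‖v‖ ^ 2 = ∑ i : Fin r, ‖inner ℂ (b i) v‖ ^ 2 := (b.sum_sq_norm_inner_right v).symm
  rw [h1, h2, Finset.mul_sum]
  refine Finset.sum_le_sum fun i _ => ?_
  by_cases hi : (i : ℕ) < k
  · refine mul_le_mul_of_nonneg_right ?_ (sq_nonneg _)
    exact pow_le_pow_left₀ (T.singularValues_nonneg _) (T.singularValues_antitone (by omega)) 2
  · -- beyond the rank the eigenvectors lie in the kernel, which is orthogonal to `v`
    have h3 : T.singularValues i = 0 :=
      T.singularValues_eq_zero_iff_le_finrank_range.2 (by rw [hrk]; omega)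
    have h4 : T (b i) = 0 := by
      have h5 := hb i
      rw [h3] at h5
      rw [← inner_self_eq_zero (𝕜 := ℂ), ← LinearMap.adjoint_inner_right, h5]
      simp
    have h5 : inner ℂ (b i) v = 0 := by
      rw [LinearMap.adjoint_inner_right, h4, inner_zero_left]
    rw [h5]
    simp

theorem sigma_pos {n r k : ℕ} {z : Matrix (Fin n) (Fin r) ℂ} (hz : z.rank = k) (hk : 0 < k) :
    0 < sigma k z := by
  refine (LinearMap.singularValues_pos_iff_lt_finrank_range _).2 ?_
  have h1 := Matrix.rank_eq_finrank_range_toLin z (EuclideanSpace.basisFun (Fin n) ℂ).toBasis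
    (EuclideanSpace.basisFun (Fin r) ℂ).toBasis
  rw [← Matrix.toEuclideanLin_eq_toLin_orthonormal] at h1
  rw [← h1]
  omega

theorem norm_sq_eq_sum_cols {p q : ℕ} (M : Matrix (Fin p) (Fin q) ℂ) :
    ‖M‖ ^ 2 = ∑ j, ‖(WithLp.toLp 2 (M.col j) : EuclideanSpace ℂ (Fin p))‖ ^ 2 := by
  rw [← rinner_self, rinner_eq_sum]
  refine Finset.sum_congr rfl fun j _ => ?_
  rw [EuclideanSpace.norm_sq_eq]
  refine Finset.sum_congr rfl fun i _ => ?_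
  rw [← Complex.normSq_eq_norm_sq, Complex.normSq_apply]
  simp

theorem sigma_sq_mul_norm_mul_sq_le {n r k p : ℕ} {z : Matrix (Fin n) (Fin r) ℂ}
    (hz : z.rank = k) (hk : 0 < k) (C : Matrix (Fin n) (Fin p) ℂ) :
    sigma k z ^ 2 * ‖zᴴ * C‖ ^ 2 ≤ ‖z * (zᴴ * C)‖ ^ 2 := by
  rw [norm_sq_eq_sum_cols, norm_sq_eq_sum_cols, Finset.mul_sum]
  refine Finset.sum_le_sum fun j _ => ?_
  exact sigma_sq_mul_norm_sq_le hz hk (WithLp.toLp 2 (C.col j))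

theorem sigma_sq_mul_norm_sq_le_reduction {n r k : ℕ} {z : Matrix (Fin n) (Fin r) ℂ}
    (hz : z.rank = k) (hk : 0 < k) {zhat : Matrix (Fin n) (Fin k) ℂ} (h : IsReduction z zhat)
    (w : Matrix (Fin n) (Fin k) ℂ) : sigma k z ^ 2 * ‖w‖ ^ 2 ≤ ‖zhat * wᴴ‖ ^ 2 := by
  obtain ⟨V, hV, hzV⟩ := h.exists_coisometry
  obtain ⟨Z, hZ⟩ := exists_left_inverse h.2.1
  have h1 : Z * z = V := by rw [hzV, ← Matrix.mul_assoc, hZ, Matrix.one_mul]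
  have h2 : zᴴ * (Zᴴ * wᴴ) = Vᴴ * wᴴ := by
    rw [← Matrix.mul_assoc, ← Matrix.conjTranspose_mul, h1]
  have h3 : z * (Vᴴ * wᴴ) = zhat * wᴴ := by
    rw [hzV, Matrix.mul_assoc, ← Matrix.mul_assoc V, hV, Matrix.one_mul]
  have h4 : ‖Vᴴ * wᴴ‖ = ‖w‖ := by
    rw [norm_isometry_mul _ (by rw [Matrix.conjTranspose_conjTranspose, hV]),
      Matrix.frobenius_norm_conjTranspose]
  have h5 := sigma_sq_mul_norm_mul_sq_le hz hk (Zᴴ * wᴴ)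
  rwa [h2, h3, h4] at h5

/-! ### Comparison of `a(z)` and `â(z)` -/

/-- A minimizing horizontal direction `w` gives the tangent vector `Dπ(ẑ)(w)`, whose squared norm is
at least `2‖ẑ w*‖²`. -/
theorem aGeom_mul_le_aHatGeom {n r k m : ℕ} (A : Fin m → Matrix (Fin n) (Fin n) ℂ)
    {z : Matrix (Fin n) (Fin r) ℂ} (hz : z.rank = k) (hk : 0 < k)
    {zhat : Matrix (Fin n) (Fin k) ℂ} (h : IsReduction z zhat) {c : ℝ}
    (hc : ∀ w : Matrix (Fin n) (Fin k) ℂ, c * ‖w‖ ^ 2 ≤ ‖zhat * wᴴ‖ ^ 2) :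
    aGeom A z * (2 * c) ≤ aHatGeom A z := by
  have hz0 : z ≠ 0 := ne_zero_of_rank_pos (hz.symm ▸ hk)
  obtain ⟨⟨w, hw, hw1, he⟩, -⟩ := isLeast_aHatGeom A hz hk h
  rw [mem_horizontalSpace_iff h.2.1] at hw
  have h1 := norm_dproj_sq hw
  have h2 := hc w
  rw [hw1] at h2
  have hT : dproj zhat w ∈ tangentSpace z := by
    rw [tangentSpace_congr h.rangeProj_eq]
    exact (mem_tangentSpace_iff _ _).2 ⟨w, rfl⟩
  have h3 := aGeom_mul_norm_sq_le A hz0 hT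
  rw [he]
  refine le_trans (mul_le_mul_of_nonneg_left ?_ (aGeom_nonneg A hz0)) h3
  nlinarith [sq_nonneg ‖zhatᴴ * w‖]

/-- A minimizing unit tangent vector is `Dπ(ẑ)(w)` for a horizontal `w` with `C ‖w‖² ≥ 1`. -/
theorem aHatGeom_le_mul_aGeom {n r k m : ℕ} (A : Fin m → Matrix (Fin n) (Fin n) ℂ)
    {z : Matrix (Fin n) (Fin r) ℂ} (hz : z.rank = k) (hk : 0 < k)
    {zhat : Matrix (Fin n) (Fin k) ℂ} (h : IsReduction z zhat) {C : ℝ} (hC0 : 0 ≤ C)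
    (hC : ∀ w : Matrix (Fin n) (Fin k) ℂ, (zhatᴴ * w).IsHermitian →
      ‖dproj zhat w‖ ^ 2 ≤ C * ‖w‖ ^ 2) : aHatGeom A z ≤ C * aGeom A z := by
  have hz0 : z ≠ 0 := ne_zero_of_rank_pos (hz.symm ▸ hk)
  obtain ⟨⟨W, hW, hW1, he⟩, -⟩ := isLeast_aGeom A hz0
  rw [tangentSpace_congr h.rangeProj_eq] at hW
  obtain ⟨w', rfl⟩ := (mem_tangentSpace_iff _ _).1 hW
  obtain ⟨w, hw, hww⟩ := exists_horizontal_dproj_eq zhat w'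
  have h1 := hC w hw
  have h2 := aHatGeom_mul_norm_sq_le A hz hk h hw
  rw [hww, hW1] at h1
  rw [hww] at h2
  change aGeom A z = qform A _ at he
  rw [← he] at h2
  nlinarith [aHatGeom_nonneg A hz0]

theorem aHatGeom_le_four_norm_sq_mul {n r k m : ℕ} (A : Fin m → Matrix (Fin n) (Fin n) ℂ)
    {z : Matrix (Fin n) (Fin r) ℂ} (hz : z.rank = k) (hk : 0 < k) :
    aHatGeom A z ≤ 4 * ‖z‖ ^ 2 * aGeom A z := by
  obtain ⟨zhat, h⟩ := exists_isReduction z hz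
  refine aHatGeom_le_mul_aGeom A hz hk h (by positivity) fun w _ => ?_
  have h1 : ‖zhat‖ = ‖z‖ := norm_eq_of_proj_eq ((isReduction_iff z zhat).1 h).2.2.symm
  have h2 := pow_le_pow_left₀ (norm_nonneg _) (norm_dproj_le zhat w) 2
  rw [h1] at h2
  refine h2.trans_eq ?_
  ring

theorem isReduction_self {n r : ℕ} {z : Matrix (Fin n) (Fin r) ℂ} (hz : z.rank = r) :
    IsReduction z z := (isReduction_iff z z).2 ⟨le_rfl, hz, rfl⟩

theorem comparison_of_isometry {n r m : ℕ} (hr : 0 < r) (A : Fin m → Matrix (Fin n) (Fin n) ℂ)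
    {z : Matrix (Fin n) (Fin r) ℂ} (hz : zᴴ * z = 1) :
    aHatGeom A z ≤ 4 * aGeom A z ∧ aGeom A z * 2 ≤ aHatGeom A z := by
  have hrk := rank_of_isometry hz
  have h1 (w : Matrix (Fin n) (Fin r) ℂ) : ‖z * wᴴ‖ = ‖w‖ := by
    rw [norm_isometry_mul _ hz, Matrix.frobenius_norm_conjTranspose]
  constructor
  · refine aHatGeom_le_mul_aGeom A hrk hr (isReduction_self hrk) (by norm_num) fun w hw => ?_
    rw [norm_dproj_sq hw, h1]
    have h2 : ‖zᴴ * w‖ ≤ ‖w‖ := by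
      have h3 : ‖zᴴ * w‖ ^ 2 ≤ ‖w‖ * ‖zᴴ * w‖ := by
        rw [← rinner_self, rinner_mul_left, Matrix.conjTranspose_conjTranspose]
        refine (le_abs_self _).trans ((abs_rinner_le _ _).trans_eq ?_)
        rw [norm_isometry_mul _ hz]
      by_contra h4
      push Not at h4
      nlinarith [norm_nonneg w]
    nlinarith [norm_nonneg w, norm_nonneg (zᴴ * w)]
  · have := aGeom_mul_le_aHatGeom A hrk hr (isReduction_self hrk) (c := 1)
      fun w => by rw [one_mul, h1]
    simpa using this

/-- For one column `‖z w*‖ = ‖z‖ ‖w‖`. -/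
theorem aGeom_mul_le_aHatGeom_of_one_column {n m : ℕ} (A : Fin m → Matrix (Fin n) (Fin n) ℂ)
    {z : Matrix (Fin n) (Fin 1) ℂ} (hz : z ≠ 0) :
    aGeom A z * (2 * ‖z‖ ^ 2) ≤ aHatGeom A z := by
  have hrk : z.rank = 1 := le_antisymm (by simpa using z.rank_le_width) (rank_pos_of_ne_zero hz)
  refine aGeom_mul_le_aHatGeom A hrk one_pos (isReduction_self hrk) fun w => ?_
  have h1 : zᴴ * z = (‖z‖ ^ 2 : ℝ) • (1 : Matrix (Fin 1) (Fin 1) ℂ) := by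
    ext i j
    have hi : i = 0 := Subsingleton.elim _ _
    have hj : j = 0 := Subsingleton.elim _ _
    subst hi hj
    have h2 : (zᴴ * z) 0 0 = Matrix.trace (zᴴ * z) := by simp [Matrix.trace]
    have h3 := (Matrix.isHermitian_conjTranspose_mul_self z).apply 0 0
    refine Complex.ext ?_ ?_
    · rw [h2, ← rinner_self, rinner]; simp
    · have h4 := congrArg Complex.im h3
      simp only [Complex.star_def, Complex.conj_im] at h4
      have h5 : ((zᴴ * z) 0 0).im = 0 := by linarith
      rw [h5]
      simp [-Complex.ofReal_pow]
  refine le_of_eq ?_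
  rw [← rinner_self (z * wᴴ), rinner_mul_left, ← Matrix.mul_assoc, h1, Matrix.smul_mul,
    Matrix.one_mul, rinner_smul_right, rinner_self, Matrix.frobenius_norm_conjTranspose]

theorem aGlobal_nonneg {n r m : ℕ} (hr : 0 < r) (hn : 0 < n)
    (A : Fin m → Matrix (Fin n) (Fin n) ℂ) : 0 ≤ aGlobal r A :=
  le_aGlobal hr hn A fun _ hz => aGeom_nonneg A hz

/-- As the global bound is attained, it is positive for phase retrievable families. -/
theorem aGlobal_pos {n r m : ℕ} (hr : 0 < r) (hrn : r ≤ n)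
    {A : Fin m → Matrix (Fin n) (Fin n) ℂ} (hA : PhaseRetrievable r A) : 0 < aGlobal r A := by
  refine lt_of_le_of_ne (aGlobal_nonneg hr (hr.trans_le hrn) A) fun h0 => ?_
  obtain ⟨U, hU, hUe⟩ := exists_unitary_aGeom_eq_aGlobal hr hrn A
  have hiso := leftCols_isometry hrn (conjTranspose_mul_self_of_mem hU)
  set z := leftCols hrn U
  have hz : z ≠ 0 := ne_zero_of_rank_pos (by rw [rank_of_isometry hiso]; exact hr)
  obtain ⟨w, hw, he⟩ := exists_unit_dproj A hz
  rw [hUe, ← h0] at he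
  have h1 : proj (z + (2⁻¹ : ℝ) • w) - proj (z - (2⁻¹ : ℝ) • w) = dproj z w := by
    rw [proj_sub_proj]
    congr 1 <;> module
  have h2 : betaDistSq A (z + (2⁻¹ : ℝ) • w) (z - (2⁻¹ : ℝ) • w) = 0 := by
    rw [betaDistSq_eq, h1, he]
  have h3 : beta A (z + (2⁻¹ : ℝ) • w) = beta A (z - (2⁻¹ : ℝ) • w) := by
    funext j
    have := (Finset.sum_eq_zero_iff_of_nonneg fun _ _ => sq_nonneg _).1 h2 j (Finset.mem_univ j)
    exact sub_eq_zero.1 (sq_eq_zero_iff.1 this)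
  have h4 := (uEquiv_iff_proj_eq _ _).1 (hA _ _ h3)
  rw [h4, sub_self] at h1
  rw [← h1, norm_zero] at hw
  exact zero_ne_one hw

/-! ### Degeneration of `â` with more than one column -/

/-- With columns `√(1 - s²) e₁` and `s e₂` the value of `â` is of order `s²`, as seen from the
horizontal direction `[0 | e₂]`. -/
theorem exists_aHatGeom_le {n r m : ℕ} (hr : 1 < r) (hrn : r ≤ n)
    (A : Fin m → Matrix (Fin n) (Fin n) ℂ) {s : ℝ} (hs0 : 0 < s) (hs1 : s < 1) :
    ∃ z : Matrix (Fin n) (Fin r) ℂ, ‖z‖ = 1 ∧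
      aHatGeom A z ≤ (∑ j, ‖A j‖ ^ 2) * (4 * s ^ 2) := by
  set c := √(1 - s ^ 2)
  have hs2 : 0 < 1 - s ^ 2 := by nlinarith
  have hc0 : 0 < c := Real.sqrt_pos.2 hs2
  have hc2 : c ^ 2 = 1 - s ^ 2 := Real.sq_sqrt hs2.le
  have hnorm (a b : ℝ) : ‖(Matrix.diagonal ![(a : ℂ), (b : ℂ)])‖ ^ 2 = a ^ 2 + b ^ 2 := by
    rw [Matrix.frobenius_norm_diagonal, EuclideanSpace.norm_sq_eq]
    simp [Fin.sum_univ_two]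
  have hherm (a b : ℝ) : (Matrix.diagonal ![(a : ℂ), (b : ℂ)])ᴴ =
      Matrix.diagonal ![(a : ℂ), (b : ℂ)] := by
    rw [Matrix.diagonal_conjTranspose]
    congr 1
    funext i
    fin_cases i <;> simp
  have hmul (a b a' b' : ℝ) : Matrix.diagonal ![(a : ℂ), (b : ℂ)] *
      Matrix.diagonal ![(a' : ℂ), (b' : ℂ)] =
        Matrix.diagonal ![((a * a' : ℝ) : ℂ), ((b * b' : ℝ) : ℂ)] := by
    rw [Matrix.diagonal_mul_diagonal]
    congr 1
    funext i
    fin_cases i <;> simp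
  -- `E` embeds `ℂ²` as the first two coordinates, `E D` is the reduced matrix and `E N`
  -- the direction
  set E : Matrix (Fin n) (Fin 2) ℂ := (padMat 2 n)ᴴ
  have hE : Eᴴ * E = 1 := by
    simpa [E] using padMat_mul_conjTranspose (k := 2) (r := n) (by omega)
  set D := Matrix.diagonal ![(c : ℂ), (s : ℂ)] with hD
  set N := Matrix.diagonal ![((0 : ℝ) : ℂ), ((1 : ℝ) : ℂ)] with hN
  have hrank : (E * D).rank = 2 := by
    refine le_antisymm (by simpa using (E * D).rank_le_width) ?_
    have h1 : Matrix.diagonal ![((c⁻¹ : ℝ) : ℂ), ((s⁻¹ : ℝ) : ℂ)] * Eᴴ * (E * D) = 1 := by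
      rw [Matrix.mul_assoc, ← Matrix.mul_assoc Eᴴ, hE, Matrix.one_mul, hD, hmul,
        inv_mul_cancel₀ hc0.ne', inv_mul_cancel₀ hs0.ne']
      ext i j
      fin_cases i <;> fin_cases j <;> simp
    have h2 := Matrix.rank_mul_le_right
      (Matrix.diagonal ![((c⁻¹ : ℝ) : ℂ), ((s⁻¹ : ℝ) : ℂ)] * Eᴴ) (E * D)
    rwa [h1, Matrix.rank_one, Fintype.card_fin] at h2
  have hp : proj (padZero r (E * D)) = proj (E * D) := proj_padZero hr _
  have hred : IsReduction (padZero r (E * D)) (E * D) :=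
    (isReduction_iff _ _).2 ⟨hr, hrank, hp⟩
  have hzr : (padZero r (E * D)).rank = 2 := by rw [← rank_proj, hp, rank_proj, hrank]
  refine ⟨padZero r (E * D), ?_, ?_⟩
  · rw [norm_eq_of_proj_eq hp, norm_isometry_mul _ hE,
      ← sq_eq_sq₀ (norm_nonneg _) zero_le_one, hD, hnorm, hc2]
    ring
  · have h1 : (E * D)ᴴ * (E * N) = Matrix.diagonal ![((0 : ℝ) : ℂ), (s : ℂ)] := by
      rw [Matrix.conjTranspose_mul, Matrix.mul_assoc, ← Matrix.mul_assoc Eᴴ, hE, Matrix.one_mul,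
        hD, hherm, hN, hmul]
      simp
    have hw : ((E * D)ᴴ * (E * N)).IsHermitian := by
      rw [h1]; exact hherm 0 s
    have h2 : ‖E * N‖ = 1 := by
      rw [norm_isometry_mul _ hE, ← sq_eq_sq₀ (norm_nonneg _) zero_le_one, hN, hnorm]
      norm_num
    have h3 : ‖E * D * (E * N)ᴴ‖ ^ 2 = s ^ 2 := by
      have e1 : E * D * (E * N)ᴴ = E * (D * N) * Eᴴ := by
        rw [Matrix.conjTranspose_mul, hN, hherm]
        simp only [Matrix.mul_assoc]
      rw [e1, norm_mul_coisometry _ (by simpa [E] using hE),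
        norm_isometry_mul _ hE, hD, hN, hmul, hnorm]
      ring
    have h4 := aHatGeom_mul_norm_sq_le A hzr two_pos hred hw
    rw [h2, one_pow, mul_one] at h4
    refine h4.trans ((qform_le A _).trans_eq ?_)
    rw [norm_dproj_sq hw, h3, h1, hnorm]
    ring

theorem isGLB_aHatGeom_zero {n r m : ℕ} (hr : 1 < r) (hrn : r ≤ n)
    (A : Fin m → Matrix (Fin n) (Fin n) ℂ) {S : Set (Matrix (Fin n) (Fin r) ℂ)}
    (h1 : ∀ z, ‖z‖ = 1 → z ∈ S) (h2 : ∀ z ∈ S, z ≠ 0) : IsGLB (aHatGeom A '' S) 0 := by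
  constructor
  · rintro _ ⟨z, hz, rfl⟩
    exact aHatGeom_nonneg A (h2 z hz)
  · intro b hb
    have hlim : Tendsto (fun s : ℝ => (∑ j, ‖A j‖ ^ 2) * (4 * s ^ 2)) (𝓝[>] 0) (𝓝 0) := by
      have : Continuous fun s : ℝ => (∑ j, ‖A j‖ ^ 2) * (4 * s ^ 2) := by fun_prop
      have h3 := (this.tendsto 0).mono_left (nhdsWithin_le_nhds (s := Set.Ioi 0))
      simpa using h3
    refine ge_of_tendsto hlim ?_
    filter_upwards [Ioo_mem_nhdsGT (one_pos : (0 : ℝ) < 1)] with s hs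
    obtain ⟨z, hz, hle⟩ := exists_aHatGeom_le hr hrn A hs.1 hs.2
    exact (hb ⟨z, h1 z hz, rfl⟩).trans hle

theorem ne_zero_of_norm_eq_one {n r : ℕ} {z : Matrix (Fin n) (Fin r) ℂ} (hz : ‖z‖ = 1) : z ≠ 0 :=
  norm_ne_zero_iff.1 (by rw [hz]; exact one_ne_zero)

/-- A global lower bound for the metric `d` would bound `â` from below on the unit sphere. -/
theorem isGLB_quotient_dMetric_zero {n r m : ℕ} (hr : 1 < r) (hrn : r ≤ n)
    (A : Fin m → Matrix (Fin n) (Fin n) ℂ) :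
    IsGLB {s | ∃ x y : Matrix (Fin n) (Fin r) ℂ, ¬ UEquiv x y ∧
        s = betaDistSq A x y / dMetric x y ^ 2} 0 := by
  constructor
  · rintro _ ⟨x, y, -, rfl⟩
    exact quotient_nonneg A x y _
  · intro b hb
    have hglb := isGLB_aHatGeom_zero hr hrn A (S := {z | ‖z‖ = 1}) (fun _ h => h)
      fun _ h => ne_zero_of_norm_eq_one h
    have h4 : 4 * b ≤ 0 := by
      refine hglb.2 ?_
      rintro _ ⟨z, hz, rfl⟩
      have hz0 := ne_zero_of_norm_eq_one hz
      have h1 : b ≤ aHatGeom A z / (4 * ‖z‖ ^ 2) := by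
        refine ge_of_tendsto (tendsto_localInfHat A hz0).1 ?_
        filter_upwards [self_mem_nhdsWithin] with R hR
        refine le_csInf (localInfHat1_set_nonempty A hz0 hR) ?_
        rintro _ ⟨x, -, -, h, rfl⟩
        exact hb ⟨x, z, h, rfl⟩
      rw [show ‖z‖ = 1 from hz] at h1
      linarith
    linarith

end PhaseRetrieval

theorem theorem4p1 {n r m : ℕ} (hr : 0 < r) (hrn : r ≤ n)
    (A : Fin m → Matrix (Fin n) (Fin n) ℂ) (hA : ∀ j, (A j).IsHermitian) :
    -- the local quantities are well defined at every z of rank k > 0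
    (∀ (k : ℕ) (z : Matrix (Fin n) (Fin r) ℂ), z.rank = k → 0 < k →
      (∃ zhat : Matrix (Fin n) (Fin k) ℂ, IsReduction z zhat) ∧
      (∃ (U1 : Matrix (Fin n) (Fin k) ℂ) (U2 : Matrix (Fin n) (Fin (n - k)) ℂ),
        IsAdapted z U1 U2) ∧
      (∀ zhat : Matrix (Fin n) (Fin k) ℂ, IsReduction z zhat →
        IsLeast (tangentValues A zhat) (aGeom A z) ∧
        IsLeast (horizontalValues A zhat) (aHatGeom A z)) ∧
      Tendsto (localInf1 A z) (𝓝[>] 0) (𝓝 (aOne A z)) ∧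
      Tendsto (localInf2 A z) (𝓝[>] 0) (𝓝 (aTwo A z)) ∧
      Tendsto (localInfHat1 A z) (𝓝[>] 0) (𝓝 (aHatOne A z)) ∧
      Tendsto (localInfHat2 A z) (𝓝[>] 0) (𝓝 (aHatTwo A z))) ∧
    -- the global bound as an infimum of tangent-space quantities
    IsGLB (aGeom A '' {z : Matrix (Fin n) (Fin r) ℂ | z ≠ 0}) (aGlobal r A) ∧
    -- the local bounds for the Frobenius distance of `xx*` and `yy*`
    (∀ z : Matrix (Fin n) (Fin r) ℂ, z ≠ 0 →
      aGlobal r A ≤ aTwo A z ∧ aTwo A z ≤ aOne A z ∧ aOne A z ≤ aGeom A z) ∧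
    IsGLB (aOne A '' {z : Matrix (Fin n) (Fin r) ℂ | z ≠ 0}) (aGlobal r A) ∧
    IsGLB (aTwo A '' {z : Matrix (Fin n) (Fin r) ℂ | z ≠ 0}) (aGlobal r A) ∧
    -- the eigenvalue formula for `a(z)`
    (∀ (k : ℕ) (z : Matrix (Fin n) (Fin r) ℂ), z.rank = k → 0 < k →
      ∀ (U1 : Matrix (Fin n) (Fin k) ℂ) (U2 : Matrix (Fin n) (Fin (n - k)) ℂ),
        IsAdapted z U1 U2 → aGeom A z = lam (2 * n * k - k ^ 2) (qMat A U1 U2)) ∧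
    -- behaviour of the normalized `â` for one column
    (r = 1 →
      (∀ z : Matrix (Fin n) (Fin r) ℂ, z ≠ 0 →
        aHatGeom A z / (4 * ‖z‖ ^ 2) ≤ aGeom A z ∧
        aGeom A z ≤ aHatGeom A z / (2 * ‖z‖ ^ 2)) ∧
      (PhaseRetrievable r A →
        0 < sInf (aHatGeom A '' {z : Matrix (Fin n) (Fin r) ℂ | ‖z‖ = 1}))) ∧
    -- no lower bound for the metric `d` with more than one column
    (1 < r →
      IsGLB (aHatGeom A '' {z : Matrix (Fin n) (Fin r) ℂ | z ≠ 0}) 0 ∧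
      IsGLB (aHatGeom A '' {z : Matrix (Fin n) (Fin r) ℂ | ‖z‖ = 1}) 0 ∧
      IsGLB {s | ∃ x y : Matrix (Fin n) (Fin r) ℂ, ¬ UEquiv x y ∧
        s = betaDistSq A x y / dMetric x y ^ 2} 0) ∧
    -- the local bounds for the metric `d`
    (∀ z : Matrix (Fin n) (Fin r) ℂ, z ≠ 0 →
      aHatOne A z = aHatTwo A z ∧ aHatTwo A z = 1 / (4 * ‖z‖ ^ 2) * aHatGeom A z) ∧
    -- the eigenvalue formula for `â(z)`
    (∀ (k : ℕ) (z : Matrix (Fin n) (Fin r) ℂ), z.rank = k → 0 < k →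
      ∀ zhat : Matrix (Fin n) (Fin k) ℂ, IsReduction z zhat →
        aHatGeom A z = lam (2 * n * k - k ^ 2) (qHatMat A zhat)) ∧
    -- comparison of `a(z)` and `â(z)`
    (∀ (k : ℕ) (z : Matrix (Fin n) (Fin r) ℂ), z.rank = k → 0 < k →
      1 / (4 * ‖z‖ ^ 2) * aHatGeom A z ≤ aGeom A z ∧
      aGeom A z ≤ 1 / (2 * sigma k z ^ 2) * aHatGeom A z) ∧
    -- the global bound as a minimum over the unitary group
    IsLeast (Set.range fun U : Matrix.unitaryGroup (Fin n) ℂ =>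
      lam (2 * n * r - r ^ 2) (qMat A (leftCols hrn (U : Matrix (Fin n) (Fin n) ℂ))
        (rightCols hrn (U : Matrix (Fin n) (Fin n) ℂ)))) (aGlobal r A) ∧
    -- the global bound and the infimum of `â` over orthonormal columns
    (1 / 4 * sInf (aHatGeom A '' {z : Matrix (Fin n) (Fin r) ℂ | zᴴ * z = 1}) ≤ aGlobal r A ∧
      aGlobal r A ≤
        1 / 2 * sInf (aHatGeom A '' {z : Matrix (Fin n) (Fin r) ℂ | zᴴ * z = 1})) := by
  have hn : 0 < n := hr.trans_le hrn
  have hne {k : ℕ} {z : Matrix (Fin n) (Fin r) ℂ} (hz : z.rank = k) (hk : 0 < k) : z ≠ 0 :=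
    ne_zero_of_rank_pos (hz.symm ▸ hk)
  have hkn {k : ℕ} {z : Matrix (Fin n) (Fin r) ℂ} (hz : z.rank = k) : k ≤ n := by
    rw [← hz]; simpa using z.rank_le_height
  have hpos {z : Matrix (Fin n) (Fin r) ℂ} (hz : z ≠ 0) : 0 < ‖z‖ ^ 2 := by
    have := norm_pos_iff.2 hz
    positivity
  refine ⟨?_, isGLB_aGeom hr hn A, ?_, ?_, ?_, ?_, ?_, ?_, ?_, ?_, ?_, ?_, ?_⟩
  · intro k z hz hk
    have hz0 := hne hz hk
    refine ⟨exists_isReduction z hz, exists_isAdapted z hz, fun zhat h =>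
      ⟨isLeast_aGeom_reduction A hz0 h, isLeast_aHatGeom A hz hk h⟩,
      tendsto_localInf1 A hz0, tendsto_localInf2 A hz0, ?_, ?_⟩
    · rw [aHatOne_eq A hz0]
      exact (tendsto_localInfHat A hz0).1
    · rw [aHatTwo_eq A hz0]
      exact (tendsto_localInfHat A hz0).2
  · exact fun z hz => ⟨aGlobal_le_aTwo A hz, aTwo_le_aOne A hz, aOne_le_aGeom A hz⟩
  · exact isGLB_of_between hr hn A _
      (fun z hz => (aGlobal_le_aTwo A hz).trans (aTwo_le_aOne A hz)) fun z hz => aOne_le_aGeom A hz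
  · exact isGLB_of_between hr hn A _ (fun z hz => aGlobal_le_aTwo A hz)
      fun z hz => (aTwo_le_aOne A hz).trans (aOne_le_aGeom A hz)
  · intro k z hz hk U1 U2 hU
    exact (lam_qMat_eq hA hk (hkn hz) hU (isLeast_aGeom A (hne hz hk))).symm
  · rintro rfl
    constructor
    · intro z hz
      have h := hpos hz
      rw [div_le_iff₀ (by positivity), le_div_iff₀ (by positivity), mul_comm (aGeom A z)]
      refine ⟨aHatGeom_le_four_norm_sq_mul A rfl (rank_pos_of_ne_zero hz), ?_⟩
      exact aGeom_mul_le_aHatGeom_of_one_column A hz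
    · intro hPR
      have h0 := aGlobal_pos hr hrn hPR
      refine lt_of_lt_of_le (by linarith : 0 < aGlobal 1 A * 2) (le_csInf ?_ ?_)
      · obtain ⟨z, hz⟩ := exists_ne_zero_matrix hr hn
        exact ⟨_, ‖z‖⁻¹ • z, norm_inv_norm_smul hz, rfl⟩
      · rintro _ ⟨z, hz, rfl⟩
        have hz0 := ne_zero_of_norm_eq_one hz
        have h1 := aGeom_mul_le_aHatGeom_of_one_column A hz0
        rw [show ‖z‖ = 1 from hz] at h1
        linarith [aGlobal_le_aGeom A hz0]
  · intro hr1
    exact ⟨isGLB_aHatGeom_zero hr1 hrn A (fun _ h => ne_zero_of_norm_eq_one h) fun _ h => h,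
      isGLB_aHatGeom_zero hr1 hrn A (fun _ h => h) fun _ h => ne_zero_of_norm_eq_one h,
      isGLB_quotient_dMetric_zero hr1 hrn A⟩
  · intro z hz
    rw [aHatOne_eq A hz, aHatTwo_eq A hz]
    exact ⟨rfl, by ring⟩
  · intro k z hz hk zhat h
    exact (lam_qHatMat_eq hA hk (hkn hz) h.2.1 (isLeast_aHatGeom A hz hk h)).symm
  · intro k z hz hk
    have h := hpos (hne hz hk)
    have hs := sigma_pos hz hk
    rw [one_div_mul_eq_div, one_div_mul_eq_div, div_le_iff₀ (by positivity),
      le_div_iff₀ (by positivity)]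
    obtain ⟨zhat, hred⟩ := exists_isReduction z hz
    refine ⟨?_, aGeom_mul_le_aHatGeom A hz hk hred (sigma_sq_mul_norm_sq_le_reduction hz hk hred)⟩
    rw [mul_comm]
    exact aHatGeom_le_four_norm_sq_mul A hz hk
  · have hlam (U : Matrix (Fin n) (Fin n) ℂ) (hU : U ∈ Matrix.unitaryGroup (Fin n) ℂ) :
        lam (2 * n * r - r ^ 2) (qMat A (leftCols hrn U) (rightCols hrn U)) =
            aGeom A (leftCols hrn U) ∧ aGlobal r A ≤ aGeom A (leftCols hrn U) := by
      have hiso := conjTranspose_mul_self_of_mem hU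
      have hz0 : leftCols hrn U ≠ 0 :=
        ne_zero_of_rank_pos (by rw [rank_of_isometry (leftCols_isometry hrn hiso)]; exact hr)
      exact ⟨lam_qMat_eq hA hr hrn (isAdapted_cols hrn hiso) (isLeast_aGeom A hz0),
        aGlobal_le_aGeom A hz0⟩
    constructor
    · obtain ⟨U, hU, he⟩ := exists_unitary_aGeom_eq_aGlobal hr hrn A
      exact ⟨⟨U, hU⟩, ((hlam U hU).1.trans he)⟩
    · rintro _ ⟨U, rfl⟩
      exact (hlam U U.2).2.trans_eq (hlam U U.2).1.symm
  · have hz0 (z : Matrix (Fin n) (Fin r) ℂ) (hz : zᴴ * z = 1) : z ≠ 0 :=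
      ne_zero_of_rank_pos (by rw [rank_of_isometry hz]; exact hr)
    obtain ⟨U, hU, he⟩ := exists_unitary_aGeom_eq_aGlobal hr hrn A
    have hiso := leftCols_isometry hrn (conjTranspose_mul_self_of_mem hU)
    constructor
    · have h1 := (comparison_of_isometry hr A hiso).1
      have h2 : sInf (aHatGeom A '' {z : Matrix (Fin n) (Fin r) ℂ | zᴴ * z = 1}) ≤
          aHatGeom A (leftCols hrn U) := by
        refine csInf_le ⟨0, ?_⟩ ⟨_, hiso, rfl⟩
        rintro _ ⟨z, hz, rfl⟩
        exact aHatGeom_nonneg A (hz0 z hz)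
      rw [← he]
      linarith
    · have h2 : 2 * aGlobal r A ≤
          sInf (aHatGeom A '' {z : Matrix (Fin n) (Fin r) ℂ | zᴴ * z = 1}) := by
        refine le_csInf ⟨_, _, hiso, rfl⟩ ?_
        rintro _ ⟨z, hz, rfl⟩
        have h3 := (comparison_of_isometry hr A hz).2
        linarith [aGlobal_le_aGeom A (hz0 z hz)]
      linarith
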